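/- **Setting.** Let $d\ge 1$, $T\ge 0$, $\mathcal X=[0,1)^d$. Let $m_0$ be a probability measure on $\mathcal X$ and, for $t\ge1$, let $m_t(x_{t-1},dx_t)=m_t(x_{t-1},x_t)\,dx_t$ be a Markov kernel on $\mathcal X$ with a strictly positive measurable Lebesgue density; let $G_0:\mathcal X\to[0,\infty)$ and $G_t:\mathcal X^2\to[0,\infty)$, $t\ge 1$, be measurable. Let $\widetilde{\mathbb Q}_t$ be the probability measure on $\mathcal X^{t+1}$ proportional to $G_0(x_0)\prod_{s=1}^tG_s(x_{s-1},x_s)\; m_0(dx_0)\prod_{s=1}^t m_s(x_{s-1},dx_s)$, and $\mathbb Q_t$ its marginal in $x_t$. For measures on $[0,1]^k$, $\|\mu-\nu\|_E=\sup_B|\mu(B)-\nu(B)|$ over boxes $B=\prod_i[a_i,b_i]$, $0\le a_i<b_i<1$; for points $p^1,\dots,p^N$ put $\mathcal S(p^{1:N})=N^{-1}\sum_n\delta_{p^n}$, and $D(u^{1:N})=\|\mathcal S(u^{1:N})-\lambda_k\|_E$ for $u^{1:N}$ in $[0,1)^k$. For a probability measure $\pi$ on $[0,1)^d$, the Rosenblatt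 transform $F_\pi$ has as $i$-th coordinate the CDF of $x_i$ conditional on $x_{1:i-1}$, evaluated at $x_i$; $F_K(x',x)$ is the Rosenblatt transform of $K(x',\cdot)$ for a kernel $K$. For a probability measure on $[0,1)$, $F^{-1}(u)=\inf\{x\in[0,1):F(x)\ge u\}$. Let $H$ be a Hilbert curve in $[0,1]^d$ with $H(0)=0$: a limit of dyadic curves that at each level $m$ run through all $2^{dm}$ dyadic cubes of side $2^{-m}$, consecutive cubes being adjacent and the orders at successive levels being nested. Let $h:[0,1)^d\to[0,1)$ satisfy $H(h(x))=x$, and let $H_T(h_0,\dots,h_T)=(H(h_0),\dots,H(h_T))$. **Forward pass (SQMC).** For each $N\ge1$, let $u_0^{1:N}$ be points in $[0,1)^d$ and, for $1\le t\le T$, let $u_t^n=(\alpha_t^n,\beta_t^n)$, $n\le N$, be points in $[0,1)\times[0,1)^{d}$ with $\alpha_t^n$ nondecreasing in $n$. All point sets may depend on $N$, and $D(u_t^{1:N})\to0$ as $N\to\infty$ for all $t\in\{0,\dots,T\}$. Set $x_0^n=F_{m_0}^{-1}(u_0^n)$, $W_0^n=G_0(x_0^n)/\sum_kG_0(x_0^k)$.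 For $t=1,\dots,T$: let $\sigma$ be a permutation sorting $h(x_{t-1}^{1:N})$ in nondecreasing order; let $a^n$ be the smallest $a$ with $\alpha_t^n\le\sum_{i\le a}W_{t-1}^{\sigma(i)}$; set $\hat x_{t-1}^n=x_{t-1}^{\sigma(a^n)}$, $x_t^n=F_{m_t}^{-1}(\hat x_{t-1}^n,\beta_t^n)$ and $W_t^n=G_t(\hat x_{t-1}^n,x_t^n)/\sum_kG_t(\hat x_{t-1}^k,x_t^k)$. Let $\widehat{\mathbb Q}^N_{t,h}=\sum_nW_t^n\delta_{h(x_t^n)}$ and $b_t^N=\max_nh(x_t^n)$. **Backward kernels.** For $t\in\{1,\dots,T\}$ let $$\tilde G_t(x_{t-1},x_t)=\frac{m_t(x_{t-1},x_t)G_t(x_{t-1},x_t)}{\int m_t(y,x_t)G_t(y,x_t)\,\mathbb Q_{t-1}(dy)},\qquad \mathcal M_{t,\mathbb Q_{t-1}}(x_t,dx_{t-1})=\tilde G_t(x_{t-1},x_t)\,\mathbb Q_{t-1}(dx_{t-1}),$$ and let $\mathcal M^{h}_{t,N}(h_t,dh_{t-1})$ be the probability measure proportional to $m_t(H(h_{t-1}),H(h_t))\,G_t(H(h_{t-1}),H(h_t))\,\widehat{\mathbb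 Q}^N_{t-1,h}(dh_{t-1})$, for $h_t\in A:=\{s\in[0,1):H(s)\in[0,1)^d\}$. **Assumptions.** For all $t\in\{0,\dots,T\}$ in 1–4 (when $t=0$, omit the argument $x'$) and all $t\in\{1,\dots,T\}$ in 5–7: 1. for every $N$, the points $x_t^{1:N}$ are pairwise distinct; 2. $G_t$ is continuous and bounded; 3. (a) for fixed $x'$, the $i$-th coordinate of $F_{m_t}(x',x)$ is strictly increasing in $x_i$, for all $i$; (b) $F_{m_t}(x',x)$ is Hölder continuous in $(x',x)$; (c) the conditional laws of $x_i$ given $x_{1:i-1}$ under $m_t(x',dx)$ have uniformly bounded Lebesgue densities; 4. $\mathbb Q_t$ has a strictly positive bounded Lebesgue density; 5. $\tilde G_t$ is continuous and bounded; 6. $F_{\mathcal M_{t,\mathbb Q_{t-1}}}(x_t,x_{t-1})$ satisfies (a) and (b) of 3; 7. the CDF $(x_t,x_{t-1})\mapsto\mathcal M_{t,\mathbb Q_{t-1}}\big(x_t,\prod_i[0,x_{t-1,i}]\big)$ is Hölder continuous. **Continuous backward pass.** For each $N$, let $\mathsf Q^N$ be a probability measure on $[0,1)$ with CDF continuous on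 $[0,1)$, strictly increasing on $[0,b_T^N]$ and equal to $1$ at $b_T^N$, with $\|\mathsf Q^N-\widehat{\mathbb Q}^N_{T,h}\|_E\to0$ as $N\to\infty$. For $t\in\{1,\dots,T\}$ let $K_t^N$ be a Markov kernel on $[0,1)$ whose CDF $F_{K_t^N}(h_t,h_{t-1})$ is continuous on $A\times[0,b_{t-1}^N]$ and, for every $h_t\in[0,1)$, strictly increasing in $h_{t-1}\in[0,b_{t-1}^N]$ and equal to $1$ at $h_{t-1}=b_{t-1}^N$, with $\sup_{h_t\in A}\|K_t^N(h_t,\cdot)-\mathcal M^{h}_{t,N}(h_t,\cdot)\|_E\to0$ as $N\to\infty$. Let $\tilde u^{1:N}$ be point sets in $[0,1)^{T+1}$ with $D(\tilde u^{1:N})\to0$. Let $\check h_{0:T}^n$ be the image of $\tilde u^n$ by the inverse Rosenblatt transform of $\mathsf Q^N(dh_T)\prod_{t=1}^TK_t^N(h_t,dh_{t-1})$, with coordinates in the order $h_T,\dots,h_0$: $\check h_T^n=F_{\mathsf Q^N}^{-1}(\tilde u_T^n)$ and $\check h_{t-1}^n=F_{K_t^N}^{-1}(\check h_t^n,\tilde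 u_{t-1}^n)$ for $t=T,\dots,1$. Let $\check x_{0:T}^n=H_T(\check h_{0:T}^n)$. **Conclusion.** $\ \|\mathcal S(\check x_{0:T}^{1:N})-\widetilde{\mathbb Q}_T\|_E\to0$ as $N\to\infty$. -/

import Mathlib

open MeasureTheory ProbabilityTheory Filter Topology

noncomputable section

/-! ### The unit interval, the state space, and the extreme norm -/

/-- The half-open unit interval `[0,1)`. -/
abbrev UI : Type := Set.Ico (0 : ℝ) 1

instance instInhabitedUI : Inhabited UI := ⟨⟨0, le_refl _, zero_lt_one⟩⟩

/-- Lebesgue measure on `[0,1)`. -/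
instance instMeasureSpaceUI : MeasureSpace UI where
  volume := Measure.comap (fun x : UI => (x : ℝ)) volume

/-- The state space `[0,1)^d`. Its measure `volume` is Lebesgue measure. -/
abbrev State (d : ℕ) : Type := Fin d → UI

/-- The closed boxes `∏ [a_i, b_i]` with `0 ≤ a_i < b_i < 1`. -/
def boxes (ι : Type) : Set (Set (ι → ℝ)) :=
  {B | ∃ a b : ι → ℝ, (∀ i, 0 ≤ a i ∧ a i < b i ∧ b i < 1) ∧ B = Set.Icc a b}

/-- The extreme norm `‖μ - ν‖_E = sup_B |μ(B) - ν(B)|`, over the boxes `B` above. -/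
def extremeNorm {ι : Type} [Fintype ι] (μ ν : Measure (ι → ℝ)) : ℝ :=
  ⨆ B : boxes ι, |μ.real (B : Set (ι → ℝ)) - ν.real (B : Set (ι → ℝ))|

/-- The empirical measure `S(p^{1:N}) = N⁻¹ ∑ δ_{p^n}`. -/
def empirical {ι : Type} [Fintype ι] {N : ℕ} (p : Fin N → ι → ℝ) : Measure (ι → ℝ) :=
  (N : ENNReal)⁻¹ • ∑ n, Measure.dirac (p n)

/-- The extreme discrepancy of a point set in `[0,1)^k`. -/
def discrepancy {k N : ℕ} (u : Fin N → Fin k → UI) : ℝ :=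
  extremeNorm (empirical fun n i => (u n i : ℝ)) volume

/-- The extreme norm for measures on `[0,1)`. -/
def extremeNormUI (μ ν : Measure UI) : ℝ :=
  extremeNorm (μ.map fun (x : UI) (_ : Fin 1) => (x : ℝ)) (ν.map fun (x : UI) (_ : Fin 1) => (x : ℝ))

/-- `∑ w_n δ_{p_n}`. -/
def weightedDirac {α : Type} [MeasurableSpace α] {N : ℕ} (w : Fin N → ℝ) (p : Fin N → α) :
    Measure α :=
  ∑ n, ENNReal.ofReal (w n) • Measure.dirac (p n)

/-- The probability measure proportional to `μ`. -/
def normalizeMeasure {α : Type} [MeasurableSpace α] (μ : Measure α) : Measure α :=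
  (μ Set.univ)⁻¹ • μ

/-- The cumulative distribution function of a distribution on `[0,1)`. -/
def cdfUI (μ : Measure UI) (x : UI) : ℝ := μ.real (Set.Iic x)

/-- The inverse CDF, `inf {x ∈ [0,1) : F(x) ≥ u}`. -/
def quantile (μ : Measure UI) (u : UI) : UI := sInf {x | (u : ℝ) ≤ cdfUI μ x}

/-- Hölder continuity with some exponent in `(0,1]`. -/
def IsHolder {α β : Type} [PseudoEMetricSpace α] [PseudoEMetricSpace β] (f : α → β) : Prop :=
  ∃ C r : NNReal, 0 < r ∧ r ≤ 1 ∧ HolderWith C r f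

/-! ### The Rosenblatt transform -/

/-- Markov kernels giving, for each `i`, a law of the `i`-th coordinate for each value of the
preceding coordinates. -/
abbrev CondLaws (d : ℕ) : Type := ∀ i : Fin d, Kernel ({j : Fin d // j < i} → UI) UI

/-- The coordinates that precede the `i`-th one. -/
def past {d : ℕ} (i : Fin d) (x : State d) : {j : Fin d // j < i} → UI := fun j => x j

/-- `κ i` is a regular conditional distribution of `x_i` given `x_{1:i-1}` under `π`. -/
def IsCondLaws {d : ℕ} (π : Measure (State d)) (κ : CondLaws d) : Prop :=
  ∀ i, IsMarkovKernel (κ i) ∧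
    (π.map (past i)).compProd (κ i) = π.map fun x => (past i x, x i)

/-- The Rosenblatt transform: the `i`-th coordinate is the conditional CDF of `x_i` given
`x_{1:i-1}`, evaluated at `x_i`. -/
def rosenblatt {d : ℕ} (κ : CondLaws d) (x : State d) : Fin d → ℝ :=
  fun i => cdfUI (κ i (past i x)) (x i)

/-- The inverse Rosenblatt transform. -/
def rosenblattInv {d : ℕ} (κ : CondLaws d) (v : State d) : State d :=
  Function.invFun (rosenblatt κ) fun i => (v i : ℝ)

/-- `κ x'` gives the conditional distributions of the kernel `K(x', dx)`; the corresponding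
Rosenblatt transform `F_K(x', x)` is strictly increasing in `x_i` in its `i`-th coordinate, and is
Hölder continuous in `(x', x)`. -/
def RosenblattRegular {d : ℕ} (K : State d → Measure (State d)) (κ : State d → CondLaws d) :
    Prop :=
  (∀ x', IsCondLaws (K x') (κ x')) ∧
  (∀ x' x i, StrictMono fun c : UI => rosenblatt (κ x') (Function.update x i c) i) ∧
  IsHolder fun p : State d × State d => rosenblatt (κ p.1) p.2

/-- The conditional distributions have Lebesgue densities with a common bound. -/
def BoundedCondDensities {d : ℕ} (κ : State d → CondLaws d) : Prop :=
  ∃ C : ℝ, ∀ x' i z, ∃ p : UI → ℝ, Measurable p ∧ (∀ y, 0 ≤ p y ∧ p y ≤ C) ∧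
    κ x' i z = volume.withDensity fun y => ENNReal.ofReal (p y)

/-! ### The Hilbert curve -/

/-- The combinatorial data of a Hilbert curve: at each level `m`, an enumeration of the `2^(dm)`
dyadic cubes of side `2^(-m)`. The `k`-th one is `S_m(k) = ∏_j [c_j 2^(-m), (c_j + 1) 2^(-m)]`
with `c = cell m k`. -/
structure HilbertOrder (d : ℕ) where
  cell : ℕ → ℕ → Fin d → ℕ
  bijOn : ∀ m, Set.BijOn (cell m) (Set.Iio (2 ^ (d * m))) {c | ∀ j, c j < 2 ^ m}
  /-- The cubes `S_{m+1}(2^d k + i)`, `i < 2^d`, subdivide `S_m(k)`. -/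
  nested : ∀ m k, k < 2 ^ (d * (m + 1)) → ∀ j, cell (m + 1) k j / 2 = cell m (k / 2 ^ d) j
  /-- The cubes `S_m(k)` and `S_m(k+1)` touch, and for `d ≥ 2` have an edge in common. -/
  adjacent : ∀ m k, k + 1 < 2 ^ (d * m) →
    (∀ j, cell m k j ≤ cell m (k + 1) j + 1 ∧ cell m (k + 1) j ≤ cell m k j + 1) ∧
    (2 ≤ d → ∃ j, cell m k j = cell m (k + 1) j)

/-- The Hilbert curve `H : [0,1) → [0,1]^d`, as the limit of the curves `H_m` that send `x` to the
lower corner of the cube `S_m(k)` with `k 2^(-dm) ≤ x < (k+1) 2^(-dm)`. The limit is a supremum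
because the cubes are nested. -/
def HilbertOrder.curve {d : ℕ} (H : HilbertOrder d) (x : UI) : Fin d → ℝ :=
  fun j => ⨆ m : ℕ, (H.cell m ⌊(x : ℝ) * 2 ^ (d * m)⌋₊ j : ℝ) / 2 ^ m

/-- The set of `s ∈ [0,1)` with `H(s) ∈ [0,1)^d`. -/
def HilbertOrder.domain {d : ℕ} (H : HilbertOrder d) : Set UI := {s | ∀ j, H.curve s j < 1}

/-- `H(s)` as a point of `[0,1)^d`, for `s` in the domain above (elsewhere, coordinates equal to
one are replaced by zero). -/
def HilbertOrder.toState {d : ℕ} (H : HilbertOrder d) (s : UI) : State d :=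
  fun j => ⟨Int.fract (H.curve s j), Int.fract_nonneg _, Int.fract_lt_one _⟩

/-! ### The Feynman-Kac model -/

/-- Initial law `m_0`, transition densities `m_t(x_{t-1}, x_t)` for `t ≥ 1`, and potentials `G_0`
and `G_t(x_{t-1}, x_t)` for `t ≥ 1`. The values of `m` and `G` at time index zero are not used. -/
structure FeynmanKac (d : ℕ) where
  init : Measure (State d)
  init_prob : IsProbabilityMeasure init
  m : ℕ → State d → State d → ℝ
  m_meas : ∀ t, 1 ≤ t → Measurable (Function.uncurry (m t))
  m_pos : ∀ t, 1 ≤ t → ∀ x' x, 0 < m t x' x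
  m_int : ∀ t, 1 ≤ t → ∀ x', ∫⁻ x, ENNReal.ofReal (m t x' x) = 1
  G₀ : State d → ℝ
  G₀_meas : Measurable G₀
  G₀_nonneg : ∀ x, 0 ≤ G₀ x
  G : ℕ → State d → State d → ℝ
  G_meas : ∀ t, 1 ≤ t → Measurable (Function.uncurry (G t))
  G_nonneg : ∀ t, 1 ≤ t → ∀ x' x, 0 ≤ G t x' x

namespace FeynmanKac

variable {d : ℕ} (M : FeynmanKac d)

/-- The transition kernel `m_t(x_{t-1}, dx_t)`. -/
def transition (t : ℕ) (x' : State d) : Measure (State d) :=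
  volume.withDensity fun x => ENNReal.ofReal (M.m t x' x)

/-- The law of `x_{0:T}`: `m_0(dx_0) ∏ m_t(x_{t-1}, x_t) dx_t`. -/
def chainLaw (T : ℕ) : Measure (Fin (T + 1) → State d) :=
  (Measure.pi (Fin.cons (α := fun _ => Measure (State d)) M.init fun _ => volume)).withDensity
    fun x => ∏ s : Fin T, ENNReal.ofReal (M.m (s + 1) (x s.castSucc) (x s.succ))

/-- `G_0(x_0) ∏ G_t(x_{t-1}, x_t)`. -/
def potential (T : ℕ) (x : Fin (T + 1) → State d) : ℝ :=
  M.G₀ (x 0) * ∏ s : Fin T, M.G (s + 1) (x s.castSucc) (x s.succ)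

/-- The smoothing distribution on `[0,1)^{d(T+1)}`. -/
def smoothing (T : ℕ) : Measure (Fin (T + 1) → State d) :=
  normalizeMeasure ((M.chainLaw T).withDensity fun x => ENNReal.ofReal (M.potential T x))

/-- The filtering distribution `Q_t`: the last marginal of the smoothing distribution. -/
def filtering (t : ℕ) : Measure (State d) :=
  (M.smoothing t).map fun x => x (Fin.last t)

/-- The function `G̃_t(x_{t-1}, x_t)`, for a given law `π` of `x_{t-1}`. -/
def Gtilde (t : ℕ) (π : Measure (State d)) (x' x : State d) : ℝ :=
  M.m t x' x * M.G t x' x / ∫ y, M.m t y x * M.G t y x ∂π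

/-- The backward kernel `ℳ_{t,π}(x_t, dx_{t-1}) = G̃_t(x_{t-1}, x_t) π(dx_{t-1})`. -/
def backward (t : ℕ) (π : Measure (State d)) (x : State d) : Measure (State d) :=
  π.withDensity fun x' => ENNReal.ofReal (M.Gtilde t π x' x)

/-- The backward kernel on `[0,1)`, obtained through the Hilbert curve:
`ℳ^h_{t,π}(h_t, dh_{t-1}) ∝ m_t(H(h_{t-1}), H(h_t)) G_t(H(h_{t-1}), H(h_t)) π(dh_{t-1})`. -/
def backwardHilbert (H : HilbertOrder d) (t : ℕ) (π : Measure UI) (s : UI) : Measure UI :=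
  normalizeMeasure (π.withDensity fun s' =>
    ENNReal.ofReal (M.m t (H.toState s') (H.toState s) * M.G t (H.toState s') (H.toState s)))

end FeynmanKac

/-! ### The SQMC algorithm -/

/-- The resampled index `σ(a)`, where `a` is the smallest index with
`u ≤ ∑_{i ≤ a} W^{σ(i)}`. (The value `n` is used only if there is no such index, which cannot
happen for weights that sum to one.) -/
def ancestor {N : ℕ} (W : Fin N → ℝ) (σ : Equiv.Perm (Fin N)) (u : UI) (n : Fin N) : Fin N :=
  open Classical in
  if hk : ∃ k : Fin N, (u : ℝ) ≤ ∑ i ∈ Finset.univ.filter (· ≤ k), W (σ i) then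
    σ (Fin.find (fun k : Fin N => (u : ℝ) ≤ ∑ i ∈ Finset.univ.filter (· ≤ k), W (σ i)) hk)
  else n

/-- The particles `x_t^{1:N}` and weights `W_t^{1:N}` at time `t` of the SQMC algorithm.
Here `κ₀` and `κ t x'` are conditional distributions for `m_0` and `m_t(x', dx)`, `h` is the
pseudo-inverse of the Hilbert curve, and `u₀`, `u t` are the point sets in `[0,1)^d` and
`[0,1)^{d+1}` that are used at time zero and at time `t ≥ 1`. -/
def sqmc {d N : ℕ} (M : FeynmanKac d) (κ₀ : CondLaws d) (κ : ℕ → State d → CondLaws d)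
    (h : State d → UI) (u₀ : Fin N → Fin d → UI) (u : ℕ → Fin N → Fin (d + 1) → UI) :
    ℕ → (Fin N → State d) × (Fin N → ℝ)
  | 0 =>
    let x : Fin N → State d := fun n => rosenblattInv κ₀ (u₀ n)
    (x, fun n => M.G₀ (x n) / ∑ k, M.G₀ (x k))
  | t + 1 =>
    let prev := sqmc M κ₀ κ h u₀ u t
    let σ := Tuple.sort fun n => h (prev.1 n)
    let xhat : Fin N → State d := fun n => prev.1 (ancestor prev.2 σ (u (t + 1) n 0) n)
    let x : Fin N → State d := fun n =>
      rosenblattInv (κ (t + 1) (xhat n)) (Fin.tail (u (t + 1) n))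
    (x, fun n => M.G (t + 1) (xhat n) (x n) / ∑ k, M.G (t + 1) (xhat k) (x k))

/-! ### The continuous backward pass -/

/-- The CDF of `μ` is strictly increasing on `[0, b]`, and equal to one at `b`. -/
def StrictCDFUpTo (μ : Measure UI) (b : ℝ) : Prop :=
  StrictMonoOn (cdfUI μ) {x | (x : ℝ) ≤ b} ∧ ∀ x : UI, (x : ℝ) = b → cdfUI μ x = 1

/-- The inverse Rosenblatt transform of the law `Q(dh_T) ∏_{t=1}^T K_t(h_t, dh_{t-1})` on
`[0,1)^{T+1}`, whose coordinates are taken in the order `h_T, h_{T-1}, …, h_0`: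
`h_T = F_Q⁻¹(u_T)` and `h_{t-1} = F_{K_t}⁻¹(h_t, u_{t-1})`. -/
def backwardInv {T : ℕ} (Q : Measure UI) (K : ℕ → Kernel UI UI) (u : Fin (T + 1) → UI) :
    Fin (T + 1) → UI :=
  Fin.reverseInduction (motive := fun _ => UI) (quantile Q (u (Fin.last T)))
    fun i hnext => quantile (K (i + 1) hnext) (u i.castSucc)

end

/-!
The proof replaces discrepancy bounds by weak convergence. A family of weighted point sets converges
weakly (`WeakConv`) when its sums against bounded Lipschitz functions converge. Point sets of
vanishing discrepancy converge weakly to the uniform law (`weakConv_of_discrepancy`), and conversely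
weak convergence to a law that does not charge hyperplanes is convergence in the extreme norm
(`WeakConv.tendsto_extremeNorm`). In between, everything is an application of the extended
continuous mapping theorem (`WeakConv.tendsto_sum`, `WeakConv.map`): if each point `p` of the `N`-th
set carries a value, and the values converge to `g x` whenever `N → ∞` and the points tend to `x`,
for almost every `x`, then the values converge weakly to the image of the limit law by `g`. The
values may depend on `N` in an arbitrary way; no measurability or continuity is needed before the
limit.

The maps in question are quantile transforms. Quantiles converge when CDFs converge at rational
points, except at the countably many levels that the limiting CDF takes at rational points
(`tendsto_quantile_of_ne`), and a uniform level almost surely avoids these. The Hilbert curve is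
continuous and its pseudo-inverse `h` is continuous off the dyadic hyperplanes, so weighted CDFs
along the curve converge as well (`WeakConv.tendsto_sum_indicator_pseudoInverse`).

For the forward pass, resampling is a quantile transform along the curve, mutation is an inverse
Rosenblatt transform, which is jointly continuous, and reweighting is importance sampling; by
induction on time the weighted particles converge weakly to the filtering distributions
(`weakConv_sqmc`).

For the backward pass, the CDF of the particle backward kernel at a state `z` is a ratio of weighted
sums of `G̃(·, z)`. It converges continuously in `z` to the CDF of the image by `h` of the backward
kernel of the filtering distribution (`FeynmanKac.tendsto_cdfUI_kernel`). Hence the inverse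
Rosenblatt transforms of the backward chains converge at almost every point (`tendsto_backwardInv`).
The law of their limit is the smoothing distribution, because quantile transforms sample from their
kernels and because the backward kernels disintegrate the smoothing distribution
(`lintegral_toState_backwardInv`). That the limiting backward kernels have mass one at every state,
and not just at almost every state, follows from the continuity of `G̃` and the connectedness of the
state space (`FeynmanKac.integral_mG_ne_zero`).
-/

/-! ### Lebesgue measure on the unit interval -/

noncomputable section

theorem map_coe_volume_UI :
    (volume : Measure UI).map (fun x : UI => (x : ℝ)) = volume.restrict (Set.Ico 0 1) :=
  map_comap_subtype_coe measurableSet_Ico volume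

theorem volume_UI_apply {s : Set ℝ} (hs : MeasurableSet s) :
    (volume : Measure UI) ((fun x : UI => (x : ℝ)) ⁻¹' s) = volume (s ∩ Set.Ico 0 1) := by
  rw [← Measure.map_apply measurable_subtype_coe hs, map_coe_volume_UI, Measure.restrict_apply hs]

instance instIsProbabilityMeasureVolumeUI : IsProbabilityMeasure (volume : Measure UI) := ⟨by
  have := volume_UI_apply MeasurableSet.univ
  simpa using this⟩

instance instNullSingletonClassVolumeUI : NullSingletonClass (volume : Measure UI) := ⟨fun x => by
  have h : ({x} : Set UI) = (fun x : UI => (x : ℝ)) ⁻¹' {(x : ℝ)} := by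
    ext y; simp [Subtype.ext_iff]
  rw [h, volume_UI_apply (measurableSet_singleton _)]
  exact measure_mono_null Set.inter_subset_left (by simp)⟩

instance instIsProbabilityMeasureVolumeState (d : ℕ) :
    IsProbabilityMeasure (volume : Measure (State d)) := by
  rw [volume_pi]; infer_instance

theorem volume_UI_Iic (b : UI) : (volume : Measure UI) (Set.Iic b) = ENNReal.ofReal b := by
  have h : Set.Iic b = (fun x : UI => (x : ℝ)) ⁻¹' Set.Iic (b : ℝ) := by
    ext y; simp
  rw [h, volume_UI_apply measurableSet_Iic]
  have : Set.Iic (b : ℝ) ∩ Set.Ico 0 1 = Set.Icc 0 (b : ℝ) := by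
    ext y
    simp only [Set.mem_inter_iff, Set.mem_Iic, Set.mem_Ico, Set.mem_Icc]
    constructor
    · rintro ⟨h1, h2, -⟩; exact ⟨h2, h1⟩
    · rintro ⟨h1, h2⟩; exact ⟨h2, h1, h2.trans_lt b.2.2⟩
  rw [this, Real.volume_Icc, sub_zero]

instance instPreconnectedSpaceUI : PreconnectedSpace UI :=
  Subtype.preconnectedSpace isPreconnected_Ico

/-! ### Distribution functions and quantiles on the unit interval -/

theorem cdfUI_mono (μ : Measure UI) [IsFiniteMeasure μ] : Monotone (cdfUI μ) := fun _ _ hab =>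
  measureReal_mono (Set.Iic_subset_Iic.2 hab)

theorem cdfUI_nonneg (μ : Measure UI) (x : UI) : 0 ≤ cdfUI μ x := measureReal_nonneg

theorem cdfUI_le_one (μ : Measure UI) [IsProbabilityMeasure μ] (x : UI) : cdfUI μ x ≤ 1 :=
  measureReal_le_one

/-- The point `1 - 1 / (n + 2)` of `[0,1)`; these points exhaust the interval. -/
def nearOne (n : ℕ) : UI := ⟨1 - 1 / ((n : ℝ) + 2), by
  have : (0 : ℝ) < (n : ℝ) + 2 := by positivity
  constructor
  · rw [sub_nonneg, div_le_one this]; linarith [(Nat.cast_nonneg n : (0 : ℝ) ≤ n)]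
  · linarith [one_div_pos.2 this]⟩

theorem nearOne_mono : Monotone nearOne := fun m n hmn => by
  change (1 : ℝ) - 1 / ((m : ℝ) + 2) ≤ 1 - 1 / ((n : ℝ) + 2)
  have : (m : ℝ) ≤ n := by exact_mod_cast hmn
  gcongr

theorem exists_le_nearOne (b : UI) : ∃ n, b ≤ nearOne n := by
  obtain ⟨n, hn⟩ := exists_nat_gt (1 / (1 - (b : ℝ)))
  have hb : 0 < 1 - (b : ℝ) := by linarith [b.2.2]
  refine ⟨n, ?_⟩
  change (b : ℝ) ≤ 1 - 1 / ((n : ℝ) + 2)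
  have : 1 / ((n : ℝ) + 2) ≤ 1 - b := by
    rw [div_le_iff₀ (by positivity)]
    rw [div_lt_iff₀ hb] at hn
    nlinarith
  linarith

theorem tendsto_cdfUI_nearOne (μ : Measure UI) [IsProbabilityMeasure μ] :
    Tendsto (fun n => cdfUI μ (nearOne n)) atTop (𝓝 1) := by
  have h := tendsto_measure_iUnion_atTop (μ := μ)
    (s := fun n => Set.Iic (nearOne n)) (fun m n hmn => Set.Iic_subset_Iic.2 (nearOne_mono hmn))
  have hu : (⋃ n, Set.Iic (nearOne n)) = Set.univ := by
    ext b; simpa using exists_le_nearOne b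
  rw [hu, measure_univ] at h
  exact (ENNReal.tendsto_toReal ENNReal.one_ne_top).comp h

theorem exists_lt_cdfUI (μ : Measure UI) [IsProbabilityMeasure μ] (u : UI) :
    ∃ x, (u : ℝ) < cdfUI μ x :=
  ((tendsto_cdfUI_nearOne μ).eventually_const_lt u.2.2).exists.imp' nearOne fun _ h => h

theorem bddBelow_UI (s : Set UI) : BddBelow s :=
  ⟨⟨0, le_refl _, zero_lt_one⟩, fun x _ => x.2.1⟩

theorem quantile_le {μ : Measure UI} {u b : UI} (h : (u : ℝ) ≤ cdfUI μ b) : quantile μ u ≤ b :=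
  csInf_le (bddBelow_UI _) h

theorem le_quantile {μ : Measure UI} [IsProbabilityMeasure μ] {u b : UI}
    (h : cdfUI μ b < u) : b ≤ quantile μ u := by
  obtain ⟨x, hx⟩ := exists_lt_cdfUI μ u
  refine le_csInf ⟨x, hx.le⟩ fun y hy => ?_
  by_contra! hyb
  exact (h.trans_le (hy.trans (cdfUI_mono μ hyb.le))).false

theorem le_cdfUI_of_quantile_lt {μ : Measure UI} [IsProbabilityMeasure μ] {u b : UI}
    (h : quantile μ u < b) : (u : ℝ) ≤ cdfUI μ b := by
  by_contra! hb
  exact (h.trans_le (le_quantile hb)).false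

/-- The infimum defining the quantile is attained, by right continuity of the CDF. -/
theorem quantile_le_iff {μ : Measure UI} [IsProbabilityMeasure μ] {u b : UI} :
    quantile μ u ≤ b ↔ (u : ℝ) ≤ cdfUI μ b := by
  refine ⟨fun h => ?_, quantile_le⟩
  obtain ⟨c, hc_anti, hc_gt, hc⟩ := exists_seq_strictAnti_tendsto b
  have hI : (⋂ n, Set.Iic (c n)) = Set.Iic b := by
    ext y
    simp only [Set.mem_iInter, Set.mem_Iic]
    exact ⟨fun hy => ge_of_tendsto' hc hy, fun hy n => hy.trans (hc_gt n).le⟩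
  have ht := tendsto_measure_iInter_atTop (μ := μ) (s := fun n => Set.Iic (c n))
    (fun n => measurableSet_Iic.nullMeasurableSet)
    (fun m n hmn => Set.Iic_subset_Iic.2 (hc_anti.antitone hmn)) ⟨0, measure_ne_top _ _⟩
  rw [hI] at ht
  have ht' := (ENNReal.tendsto_toReal (measure_ne_top μ (Set.Iic b))).comp ht
  exact ge_of_tendsto' ht' fun n => le_cdfUI_of_quantile_lt (h.trans_lt (hc_gt n))

theorem cdfUI_eq_ofReal (μ : Measure UI) [IsFiniteMeasure μ] (b : UI) :
    ENNReal.ofReal (cdfUI μ b) = μ (Set.Iic b) :=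
  ENNReal.ofReal_toReal (measure_ne_top _ _)

/-- Unlike in `volume_UI_Iic`, the bound may be one, which is not a point of `[0,1)`. -/
theorem volume_UI_le {c : ℝ} (h0 : 0 ≤ c) (h1 : c ≤ 1) :
    (volume : Measure UI) {v | (v : ℝ) ≤ c} = ENNReal.ofReal c := by
  rcases h1.lt_or_eq with h | rfl
  · exact volume_UI_Iic ⟨c, h0, h⟩
  · have : {v : UI | (v : ℝ) ≤ 1} = Set.univ := by
      ext v; simpa using v.2.2.le
    rw [this]; simp

theorem measurable_quantile {α : Type*} [MeasurableSpace α] (κ : Kernel α UI) [IsMarkovKernel κ] :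
    Measurable fun p : α × UI => quantile (κ p.1) p.2 := by
  refine measurable_of_Iic fun b => ?_
  have : (fun p : α × UI => quantile (κ p.1) p.2) ⁻¹' Set.Iic b =
      {p | (p.2 : ℝ) ≤ (κ p.1 (Set.Iic b)).toReal} := by
    ext p; simp only [Set.mem_preimage, Set.mem_Iic, quantile_le_iff]; rfl
  rw [this]
  refine measurableSet_le (measurable_subtype_coe.comp measurable_snd) ?_
  exact ((κ.measurable_coe measurableSet_Iic).comp measurable_fst).ennreal_toReal

theorem measurable_quantile_const (μ : Measure UI) [IsProbabilityMeasure μ] :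
    Measurable (quantile μ) := by
  have := (measurable_quantile (Kernel.const Unit μ)).comp (measurable_prodMk_left (x := ()))
  simpa [Function.comp_def] using this

/-- Inverse transform sampling. -/
theorem map_quantile_volume (μ : Measure UI) [IsProbabilityMeasure μ] :
    (volume : Measure UI).map (quantile μ) = μ := by
  symm
  refine Measure.ext_of_Iic _ _ fun b => ?_
  rw [Measure.map_apply (measurable_quantile_const μ) measurableSet_Iic]
  have : quantile μ ⁻¹' Set.Iic b = {v : UI | (v : ℝ) ≤ cdfUI μ b} := by
    ext v; exact quantile_le_iff (μ := μ)
  rw [this, volume_UI_le (cdfUI_nonneg _ _) (cdfUI_le_one _ _), cdfUI_eq_ofReal]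

/-- Inverse transform sampling from a kernel. -/
theorem map_prod_quantile {α : Type*} [MeasurableSpace α] (μ : Measure α) [SFinite μ]
    (κ : Kernel α UI) [IsMarkovKernel κ] :
    (μ.prod volume).map (fun p : α × UI => (p.1, quantile (κ p.1) p.2)) = μ.compProd κ := by
  have hm : Measurable fun p : α × UI => (p.1, quantile (κ p.1) p.2) :=
    measurable_fst.prodMk (measurable_quantile κ)
  refine Measure.ext_of_lintegral _ fun f hf => ?_
  rw [lintegral_map hf hm, Measure.lintegral_compProd hf,
    lintegral_prod (fun p : α × UI => f (p.1, quantile (κ p.1) p.2)) (hf.comp hm).aemeasurable]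
  refine lintegral_congr fun a => ?_
  conv_rhs => rw [← map_quantile_volume (κ a)]
  exact (lintegral_map (hf.comp measurable_prodMk_left) (measurable_quantile_const (κ a))).symm

/-! ### Convergence of quantiles -/

/-- The positive rational points of `[0,1)`, on which convergence of CDFs is tested. -/
def ratUI : Set UI := {a | 0 < (a : ℝ) ∧ ∃ q : ℚ, (q : ℝ) = a}

theorem countable_ratUI : ratUI.Countable := by
  have : ratUI ⊆ (fun a : UI => (a : ℝ)) ⁻¹' Set.range ((↑) : ℚ → ℝ) := fun a ha => ha.2
  exact ((Set.countable_range _).preimage Subtype.val_injective).mono this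

theorem exists_ratUI_between {b c : UI} (h : b < c) : ∃ a ∈ ratUI, b < a ∧ a < c := by
  obtain ⟨q, hq1, hq2⟩ := exists_rat_btwn (Subtype.coe_lt_coe.2 h)
  exact ⟨⟨q, b.2.1.trans hq1.le, hq2.trans c.2.2⟩, ⟨b.2.1.trans_lt hq1, q, rfl⟩, hq1, hq2⟩

/-- Points `q i` that are quantiles of level `u i` of functions `F i` converge to `q₀` when the
functions converge at the rational points to a function `F₀` that crosses the level
`lim u i` at `q₀` only. -/
theorem tendsto_of_tendsto_cdf {I : Type*} {l : Filter I} {F : I → UI → ℝ} {F₀ : UI → ℝ}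
    {u : I → ℝ} {u₀ : ℝ} {q : I → UI} {q₀ : UI}
    (hF : ∀ a ∈ ratUI, Tendsto (fun i => F i a) l (𝓝 (F₀ a)))
    (hu : Tendsto u l (𝓝 u₀))
    (hle : ∀ᶠ i in l, ∀ b, F i b < u i → b ≤ q i)
    (hge : ∀ᶠ i in l, ∀ b, u i < F i b → q i ≤ b)
    (hlt : ∀ a ∈ ratUI, a < q₀ → F₀ a < u₀) (hgt : ∀ a ∈ ratUI, q₀ < a → u₀ < F₀ a) :
    Tendsto q l (𝓝 q₀) := by
  refine tendsto_order.2 ⟨fun b hb => ?_, fun b hb => ?_⟩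
  · obtain ⟨a, ha, hba, haq⟩ := exists_ratUI_between hb
    filter_upwards [hle, (hF a ha).eventually_lt hu (hlt a ha haq)] with i h1 h2
    exact hba.trans_le (h1 a h2)
  · obtain ⟨a, ha, hqa, hab⟩ := exists_ratUI_between hb
    filter_upwards [hge, hu.eventually_lt (hF a ha) (hgt a ha hqa)] with i h1 h2
    exact (h1 a h2).trans_lt hab

/-- Quantiles converge at every level `u₀` that the limiting CDF does not take at a rational point,
because such a CDF crosses the level `u₀` at one point only. The points `q i` need only be quantiles
up to ties, which covers the resampled particles. -/
theorem tendsto_quantile_of_ne {I : Type*} {l : Filter I} {F : I → UI → ℝ}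
    {u : I → ℝ} {u₀ : UI} {q : I → UI} {μ : Measure UI} [IsProbabilityMeasure μ]
    (hF : ∀ a ∈ ratUI, Tendsto (fun i => F i a) l (𝓝 (cdfUI μ a)))
    (hu : Tendsto u l (𝓝 (u₀ : ℝ)))
    (hle : ∀ᶠ i in l, ∀ b, F i b < u i → b ≤ q i)
    (hge : ∀ᶠ i in l, ∀ b, u i < F i b → q i ≤ b)
    (hne : ∀ a ∈ ratUI, (u₀ : ℝ) ≠ cdfUI μ a) :
    Tendsto q l (𝓝 (quantile μ u₀)) := by
  refine tendsto_of_tendsto_cdf hF hu hle hge (fun a _ h => ?_) fun a ha h => ?_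
  · by_contra! h'
    exact (h.trans_le (quantile_le h')).false
  · exact lt_of_le_of_ne (le_cdfUI_of_quantile_lt h) (hne a ha)

/-- Almost no level is a value of a given CDF at a rational point. -/
theorem ae_ne_cdfUI (μ : Measure UI) :
    ∀ᵐ v : UI, ∀ a ∈ ratUI, (v : ℝ) ≠ cdfUI μ a := by
  refine (ae_ball_iff countable_ratUI).2 fun a _ => ?_
  have h : {v : UI | (v : ℝ) = cdfUI μ a}.Subsingleton := fun v hv w hw =>
    Subtype.ext ((hv : (v : ℝ) = _).trans (hw : (w : ℝ) = _).symm)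
  filter_upwards [measure_eq_zero_iff_ae_notMem.1 (h.measure_zero volume)] with v hv using hv

end

/-! ### Weak convergence of weighted point sets -/

noncomputable section

section Weak

variable {X J : Type*} [PseudoMetricSpace X]
  {ι : J → Type} {l : Filter J}

/-- The filter of pairs `(j, n)` for which `j` tends to `l` and the point `p j n` tends to `x`. -/
def ptFilter (l : Filter J) (p : ∀ j, ι j → X) (x : X) : Filter (Σ j, ι j) :=
  comap Sigma.fst l ⊓ comap (fun i => p i.1 i.2) (𝓝 x)

theorem tendsto_fst_ptFilter (p : ∀ j, ι j → X) (x : X) :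
    Tendsto Sigma.fst (ptFilter l p x) l := tendsto_comap.mono_left inf_le_left

theorem tendsto_point_ptFilter (p : ∀ j, ι j → X) (x : X) :
    Tendsto (fun i : Σ j, ι j => p i.1 i.2) (ptFilter l p x) (𝓝 x) :=
  tendsto_comap.mono_left inf_le_right

/-- The `k`-Lipschitz upper envelope, truncated below by `-C`, of the values `y j n` at the points
`p j n` with `j ∈ B`. The extra index `none` carries the truncation, and makes the supremum one over
a nonempty type. -/
def lipEnvelope (B : Set J) (p : ∀ j, ι j → X) (y : ∀ j, ι j → ℝ) (C : ℝ) (k : ℕ) (x : X) : ℝ :=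
  ⨆ o : Option {i : Σ j, ι j // i.1 ∈ B},
    o.elim (-C) fun i => y i.1.1 i.1.2 - k * dist x (p i.1.1 i.1.2)

section Envelope

variable {B : Set J} {p : ∀ j, ι j → X} {y : ∀ j, ι j → ℝ} {C : ℝ} {k : ℕ}

theorem lipEnvelope_bddAbove (hy : ∀ j n, |y j n| ≤ C) (x : X) :
    BddAbove (Set.range fun o : Option {i : Σ j, ι j // i.1 ∈ B} =>
      o.elim (-C) fun i => y i.1.1 i.1.2 - k * dist x (p i.1.1 i.1.2)) := by
  refine ⟨|C|, ?_⟩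
  rintro _ ⟨_ | i, rfl⟩
  · exact neg_le_abs C
  · have := (abs_le.1 (hy i.1.1 i.1.2)).2
    have h2 : 0 ≤ (k : ℝ) * dist x (p i.1.1 i.1.2) := by positivity
    change _ - _ ≤ _
    linarith [le_abs_self C]

/-- The envelope dominates the values. -/
theorem le_lipEnvelope (hy : ∀ j n, |y j n| ≤ C) {j : J} (hj : j ∈ B) (n : ι j) :
    y j n ≤ lipEnvelope B p y C k (p j n) := by
  have := le_ciSup (lipEnvelope_bddAbove (B := B) (p := p) (k := k) hy (p j n))
    (some ⟨⟨j, n⟩, hj⟩)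
  change y j n - k * dist (p j n) (p j n) ≤ _ at this
  rwa [dist_self, mul_zero, sub_zero] at this

theorem neg_le_lipEnvelope (hy : ∀ j n, |y j n| ≤ C) (x : X) :
    -C ≤ lipEnvelope B p y C k x :=
  le_ciSup (lipEnvelope_bddAbove (B := B) (p := p) (k := k) hy x) none

theorem lipEnvelope_le_abs (hy : ∀ j n, |y j n| ≤ C) (x : X) :
    lipEnvelope B p y C k x ≤ |C| := by
  refine ciSup_le ?_
  rintro (_ | i)
  · exact neg_le_abs C
  · have := (abs_le.1 (hy i.1.1 i.1.2)).2
    have h2 : 0 ≤ (k : ℝ) * dist x (p i.1.1 i.1.2) := by positivity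
    change _ - _ ≤ _
    linarith [le_abs_self C]

theorem abs_lipEnvelope_le (hy : ∀ j n, |y j n| ≤ C) (x : X) :
    |lipEnvelope B p y C k x| ≤ |C| :=
  abs_le.2 ⟨(neg_le_neg (le_abs_self C)).trans (neg_le_lipEnvelope hy x), lipEnvelope_le_abs hy x⟩

theorem lipschitzWith_lipEnvelope (hy : ∀ j n, |y j n| ≤ C) :
    LipschitzWith k (lipEnvelope B p y C k) := by
  refine LipschitzWith.of_le_add_mul _ fun x x' => ciSup_le ?_
  rintro (_ | i)
  · have := neg_le_lipEnvelope (B := B) (p := p) (k := k) hy x'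
    have h2 : 0 ≤ (k : ℝ) * dist x x' := by positivity
    change -C ≤ _ + (k : ℝ) * _
    linarith
  · have h1 := le_ciSup (lipEnvelope_bddAbove (B := B) (p := p) (k := k) hy x') (some i)
    have h2 : dist x' (p i.1.1 i.1.2) ≤ dist x x' + dist x (p i.1.1 i.1.2) :=
      dist_triangle_left _ _ _
    have h3 := mul_le_mul_of_nonneg_left h2 (Nat.cast_nonneg (α := ℝ) k)
    change y i.1.1 i.1.2 - k * dist x (p i.1.1 i.1.2) ≤ lipEnvelope B p y C k x' + (k : ℝ) * _
    change y i.1.1 i.1.2 - k * dist x' (p i.1.1 i.1.2) ≤ lipEnvelope B p y C k x' at h1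
    linarith

/-- As the index runs through an antitone basis of the filter and the Lipschitz constant grows, the
limit superior of the envelopes at `x` is at most the limit of the values at points that tend to
`x`. -/
theorem tendsto_max_lipEnvelope {b : ℕ → Set J} (hb : l.HasAntitoneBasis b)
    (hy : ∀ j n, |y j n| ≤ C) {x : X} {c : ℝ} (hc : |c| ≤ C)
    (h : Tendsto (fun i : Σ j, ι j => y i.1 i.2) (ptFilter l p x) (𝓝 c)) :
    Tendsto (fun k => max (lipEnvelope (b k) p y C k x) c) atTop (𝓝 c) := by
  refine tendsto_order.2 ⟨fun a ha => .of_forall fun k => lt_max_of_lt_right ha, fun a ha => ?_⟩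
  obtain ⟨a', hca', ha'⟩ := exists_between ha
  have h1 := h.eventually_lt_const hca'
  rw [ptFilter, (hb.1.comap Sigma.fst).inf
    (Metric.nhds_basis_ball.comap fun i : Σ j, ι j => p i.1 i.2) |>.eventually_iff] at h1
  obtain ⟨⟨k₀, δ⟩, ⟨-, hδ⟩, h2⟩ := h1
  -- For `k ≥ 2 C / δ` the values at points at distance at least `δ` do not contribute.
  obtain ⟨k₁, hk₁⟩ := exists_nat_ge (2 * C / δ)
  filter_upwards [eventually_ge_atTop k₀, eventually_ge_atTop k₁] with k hk0 hk1
  refine max_lt (lt_of_le_of_lt (ciSup_le ?_) ha') ha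
  have hCa : -C ≤ a' := (abs_le.1 hc).1.trans hca'.le
  rintro (_ | ⟨i, hi⟩)
  · exact hCa
  · change y i.1 i.2 - k * dist x (p i.1 i.2) ≤ a'
    by_cases hd : dist x (p i.1 i.2) < δ
    · have h3 : y i.1 i.2 < a' := h2 (x := i) ⟨hb.2 hk0 hi, by
        simpa [Metric.mem_ball, dist_comm] using hd⟩
      have h4 : 0 ≤ (k : ℝ) * dist x (p i.1 i.2) := by positivity
      linarith
    · have h3 := (abs_le.1 (hy i.1 i.2)).2
      have h4 : (k₁ : ℝ) ≤ k := by exact_mod_cast hk1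
      have h5 : 2 * C ≤ k * δ := (div_le_iff₀ hδ).1 (hk₁.trans h4)
      have h6 : (k : ℝ) * δ ≤ k * dist x (p i.1 i.2) :=
        mul_le_mul_of_nonneg_left (not_lt.1 hd) (Nat.cast_nonneg k)
      linarith

end Envelope

variable [MeasurableSpace X] [∀ j, Fintype (ι j)]

/-- The measures `∑ n, w j n • δ_{p j n}`, with nonnegative weights, converge weakly to `μ` along
`l`. The test functions are the bounded Lipschitz functions. -/
structure WeakConv (l : Filter J) (w : ∀ j, ι j → ℝ) (p : ∀ j, ι j → X) (μ : Measure X) :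
    Prop where
  nonneg : ∀ j n, 0 ≤ w j n
  tendsto : ∀ f : X → ℝ, (∃ K, LipschitzWith K f) → (∃ C, ∀ x, |f x| ≤ C) →
    Tendsto (fun j => ∑ n, w j n * f (p j n)) l (𝓝 (∫ x, f x ∂μ))

theorem WeakConv.comp {J' : Type*} {l' : Filter J'} {φ : J' → J} {w : ∀ j, ι j → ℝ}
    {p : ∀ j, ι j → X} {μ : Measure X} (h : WeakConv l w p μ) (hφ : Tendsto φ l' l) :
    WeakConv l' (ι := fun j => ι (φ j)) (fun j => w (φ j)) (fun j => p (φ j)) μ :=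
  ⟨fun j n => h.nonneg (φ j) n, fun f hf hC => (h.tendsto f hf hC).comp hφ⟩

variable {w : ∀ j, ι j → ℝ} {p : ∀ j, ι j → X} {μ : Measure X}

variable [OpensMeasurableSpace X]

/-- The upper half of the extended continuous mapping theorem: the values are dominated by Lipschitz
envelopes, to which weak convergence applies, and the integrals of the envelopes decrease to at most
the integral of `g`. -/
theorem WeakConv.eventually_sum_lt [l.IsCountablyGenerated] [IsFiniteMeasure μ]
    (h : WeakConv l w p μ) {y : ∀ j, ι j → ℝ} {g : X → ℝ} {C : ℝ} (hy : ∀ j n, |y j n| ≤ C)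
    (hgC : ∀ᵐ x ∂μ, |g x| ≤ C) (hg : AEStronglyMeasurable g μ)
    (hyg : ∀ᵐ x ∂μ, Tendsto (fun i : Σ j, ι j => y i.1 i.2) (ptFilter l p x) (𝓝 (g x)))
    {a : ℝ} (ha : ∫ x, g x ∂μ < a) : ∀ᶠ j in l, ∑ n, w j n * y j n < a := by
  obtain ⟨b, hb⟩ := l.exists_antitone_basis
  have hmeas : ∀ k, Measurable (lipEnvelope (b k) p y C k) := fun k =>
    (lipschitzWith_lipEnvelope hy).continuous.measurable
  have hint : ∀ k, Integrable (lipEnvelope (b k) p y C k) μ := fun k =>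
    .of_bound (hmeas k).aestronglyMeasurable |C| (.of_forall fun x => abs_lipEnvelope_le hy x)
  have hgi : Integrable g μ := .of_bound hg C hgC
  have hlim : Tendsto (fun k => ∫ x, max (lipEnvelope (b k) p y C k x) (g x) ∂μ) atTop
      (𝓝 (∫ x, g x ∂μ)) := by
    refine tendsto_integral_of_dominated_convergence (fun _ => |C|)
      (fun k => ((hint k).sup hgi).aestronglyMeasurable) (integrable_const _) (fun k => ?_) ?_
    · filter_upwards [hgC] with x hx
      exact (abs_max_le_max_abs_abs).trans
        (max_le (abs_lipEnvelope_le hy x) (hx.trans (le_abs_self C)))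
    · filter_upwards [hgC, hyg] with x hx hx'
      exact tendsto_max_lipEnvelope hb hy hx hx'
  obtain ⟨k, hk⟩ := (hlim.eventually_lt_const ha).exists
  have hlt : ∫ x, lipEnvelope (b k) p y C k x ∂μ < a :=
    (integral_mono (hint k) ((hint k).sup hgi) fun x => le_max_left _ _).trans_lt hk
  have ht := h.tendsto _ ⟨_, lipschitzWith_lipEnvelope (B := b k) (p := p) (k := k) hy⟩
    ⟨_, abs_lipEnvelope_le hy⟩
  filter_upwards [ht.eventually_lt_const hlt, hb.1.mem_of_mem (i := k) trivial] with j hj hjb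
  exact (Finset.sum_le_sum fun n _ =>
    mul_le_mul_of_nonneg_left (le_lipEnvelope hy hjb n) (h.nonneg j n)).trans_lt hj

/-- The extended continuous mapping theorem: if the values `y j n` attached to the points converge
to `g x` whenever the points converge to `x`, for almost all `x`, then their weighted sums
converge to the integral of `g`. -/
theorem WeakConv.tendsto_sum [l.IsCountablyGenerated] [IsFiniteMeasure μ]
    (h : WeakConv l w p μ) {y : ∀ j, ι j → ℝ} {g : X → ℝ} {C : ℝ} (hy : ∀ j n, |y j n| ≤ C)
    (hgC : ∀ᵐ x ∂μ, |g x| ≤ C) (hg : AEStronglyMeasurable g μ)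
    (hyg : ∀ᵐ x ∂μ, Tendsto (fun i : Σ j, ι j => y i.1 i.2) (ptFilter l p x) (𝓝 (g x))) :
    Tendsto (fun j => ∑ n, w j n * y j n) l (𝓝 (∫ x, g x ∂μ)) := by
  refine tendsto_order.2 ⟨fun a ha => ?_, fun a ha => h.eventually_sum_lt hy hgC hg hyg ha⟩
  have := h.eventually_sum_lt (y := fun j n => - y j n) (g := fun x => - g x) (a := -a)
    (C := C) (by simpa using hy) (by simpa using hgC) hg.neg
    (hyg.mono fun x hx => hx.neg) (by rw [integral_neg]; linarith)
  filter_upwards [this] with j hj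
  simp only [mul_neg, Finset.sum_neg_distrib] at hj
  linarith

/-- Convergence of the values attached to weakly convergent points is weak convergence. -/
theorem WeakConv.map {Y : Type*} [PseudoMetricSpace Y] [MeasurableSpace Y] [BorelSpace Y]
    [l.IsCountablyGenerated] [IsFiniteMeasure μ]
    (h : WeakConv l w p μ) {y : ∀ j, ι j → Y} {g : X → Y} (hg : Measurable g)
    (hyg : ∀ᵐ x ∂μ, Tendsto (fun i : Σ j, ι j => y i.1 i.2) (ptFilter l p x) (𝓝 (g x))) :
    WeakConv l w y (μ.map g) := by
  refine ⟨h.nonneg, fun f ⟨K, hK⟩ ⟨C, hC⟩ => ?_⟩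
  rw [integral_map hg.aemeasurable hK.continuous.measurable.aestronglyMeasurable]
  exact h.tendsto_sum (fun j n => hC _) (.of_forall fun x => hC _)
    (hK.continuous.measurable.comp hg).aestronglyMeasurable
    (hyg.mono fun x hx => (hK.continuous.tendsto _).comp hx)

end Weak

end

/-! ### Discrete measures and the extreme norm -/

noncomputable section

section Discrete

variable {α : Type} [MeasurableSpace α] {N : ℕ} {w : Fin N → ℝ} {p : Fin N → α}

theorem lintegral_weightedDirac [MeasurableSingletonClass α] (f : α → ENNReal) :
    ∫⁻ x, f x ∂weightedDirac w p = ∑ n, ENNReal.ofReal (w n) * f (p n) := by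
  simp [weightedDirac]

theorem weightedDirac_apply {s : Set α} (hs : MeasurableSet s) :
    weightedDirac w p s = ∑ n, ENNReal.ofReal (w n) * s.indicator 1 (p n) := by
  simp [weightedDirac, hs]

instance instIsFiniteMeasureWeightedDirac : IsFiniteMeasure (weightedDirac w p) := ⟨by
  rw [weightedDirac_apply MeasurableSet.univ]
  simp [ENNReal.sum_lt_top]⟩

theorem weightedDirac_real (hw : ∀ n, 0 ≤ w n) {s : Set α} (hs : MeasurableSet s) :
    (weightedDirac w p).real s = ∑ n, w n * s.indicator 1 (p n) := by
  rw [Measure.real, weightedDirac_apply hs, ENNReal.toReal_sum]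
  · refine Finset.sum_congr rfl fun n _ => ?_
    by_cases h : p n ∈ s <;> simp [h, hw n]
  · intro n _
    by_cases h : p n ∈ s <;> simp [h]

theorem integral_weightedDirac [MeasurableSingletonClass α] (hw : ∀ n, 0 ≤ w n) (f : α → ℝ) :
    ∫ x, f x ∂weightedDirac w p = ∑ n, w n * f (p n) := by
  rw [weightedDirac, integral_finsetSum_measure]
  · refine Finset.sum_congr rfl fun n _ => ?_
    rw [integral_smul_measure, integral_dirac, ENNReal.toReal_ofReal (hw n), smul_eq_mul]
  · intro n _
    exact (integrable_dirac (by simp)).smul_measure ENNReal.ofReal_ne_top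

end Discrete

theorem empirical_eq_weightedDirac {ι : Type} [Fintype ι] {N : ℕ} (p : Fin N → ι → ℝ) :
    empirical p = weightedDirac (fun _ => (N : ℝ)⁻¹) p := by
  rcases N.eq_zero_or_pos with rfl | hN
  · simp [empirical, weightedDirac]
  · have : ENNReal.ofReal (N : ℝ)⁻¹ = (N : ENNReal)⁻¹ := by
      rw [ENNReal.ofReal_inv_of_pos (by exact_mod_cast hN), ENNReal.ofReal_natCast]
    simp [empirical, weightedDirac, this, Finset.smul_sum]

theorem abs_sub_real_le {α : Type*} [MeasurableSpace α] {μ ν : Measure α} {C : ℝ} {B : Set α}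
    (hμ : μ.real B ≤ C) (hν : ν.real B ≤ C) : |μ.real B - ν.real B| ≤ C := by
  have h1 : 0 ≤ μ.real B := measureReal_nonneg
  have h2 : 0 ≤ ν.real B := measureReal_nonneg
  exact abs_le.2 ⟨by linarith, by linarith⟩

section ExtremeNorm

variable {ι : Type} [Fintype ι]

theorem measurableSet_of_mem_boxes {B : Set (ι → ℝ)} (hB : B ∈ boxes ι) : MeasurableSet B := by
  obtain ⟨a, b, -, rfl⟩ := hB
  exact measurableSet_Icc

theorem extremeNorm_nonneg (μ ν : Measure (ι → ℝ)) : 0 ≤ extremeNorm μ ν :=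
  Real.iSup_nonneg fun _ => abs_nonneg _

theorem extremeNorm_le {μ ν : Measure (ι → ℝ)} {C : ℝ} (hC : 0 ≤ C)
    (h : ∀ B ∈ boxes ι, |μ.real B - ν.real B| ≤ C) : extremeNorm μ ν ≤ C :=
  Real.iSup_le (fun B => h B B.2) hC

theorem abs_sub_le_extremeNorm {μ ν : Measure (ι → ℝ)} {C : ℝ}
    (hμ : ∀ B ∈ boxes ι, μ.real B ≤ C) (hν : ∀ B ∈ boxes ι, ν.real B ≤ C) {B : Set (ι → ℝ)}
    (hB : B ∈ boxes ι) : |μ.real B - ν.real B| ≤ extremeNorm μ ν :=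
  le_ciSup (f := fun B : boxes ι => |μ.real (B : Set (ι → ℝ)) - ν.real (B : Set (ι → ℝ))|)
    ⟨C, by rintro _ ⟨B, rfl⟩; exact abs_sub_real_le (hμ B B.2) (hν B B.2)⟩ ⟨B, hB⟩

end ExtremeNorm

theorem extremeNormUI_le_one {μ ν : Measure UI} (hμ : μ Set.univ ≤ 1) (hν : ν Set.univ ≤ 1) :
    extremeNormUI μ ν ≤ 1 := by
  have hm : Measurable fun (x : UI) (_ : Fin 1) => (x : ℝ) :=
    measurable_pi_lambda _ fun _ => measurable_subtype_coe
  refine extremeNorm_le zero_le_one fun B hB => ?_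
  have key : ∀ μ : Measure UI, μ Set.univ ≤ 1 →
      (μ.map fun (x : UI) (_ : Fin 1) => (x : ℝ)).real B ≤ 1 := fun μ hμ => by
    refine ENNReal.toReal_le_of_le_ofReal zero_le_one ?_
    rw [Measure.map_apply hm (measurableSet_of_mem_boxes hB), ENNReal.ofReal_one]
    exact (measure_mono (Set.subset_univ _)).trans hμ
  exact abs_sub_real_le (key μ hμ) (key ν hν)

/-- The extreme norm controls CDFs at positive points. At zero it does not, since the boxes are
nondegenerate. -/
theorem abs_cdfUI_sub_le (μ ν : Measure UI) [IsFiniteMeasure μ] [IsFiniteMeasure ν] {b : UI}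
    (hb : 0 < (b : ℝ)) : |cdfUI μ b - cdfUI ν b| ≤ extremeNormUI μ ν := by
  have hm : Measurable fun (x : UI) (_ : Fin 1) => (x : ℝ) :=
    measurable_pi_lambda _ fun _ => measurable_subtype_coe
  have hB : Set.Icc (fun _ : Fin 1 => (0 : ℝ)) (fun _ => (b : ℝ)) ∈ boxes (Fin 1) :=
    ⟨_, _, fun _ => ⟨le_rfl, hb, b.2.2⟩, rfl⟩
  have key : ∀ μ : Measure UI, cdfUI μ b = (μ.map fun (x : UI) (_ : Fin 1) => (x : ℝ)).real
      (Set.Icc (fun _ : Fin 1 => (0 : ℝ)) (fun _ => (b : ℝ))) := fun μ => by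
    rw [map_measureReal_apply hm measurableSet_Icc]
    refine congrArg μ.real (Set.ext fun x => ?_)
    simp only [Set.mem_Iic, Set.mem_preimage, Set.mem_Icc, Pi.le_def]
    exact ⟨fun h => ⟨fun _ => x.2.1, fun _ => h⟩, fun h => h.2 0⟩
  have h2 : ∀ μ : Measure UI, IsFiniteMeasure μ → ∀ B : Set (Fin 1 → ℝ),
      (μ.map fun (x : UI) (_ : Fin 1) => (x : ℝ)).real B ≤ μ.real Set.univ := fun μ _ B => by
    have := Measure.isFiniteMeasure_map μ fun (x : UI) (_ : Fin 1) => (x : ℝ)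
    refine (measureReal_mono (Set.subset_univ B)).trans_eq ?_
    rw [map_measureReal_apply hm MeasurableSet.univ, Set.preimage_univ]
  rw [key μ, key ν]
  exact abs_sub_le_extremeNorm (C := max (μ.real Set.univ) (ν.real Set.univ))
    (fun B _ => (h2 μ ‹_› B).trans (le_max_left _ _))
    (fun B _ => (h2 ν ‹_› B).trans (le_max_right _ _)) hB

/-! ### Vanishing discrepancy implies weak convergence to the uniform law -/

theorem volume_UI_Icc (a b : UI) :
    (volume : Measure UI) (Set.Icc a b) = ENNReal.ofReal (b - a) := by
  have h : Set.Icc a b = (fun x : UI => (x : ℝ)) ⁻¹' Set.Icc (a : ℝ) b := by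
    ext y; simp
  rw [h, volume_UI_apply measurableSet_Icc, Set.inter_eq_left.2, Real.volume_Icc]
  exact fun y hy => ⟨a.2.1.trans hy.1, hy.2.trans_lt b.2.2⟩

theorem volume_real_Icc_coe {k : ℕ} (a b : Fin k → UI) :
    (volume : Measure (Fin k → ℝ)).real (Set.Icc (fun i => (a i : ℝ)) fun i => (b i : ℝ)) =
      (volume : Measure (Fin k → UI)).real (Set.Icc a b) := by
  rw [Measure.real, Measure.real, Real.volume_Icc_pi, ← Set.pi_univ_Icc, volume_pi,
    Measure.pi_pi]
  simp_rw [volume_UI_Icc]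

theorem abs_weightedDirac_sub_le_discrepancy {k N : ℕ} (u : Fin N → Fin k → UI) {a b : Fin k → UI}
    (hab : ∀ i, a i < b i) :
    |(weightedDirac (fun _ => (N : ℝ)⁻¹) u).real (Set.Icc a b) -
      (volume : Measure (Fin k → UI)).real (Set.Icc a b)| ≤ discrepancy u := by
  have hpos : ∀ _ : Fin N, 0 ≤ (N : ℝ)⁻¹ := fun _ => by positivity
  have h1 : (weightedDirac (fun _ => (N : ℝ)⁻¹) u).real (Set.Icc a b) =
      (empirical fun n i => (u n i : ℝ)).real
        (Set.Icc (fun i => (a i : ℝ)) fun i => (b i : ℝ)) := by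
    rw [empirical_eq_weightedDirac, weightedDirac_real hpos measurableSet_Icc,
      weightedDirac_real hpos measurableSet_Icc]
    rfl
  rw [h1, ← volume_real_Icc_coe]
  refine abs_sub_le_extremeNorm (C := 1) (fun B hB => ?_) (fun B hB => ?_)
    ⟨_, _, fun i => ⟨(a i).2.1, hab i, (b i).2.2⟩, rfl⟩
  · rw [empirical_eq_weightedDirac, weightedDirac_real hpos (measurableSet_of_mem_boxes hB)]
    calc ∑ n : Fin N, (N : ℝ)⁻¹ * B.indicator 1 (fun i => (u n i : ℝ))
        ≤ ∑ n : Fin N, (N : ℝ)⁻¹ := Finset.sum_le_sum fun n _ =>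
          mul_le_of_le_one_right (hpos n) (Set.indicator_le_self' (by simp) _)
      _ ≤ 1 := by
          simp only [Finset.sum_const, Finset.card_univ, Fintype.card_fin, nsmul_eq_mul]
          exact mul_inv_le_one
  · obtain ⟨a, b, h, rfl⟩ := hB
    rw [Measure.real, Real.volume_Icc_pi_toReal fun i => (h i).2.1.le]
    exact Finset.prod_le_one (fun i _ => by linarith [(h i).2.1])
      fun i _ => by linarith [(h i).1, (h i).2.2]

/-- The point `b + δ (1 - b)` of `[0,1)`, slightly above `b`. -/
def pushUp (δ : ℝ) (hδ : 0 < δ ∧ δ < 1) (b : UI) : UI := ⟨b + δ * (1 - b), by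
  have h1 := b.2.1
  have h2 := b.2.2
  constructor
  · nlinarith
  · nlinarith⟩

/-- All closed boxes of `[0,1)^k` are covered here, also the degenerate ones, over which the
discrepancy does not range. -/
theorem tendsto_weightedDirac_Icc {k : ℕ} {u : ∀ N : ℕ, Fin N → Fin k → UI}
    (hu : Tendsto (fun N => discrepancy (u N)) atTop (𝓝 0)) (a b : Fin k → UI) :
    Tendsto (fun N : ℕ => (weightedDirac (fun _ => (N : ℝ)⁻¹) (u N)).real (Set.Icc a b)) atTop
      (𝓝 ((volume : Measure (Fin k → UI)).real (Set.Icc a b))) := by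
  by_cases h : ∀ i, a i < b i
  · rw [tendsto_iff_dist_tendsto_zero]
    exact squeeze_zero (fun _ => dist_nonneg)
      (fun N => abs_weightedDirac_sub_le_discrepancy (u N) h) hu
  push Not at h
  obtain ⟨i, hi⟩ := h
  -- The box is empty or flat, and in the latter case contained in nondegenerate thin boxes.
  have h0 : (volume : Measure (Fin k → UI)).real (Set.Icc a b) = 0 := by
    rw [Measure.real, ← Set.pi_univ_Icc, volume_pi, Measure.pi_pi,
      Finset.prod_eq_zero (Finset.mem_univ i), ENNReal.toReal_zero]
    rw [volume_UI_Icc, ENNReal.ofReal_eq_zero]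
    exact sub_nonpos.2 hi
  rw [h0]
  by_cases hab : a ≤ b
  swap
  · simp [Set.Icc_eq_empty hab]
  refine tendsto_order.2 ⟨fun c hc => .of_forall fun N => hc.trans_le measureReal_nonneg,
    fun c hc => ?_⟩
  obtain ⟨δ, hδ0, hδ⟩ := exists_between (lt_min (half_pos hc) (zero_lt_one))
  have hδ1 : 0 < δ ∧ δ < 1 := ⟨hδ0, hδ.trans_le (min_le_right _ _)⟩
  have hlt : ∀ j, b j < pushUp δ hδ1 (b j) := fun j => by
    change (b j : ℝ) < b j + δ * (1 - b j)
    nlinarith [(b j).2.2]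
  have hvol : (volume : Measure (Fin k → UI)).real (Set.Icc a fun j => pushUp δ hδ1 (b j)) ≤ δ := by
    rw [← volume_real_Icc_coe, Measure.real, Real.volume_Icc_pi_toReal
      fun j => (hab j).trans (hlt j).le, ← Finset.mul_prod_erase _ _ (Finset.mem_univ i)]
    have hle : ∀ j, 0 ≤ (pushUp δ hδ1 (b j) : ℝ) - a j := fun j =>
      sub_nonneg.2 ((hab j).trans (hlt j).le)
    have e1 : (pushUp δ hδ1 (b i) : ℝ) - a i ≤ δ := by
      have : (b i : ℝ) ≤ a i := hi
      change (b i : ℝ) + δ * (1 - b i) - a i ≤ δ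
      nlinarith [(b i).2.1]
    have e2 : ∏ j ∈ Finset.univ.erase i, ((pushUp δ hδ1 (b j) : ℝ) - a j) ≤ 1 :=
      Finset.prod_le_one (fun j _ => hle j) fun j _ => by
        linarith [(pushUp δ hδ1 (b j)).2.2, (a j).2.1]
    calc _ ≤ δ * 1 := mul_le_mul e1 e2 (Finset.prod_nonneg fun j _ => hle j) hδ0.le
      _ = δ := mul_one δ
  filter_upwards [hu.eventually_lt_const (half_pos hc)] with N hN
  have h1 := (abs_le.1 (abs_weightedDirac_sub_le_discrepancy (u N)
    fun j => (hab j).trans_lt (hlt j))).2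
  have h2 : (weightedDirac (fun _ => (N : ℝ)⁻¹) (u N)).real (Set.Icc a b) ≤ _ :=
    measureReal_mono (Set.Icc_subset_Icc_right fun j => (hlt j).le)
  have h3 : δ < c / 2 := hδ.trans_le (min_le_left _ _)
  linarith

/-- The closed boxes form a π-system that contains a neighbourhood basis, so that convergence on
them implies weak convergence. -/
theorem weakConv_of_discrepancy {k : ℕ} {u : ∀ N : ℕ, Fin N → Fin k → UI}
    (hu : Tendsto (fun N => discrepancy (u N)) atTop (𝓝 0)) :
    WeakConv atTop (fun N (_ : Fin N) => (N : ℝ)⁻¹) u volume := by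
  refine ⟨fun N _ => by positivity, fun f ⟨K, hK⟩ ⟨C, hC⟩ => ?_⟩
  -- The empirical measure of no points is zero, hence the shift of the index.
  have hprob : ∀ N : ℕ, IsProbabilityMeasure
      (weightedDirac (fun _ => ((N + 1 : ℕ) : ℝ)⁻¹) (u (N + 1))) := fun N => ⟨by
    have h : (weightedDirac (fun _ => ((N + 1 : ℕ) : ℝ)⁻¹) (u (N + 1))).real Set.univ = 1 := by
      rw [weightedDirac_real (fun _ => by positivity) MeasurableSet.univ]
      simp only [Set.indicator_univ, Pi.one_apply, mul_one, Finset.sum_const, Finset.card_univ,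
        Fintype.card_fin, nsmul_eq_mul]
      exact mul_inv_cancel₀ (by positivity)
    rwa [Measure.real, ENNReal.toReal_eq_one_iff] at h⟩
  have : IsProbabilityMeasure (volume : Measure (Fin k → UI)) := by
    rw [volume_pi]; infer_instance
  let P : ℕ → ProbabilityMeasure (Fin k → UI) := fun N => ⟨_, hprob N⟩
  let P₀ : ProbabilityMeasure (Fin k → UI) := ⟨volume, this⟩
  have key : Tendsto P atTop (𝓝 P₀) := by
    refine IsPiSystem.tendsto_probabilityMeasure_of_tendsto_of_mem
      (S := {s | ∃ a b : Fin k → UI, s = Set.Icc a b}) ?_ ?_ ?_ ?_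
    · rintro _ ⟨a, b, rfl⟩ _ ⟨a', b', rfl⟩ -
      exact ⟨_, _, Set.Icc_inter_Icc⟩
    · rintro _ ⟨a, b, rfl⟩
      exact measurableSet_Icc
    · intro s hs x hx
      have hs' := hs.mem_nhds hx
      rw [nhds_pi, Filter.mem_pi'] at hs'
      obtain ⟨I, t, ht, hts⟩ := hs'
      choose b c hbc hmem hsub using fun i => exists_Icc_mem_subset_of_mem_nhds (ht i)
      refine ⟨Set.Icc b c, ⟨b, c, rfl⟩, ?_, ?_⟩
      · rw [← Set.pi_univ_Icc]
        exact set_pi_mem_nhds Set.finite_univ fun i _ => hmem i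
      · rw [← Set.pi_univ_Icc]
        exact fun y hy => hts fun i _ => hsub i (hy i trivial)
    · rintro _ ⟨a, b, rfl⟩
      have := (tendsto_add_atTop_iff_nat 1).2 (tendsto_weightedDirac_Icc hu a b)
      rw [← NNReal.tendsto_coe]
      exact this
  rw [← tendsto_add_atTop_iff_nat 1]
  let F : BoundedContinuousFunction (Fin k → UI) ℝ :=
    BoundedContinuousFunction.ofNormedAddCommGroup f hK.continuous C hC
  have h2 := (ProbabilityMeasure.tendsto_iff_forall_integral_tendsto.1 key) F
  refine h2.congr fun N => ?_
  exact integral_weightedDirac (fun _ => by positivity) f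

/-! ### Weak convergence implies convergence in the extreme norm -/

section Polya

variable {ι : Type} [Fintype ι]

/-- Membership in a box is locally constant in the box and the point, off the hyperplanes that
bound the box. -/
theorem eventually_mem_Icc_iff {a b x : ι → ℝ} (ha : ∀ i, x i ≠ a i) (hb : ∀ i, x i ≠ b i) :
    ∀ᶠ q : ((ι → ℝ) × (ι → ℝ)) × (ι → ℝ) in 𝓝 ((a, b), x),
      (q.2 ∈ Set.Icc q.1.1 q.1.2 ↔ x ∈ Set.Icc a b) := by
  by_cases hx : x ∈ Set.Icc a b
  · have h1 : ∀ i, ∀ᶠ q : ((ι → ℝ) × (ι → ℝ)) × (ι → ℝ) in 𝓝 ((a, b), x),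
        q.1.1 i ≤ q.2 i ∧ q.2 i ≤ q.1.2 i := fun i => by
      have c1 : ContinuousAt (fun q : ((ι → ℝ) × (ι → ℝ)) × (ι → ℝ) => q.2 i - q.1.1 i)
        ((a, b), x) := by fun_prop
      have c2 : ContinuousAt (fun q : ((ι → ℝ) × (ι → ℝ)) × (ι → ℝ) => q.1.2 i - q.2 i)
        ((a, b), x) := by fun_prop
      have p1 : 0 < x i - a i := sub_pos.2 (lt_of_le_of_ne (hx.1 i) (ha i).symm)
      have p2 : 0 < b i - x i := sub_pos.2 (lt_of_le_of_ne (hx.2 i) (hb i))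
      filter_upwards [c1.eventually (lt_mem_nhds p1), c2.eventually (lt_mem_nhds p2)] with q h1 h2
      exact ⟨(sub_pos.1 h1).le, (sub_pos.1 h2).le⟩
    filter_upwards [eventually_all.2 h1] with q hq
    exact ⟨fun _ => hx, fun _ => ⟨fun i => (hq i).1, fun i => (hq i).2⟩⟩
  · have hx' : ∃ i, x i < a i ∨ b i < x i := by
      by_contra! h
      exact hx ⟨fun i => (h i).1, fun i => (h i).2⟩
    obtain ⟨i, hi⟩ := hx'
    rcases hi with hi | hi
    · have c1 : ContinuousAt (fun q : ((ι → ℝ) × (ι → ℝ)) × (ι → ℝ) => q.1.1 i - q.2 i)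
        ((a, b), x) := by fun_prop
      filter_upwards [c1.eventually (lt_mem_nhds (sub_pos.2 hi))] with q hq
      exact ⟨fun h => absurd (h.1 i) (not_le.2 (sub_pos.1 hq)), fun h => absurd h hx⟩
    · have c1 : ContinuousAt (fun q : ((ι → ℝ) × (ι → ℝ)) × (ι → ℝ) => q.2 i - q.1.2 i)
        ((a, b), x) := by fun_prop
      filter_upwards [c1.eventually (lt_mem_nhds (sub_pos.2 hi))] with q hq
      exact ⟨fun h => absurd (h.2 i) (not_le.2 (sub_pos.1 hq)), fun h => absurd h hx⟩

theorem tendsto_indicator_Icc {I : Type*} {l : Filter I} {a b x : ι → ℝ}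
    (ha : ∀ i, x i ≠ a i) (hb : ∀ i, x i ≠ b i) {A B Z : I → ι → ℝ} (hA : Tendsto A l (𝓝 a))
    (hB : Tendsto B l (𝓝 b)) (hZ : Tendsto Z l (𝓝 x)) :
    Tendsto (fun i => (Set.Icc (A i) (B i)).indicator (1 : (ι → ℝ) → ℝ) (Z i)) l
      (𝓝 ((Set.Icc a b).indicator 1 x)) := by
  refine tendsto_const_nhds.congr' ?_
  have h := ((hA.prodMk_nhds hB).prodMk_nhds hZ).eventually (eventually_mem_Icc_iff ha hb)
  filter_upwards [h] with i hi
  by_cases hx : x ∈ Set.Icc a b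
  · rw [Set.indicator_of_mem hx, Set.indicator_of_mem (hi.2 hx)]; rfl
  · rw [Set.indicator_of_notMem hx, Set.indicator_of_notMem fun h' => hx (hi.1 h')]

theorem abs_indicator_one_le {α : Type*} (s : Set α) (x : α) :
    |s.indicator (1 : α → ℝ) x| ≤ 1 := by
  by_cases h : x ∈ s <;> simp [h]

/-- Weak convergence to a law that does not charge hyperplanes is uniform over boxes: the
differences of masses tend to zero jointly in `N` and in the corners of the box, and the corners
range over a compact set. -/
theorem WeakConv.tendsto_extremeNorm {w : ∀ N : ℕ, Fin N → ℝ} {p : ∀ N : ℕ, Fin N → ι → ℝ}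
    {μ : Measure (ι → ℝ)} [IsProbabilityMeasure μ] (h : WeakConv atTop w p μ)
    (hμ : ∀ i c, μ {x | x i = c} = 0) :
    Tendsto (fun N => extremeNorm (weightedDirac (w N) (p N)) μ) atTop (𝓝 0) := by
  have hae : ∀ a : ι → ℝ, ∀ᵐ x ∂μ, ∀ i, x i ≠ a i := fun a =>
    ae_all_iff.2 fun i => measure_eq_zero_iff_ae_notMem.1 (hμ i (a i))
  have hint : ∀ a b : ι → ℝ, ∫ x, (Set.Icc a b).indicator (1 : (ι → ℝ) → ℝ) x ∂μ =
      μ.real (Set.Icc a b) := fun a b => integral_indicator_one measurableSet_Icc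
  have key : ∀ ab : (ι → ℝ) × (ι → ℝ), Tendsto (fun q : ℕ × ((ι → ℝ) × (ι → ℝ)) =>
      |(weightedDirac (w q.1) (p q.1)).real (Set.Icc q.2.1 q.2.2) -
        μ.real (Set.Icc q.2.1 q.2.2)|) (atTop ×ˢ 𝓝 ab) (𝓝 0) := by
    rintro ⟨a, b⟩
    have hA : Tendsto (fun q : ℕ × ((ι → ℝ) × (ι → ℝ)) => q.2.1) (atTop ×ˢ 𝓝 (a, b)) (𝓝 a) :=
      (continuous_fst.tendsto (a, b)).comp tendsto_snd
    have hB : Tendsto (fun q : ℕ × ((ι → ℝ) × (ι → ℝ)) => q.2.2) (atTop ×ˢ 𝓝 (a, b)) (𝓝 b) :=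
      (continuous_snd.tendsto (a, b)).comp tendsto_snd
    have h1 := (h.comp (tendsto_fst (f := atTop) (g := 𝓝 (a, b)))).tendsto_sum
      (y := fun q n => (Set.Icc q.2.1 q.2.2).indicator 1 (p q.1 n))
      (g := (Set.Icc a b).indicator 1) (C := 1)
      (fun q n => abs_indicator_one_le _ _) (.of_forall fun x => abs_indicator_one_le _ _)
      (stronglyMeasurable_one.indicator measurableSet_Icc).aestronglyMeasurable (by
        filter_upwards [hae a, hae b] with x hxa hxb
        exact tendsto_indicator_Icc hxa hxb (hA.comp (tendsto_fst_ptFilter _ _))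
          (hB.comp (tendsto_fst_ptFilter _ _)) (tendsto_point_ptFilter _ _))
    have h2 : Tendsto (fun q : ℕ × ((ι → ℝ) × (ι → ℝ)) =>
        ∫ x, (Set.Icc q.2.1 q.2.2).indicator (1 : (ι → ℝ) → ℝ) x ∂μ) (atTop ×ˢ 𝓝 (a, b))
        (𝓝 (∫ x, (Set.Icc a b).indicator (1 : (ι → ℝ) → ℝ) x ∂μ)) := by
      refine tendsto_integral_filter_of_dominated_convergence (fun _ => 1)
        (.of_forall fun q => (stronglyMeasurable_one.indicator
          measurableSet_Icc).aestronglyMeasurable)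
        (.of_forall fun q => .of_forall fun x => abs_indicator_one_le _ _)
        (integrable_const _) ?_
      filter_upwards [hae a, hae b] with x hxa hxb
      exact tendsto_indicator_Icc hxa hxb hA hB tendsto_const_nhds
    have h3 := (h1.sub h2).abs
    rw [sub_self, abs_zero] at h3
    refine h3.congr fun q => ?_
    rw [hint, weightedDirac_real (h.nonneg q.1) measurableSet_Icc]
  refine tendsto_order.2 ⟨fun c hc => .of_forall fun N => hc.trans_le (extremeNorm_nonneg _ _),
    fun c hc => ?_⟩
  have hK : IsCompact (Set.Icc (0 : ι → ℝ) 1 ×ˢ Set.Icc (0 : ι → ℝ) 1) :=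
    isCompact_Icc.prod isCompact_Icc
  have hev : ∀ᶠ q : ℕ × ((ι → ℝ) × (ι → ℝ)) in
      atTop ×ˢ 𝓝ˢ (Set.Icc (0 : ι → ℝ) 1 ×ˢ Set.Icc (0 : ι → ℝ) 1),
      |(weightedDirac (w q.1) (p q.1)).real (Set.Icc q.2.1 q.2.2) -
        μ.real (Set.Icc q.2.1 q.2.2)| < c / 2 := by
    rw [hK.prod_nhdsSet_eq_biSup]
    simp only [eventually_iSup]
    exact fun ab _ => (key ab).eventually_lt_const (half_pos hc)
  filter_upwards [hev.curry] with N hN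
  have hN' := hN.self_of_nhdsSet
  refine lt_of_le_of_lt (extremeNorm_le (half_pos hc).le ?_) (half_lt_self hc)
  rintro _ ⟨a, b, hab, rfl⟩
  refine (hN' (a, b) ⟨⟨fun i => (hab i).1, fun i => ?_⟩, ⟨fun i => ?_, fun i => ?_⟩⟩).le
  · exact ((hab i).2.1.trans (hab i).2.2).le
  · exact ((hab i).1.trans_lt (hab i).2.1).le
  · exact (hab i).2.2.le

end Polya

end

/-! ### The Hilbert curve and its pseudo-inverse -/

noncomputable section

/-- The index `k` of the interval `[k 2^(-dm), (k+1) 2^(-dm))` that contains `s`. -/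
def dyadicIndex (d m : ℕ) (s : UI) : ℕ := ⌊(s : ℝ) * 2 ^ (d * m)⌋₊

theorem dyadicIndex_lt (d m : ℕ) (s : UI) : dyadicIndex d m s < 2 ^ (d * m) := by
  rw [dyadicIndex, Nat.floor_lt (mul_nonneg s.2.1 (by positivity))]
  push_cast
  exact mul_lt_of_lt_one_left (by positivity) s.2.2

theorem dyadicIndex_succ (d m : ℕ) (s : UI) :
    dyadicIndex d (m + 1) s / 2 ^ d = dyadicIndex d m s := by
  rw [dyadicIndex, dyadicIndex]
  have h : (s : ℝ) * 2 ^ (d * m) = (s : ℝ) * 2 ^ (d * (m + 1)) / ((2 ^ d : ℕ) : ℝ) := by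
    rw [mul_add, mul_one, pow_add]
    push_cast
    field_simp
  rw [h, Nat.floor_div_natCast]

theorem abs_sub_lt_of_dyadicIndex_eq {d m : ℕ} {s s' : UI}
    (h : dyadicIndex d m s = dyadicIndex d m s') : |(s : ℝ) - s'| < 1 / 2 ^ (d * m) := by
  have hp : (0 : ℝ) < 2 ^ (d * m) := by positivity
  have h1 := Nat.floor_le (mul_nonneg s.2.1 hp.le)
  have h2 := Nat.lt_floor_add_one ((s : ℝ) * 2 ^ (d * m))
  have h3 := Nat.floor_le (mul_nonneg s'.2.1 hp.le)
  have h4 := Nat.lt_floor_add_one ((s' : ℝ) * 2 ^ (d * m))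
  have h5 : ⌊(s : ℝ) * 2 ^ (d * m)⌋₊ = ⌊(s' : ℝ) * 2 ^ (d * m)⌋₊ := h
  rw [h5] at h1 h2
  rw [lt_div_iff₀ hp, ← abs_of_pos hp, ← abs_mul, sub_mul, abs_lt]
  constructor <;> linarith

theorem dyadicIndex_close {d m : ℕ} {s s' : UI} (hss : s ≤ s')
    (h : (s' : ℝ) - s < 1 / 2 ^ (d * m)) :
    dyadicIndex d m s' = dyadicIndex d m s ∨ dyadicIndex d m s' = dyadicIndex d m s + 1 := by
  have hp : (0 : ℝ) < 2 ^ (d * m) := by positivity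
  rw [lt_div_iff₀ hp] at h
  have h1 : dyadicIndex d m s ≤ dyadicIndex d m s' :=
    Nat.floor_mono (mul_le_mul_of_nonneg_right hss hp.le)
  have h2 : dyadicIndex d m s' < dyadicIndex d m s + 2 := by
    rw [dyadicIndex, Nat.floor_lt (mul_nonneg s'.2.1 hp.le)]
    have := Nat.lt_floor_add_one ((s : ℝ) * 2 ^ (d * m))
    rw [dyadicIndex]
    push_cast
    linarith
  omega

namespace HilbertOrder

variable {d : ℕ} (H : HilbertOrder d)

/-- The `j`-th integer coordinate of the cube of level `m` visited at time `s`. -/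
def coord (s : UI) (j : Fin d) (m : ℕ) : ℕ := H.cell m (dyadicIndex d m s) j

theorem coord_succ (s : UI) (j : Fin d) (m : ℕ) :
    H.coord s j (m + 1) / 2 = H.coord s j m := by
  rw [coord, H.nested m _ (dyadicIndex_lt d (m + 1) s) j, dyadicIndex_succ, coord]

theorem monotone_coord_div (s : UI) (j : Fin d) :
    Monotone fun m : ℕ => (H.coord s j m : ℝ) / 2 ^ m := by
  refine monotone_nat_of_le_succ fun m => ?_
  have h1 : 2 * H.coord s j m ≤ H.coord s j (m + 1) := by have := H.coord_succ s j m; omega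
  have h2 : 2 * (H.coord s j m : ℝ) ≤ H.coord s j (m + 1) := by exact_mod_cast h1
  rw [pow_succ, div_le_div_iff₀ (by positivity) (by positivity)]
  nlinarith [pow_pos (two_pos (α := ℝ)) m]

theorem antitone_coord_add_one_div (s : UI) (j : Fin d) :
    Antitone fun m : ℕ => ((H.coord s j m : ℝ) + 1) / 2 ^ m := by
  refine antitone_nat_of_succ_le fun m => ?_
  have h1 : H.coord s j (m + 1) ≤ 2 * H.coord s j m + 1 := by
    have := H.coord_succ s j m; omega
  have h2 : (H.coord s j (m + 1) : ℝ) ≤ 2 * H.coord s j m + 1 := by exact_mod_cast h1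
  rw [pow_succ, div_le_div_iff₀ (by positivity) (by positivity)]
  nlinarith [pow_pos (two_pos (α := ℝ)) m]

theorem coord_div_le (s : UI) (j : Fin d) (m m' : ℕ) :
    (H.coord s j m' : ℝ) / 2 ^ m' ≤ ((H.coord s j m : ℝ) + 1) / 2 ^ m := by
  refine (H.monotone_coord_div s j (le_max_right m m')).trans
    (le_trans ?_ (H.antitone_coord_add_one_div s j (le_max_left m m')))
  change _ / _ ≤ _ / _
  gcongr
  linarith

theorem coord_div_le_curve (s : UI) (j : Fin d) (m : ℕ) :
    (H.coord s j m : ℝ) / 2 ^ m ≤ H.curve s j :=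
  le_ciSup (f := fun m : ℕ => (H.coord s j m : ℝ) / 2 ^ m)
    ⟨_, by rintro _ ⟨m', rfl⟩; exact H.coord_div_le s j 0 m'⟩ m

theorem curve_le_coord_add_one_div (s : UI) (j : Fin d) (m : ℕ) :
    H.curve s j ≤ ((H.coord s j m : ℝ) + 1) / 2 ^ m :=
  ciSup_le fun m' => H.coord_div_le s j m m'

theorem curve_nonneg (s : UI) (j : Fin d) : 0 ≤ H.curve s j :=
  le_trans (by positivity) (H.coord_div_le_curve s j 0)

/-- At each level the cubes visited at two close times are equal or adjacent. -/
theorem abs_curve_sub_le {m : ℕ} {s s' : UI} (h : |(s : ℝ) - s'| < 1 / 2 ^ (d * m))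
    (j : Fin d) : |H.curve s j - H.curve s' j| ≤ 2 / 2 ^ m := by
  wlog hss : s ≤ s' generalizing s s'
  · rw [abs_sub_comm]
    exact this (by rwa [abs_sub_comm]) (le_of_not_ge hss)
  have hp : (0 : ℝ) < 2 ^ m := by positivity
  have hc : H.coord s j m ≤ H.coord s' j m + 1 ∧ H.coord s' j m ≤ H.coord s j m + 1 := by
    have h' : (s' : ℝ) - s < 1 / 2 ^ (d * m) := (le_abs_self _).trans_lt (by rwa [abs_sub_comm])
    rcases dyadicIndex_close hss h' with h1 | h1
    · simp [coord, h1]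
    · have h2 := dyadicIndex_lt d m s'
      rw [h1] at h2
      have := (H.adjacent m _ h2).1 j
      simpa [coord, h1] using this
  have c1 : (H.coord s j m : ℝ) ≤ H.coord s' j m + 1 := by exact_mod_cast hc.1
  have c2 : (H.coord s' j m : ℝ) ≤ H.coord s j m + 1 := by exact_mod_cast hc.2
  have b1 := (div_le_iff₀ hp).1 (H.coord_div_le_curve s j m)
  have b2 := (le_div_iff₀ hp).1 (H.curve_le_coord_add_one_div s j m)
  have b3 := (div_le_iff₀ hp).1 (H.coord_div_le_curve s' j m)
  have b4 := (le_div_iff₀ hp).1 (H.curve_le_coord_add_one_div s' j m)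
  rw [le_div_iff₀ hp, ← abs_of_pos hp, ← abs_mul, sub_mul, abs_le]
  constructor <;> linarith

theorem continuous_curve : Continuous H.curve := by
  refine continuous_pi fun j => Metric.continuous_iff.2 fun s ε hε => ?_
  obtain ⟨m, hm⟩ := exists_pow_lt_of_lt_one (half_pos hε) (one_half_lt_one (α := ℝ))
  refine ⟨1 / 2 ^ (d * m), by positivity, fun s' hs' => ?_⟩
  refine (H.abs_curve_sub_le hs' j).trans_lt ?_
  rw [div_pow, one_pow] at hm
  rw [← mul_one_div]
  linarith

theorem toState_apply {s : UI} (hs : s ∈ H.domain) (j : Fin d) :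
    (H.toState s j : ℝ) = H.curve s j :=
  Int.fract_eq_self.2 ⟨H.curve_nonneg s j, hs j⟩

theorem isOpen_domain : IsOpen H.domain := by
  have : H.domain = ⋂ j, {s | H.curve s j < 1} := by
    ext s; simp [domain]
  rw [this]
  exact isOpen_iInter_of_finite fun j =>
    isOpen_lt ((continuous_apply j).comp H.continuous_curve) continuous_const

theorem continuousAt_toState {s : UI} (hs : s ∈ H.domain) : ContinuousAt H.toState s := by
  refine continuousAt_pi.2 fun j => ?_
  refine tendsto_subtype_rng.2 ?_
  rw [H.toState_apply hs]
  refine (((continuous_apply j).comp H.continuous_curve).tendsto s).congr' ?_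
  filter_upwards [H.isOpen_domain.mem_nhds hs] with s' hs'
  exact (H.toState_apply hs' j).symm

theorem measurable_toState : Measurable H.toState :=
  measurable_pi_lambda _ fun j => Measurable.subtype_mk
    (((measurable_pi_apply j).comp H.continuous_curve.measurable).fract)

/-- The points of the state space none of whose coordinates is a dyadic number. -/
def nonDyadic (d : ℕ) : Set (State d) := {x | ∀ (j : Fin d) (m k : ℕ), (x j : ℝ) * 2 ^ m ≠ k}

/-- The cube of level `m` visited at time `s` is determined by `H(s)` if this point lies in the
interior of a dyadic cube. -/
theorem coord_eq_floor {s : UI} {y : ℝ} {j : Fin d} {m k : ℕ} (h : H.curve s j = y)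
    (h1 : (k : ℝ) < y * 2 ^ m) (h2 : y * 2 ^ m < k + 1) : H.coord s j m = k := by
  have hp : (0 : ℝ) < 2 ^ m := by positivity
  have b1 := (div_le_iff₀ hp).1 (H.coord_div_le_curve s j m)
  have b2 := (le_div_iff₀ hp).1 (H.curve_le_coord_add_one_div s j m)
  rw [h] at b1 b2
  have c1 : (H.coord s j m : ℝ) < ((k + 1 : ℕ) : ℝ) := by push_cast; linarith
  have c2 : (k : ℝ) < ((H.coord s j m + 1 : ℕ) : ℝ) := by push_cast; linarith
  have := Nat.cast_lt.1 c1
  have := Nat.cast_lt.1 c2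
  omega

section PseudoInverse

variable {H} {h : State d → UI}

theorem mem_domain_of_pseudoInverse (hh : ∀ x j, H.curve (h x) j = (x j : ℝ)) (x : State d) :
    h x ∈ H.domain := fun j => by
  rw [hh]; exact (x j).2.2

theorem toState_pseudoInverse (hh : ∀ x j, H.curve (h x) j = (x j : ℝ)) (x : State d) :
    H.toState (h x) = x := by
  funext j
  exact Subtype.ext ((H.toState_apply (mem_domain_of_pseudoInverse hh x) j).trans (hh x j))

/-- Close to a point without dyadic coordinates, the pseudo-inverse stays in the dyadic interval
of a given level, because the point is interior to its dyadic cube. -/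
theorem continuousAt_pseudoInverse (hh : ∀ x j, H.curve (h x) j = (x j : ℝ)) (hd : 0 < d)
    {x : State d} (hx : x ∈ nonDyadic d) :
    ContinuousAt h x := by
  refine Metric.tendsto_nhds.2 fun ε hε => ?_
  obtain ⟨m, hm⟩ := exists_pow_lt_of_lt_one hε (one_half_lt_one (α := ℝ))
  let c : Fin d → ℕ := fun j => ⌊(x j : ℝ) * 2 ^ m⌋₊
  have hc1 : ∀ j, (c j : ℝ) < x j * 2 ^ m := fun j =>
    lt_of_le_of_ne (Nat.floor_le (mul_nonneg (x j).2.1 (by positivity))) (hx j m _).symm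
  have hc2 : ∀ j, (x j : ℝ) * 2 ^ m < c j + 1 := fun j => Nat.lt_floor_add_one _
  have hev : ∀ᶠ y : State d in 𝓝 x, ∀ j, (c j : ℝ) < y j * 2 ^ m ∧ (y j : ℝ) * 2 ^ m < c j + 1 := by
    refine eventually_all.2 fun j => ?_
    have hcont : Continuous fun y : State d => (y j : ℝ) * 2 ^ m := by fun_prop
    exact (hcont.continuousAt.eventually (lt_mem_nhds (hc1 j))).and
      (hcont.continuousAt.eventually (gt_mem_nhds (hc2 j)))
  filter_upwards [hev] with y hy
  have e : dyadicIndex d m (h y) = dyadicIndex d m (h x) := by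
    refine (H.bijOn m).injOn (dyadicIndex_lt d m _) (dyadicIndex_lt d m _) (funext fun j => ?_)
    exact (H.coord_eq_floor (hh y j) (hy j).1 (hy j).2).trans
      (H.coord_eq_floor (hh x j) (hc1 j) (hc2 j)).symm
  refine (abs_sub_lt_of_dyadicIndex_eq e).trans_le (le_trans ?_ hm.le)
  rw [div_pow, one_pow]
  gcongr
  · norm_num
  · exact Nat.le_mul_of_pos_left m hd

end PseudoInverse

end HilbertOrder

/-! ### Coordinate hyperplanes are null -/

theorem volume_hyperplane {d : ℕ} (j : Fin d) (c : ℝ) :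
    (volume : Measure (State d)) {x | (x j : ℝ) = c} = 0 := by
  have h : (volume : Measure UI) {v : UI | (v : ℝ) = c} = 0 :=
    Set.Subsingleton.measure_zero (fun v hv w hw =>
      Subtype.ext ((hv : (v : ℝ) = _).trans (hw : (w : ℝ) = _).symm)) volume
  have hm : MeasurableSet {v : UI | (v : ℝ) = c} :=
    measurable_subtype_coe (measurableSet_singleton c)
  rw [← h, ← (measurePreserving_eval (fun _ : Fin d => (volume : Measure UI)) j).measure_preimage
    hm.nullMeasurableSet]
  rfl

theorem ae_mem_nonDyadic {d : ℕ} :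
    ∀ᵐ x ∂(volume : Measure (State d)), x ∈ HilbertOrder.nonDyadic d := by
  refine ae_all_iff.2 fun j => ae_all_iff.2 fun m => ae_all_iff.2 fun k => ?_
  filter_upwards [measure_eq_zero_iff_ae_notMem.1 (volume_hyperplane j ((k : ℝ) / 2 ^ m))]
    with x hx hk
  exact hx ((eq_div_iff (by positivity)).2 hk)

theorem measurableSet_nonDyadic (d : ℕ) : MeasurableSet (HilbertOrder.nonDyadic d) := by
  have : HilbertOrder.nonDyadic d = ⋂ (j : Fin d) (m : ℕ) (k : ℕ),
      {x | (x j : ℝ) * 2 ^ m = k}ᶜ := by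
    ext x; simp [HilbertOrder.nonDyadic]
  rw [this]
  refine .iInter fun j => .iInter fun m => .iInter fun k => MeasurableSet.compl ?_
  exact measurableSet_eq_fun (by fun_prop) measurable_const

/-- The pseudo-inverse is an arbitrary right inverse of the curve, so it need not be measurable, but
it is determined and continuous up to a null set. -/
theorem HilbertOrder.aemeasurable_pseudoInverse {d : ℕ} {H : HilbertOrder d} {h : State d → UI}
    (hd : 0 < d) (hh : ∀ x j, H.curve (h x) j = (x j : ℝ)) :
    AEMeasurable h (volume : Measure (State d)) := by
  have hc : ContinuousOn h (HilbertOrder.nonDyadic d) := fun x hx =>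
    (continuousAt_pseudoInverse hh hd hx).continuousWithinAt
  have := hc.aemeasurable (μ := volume) (measurableSet_nonDyadic d)
  rwa [Measure.restrict_eq_self_of_ae_mem ae_mem_nonDyadic] at this

end

/-! ### Independence of the coordinates of a uniform point -/

noncomputable section

/-- A function of a uniform point that does not depend on the `t`-th coordinate is independent of
that coordinate. -/
theorem map_prodMk_eval {k : ℕ} (t : Fin k) {S : Type*} [MeasurableSpace S]
    {ψ : (Fin k → UI) → S} (hψ : Measurable ψ)
    (hind : ∀ u a, ψ (Function.update u t a) = ψ u) :
    (volume : Measure (Fin k → UI)).map (fun u => (ψ u, u t)) =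
      ((volume : Measure (Fin k → UI)).map ψ).prod volume := by
  obtain ⟨n, rfl⟩ : ∃ n, k = n + 1 := ⟨k - 1, by have := t.pos; omega⟩
  let e := MeasurableEquiv.piFinSuccAbove (fun _ : Fin (n + 1) => UI) t
  have he : MeasurePreserving e volume volume :=
    volume_preserving_piFinSuccAbove (fun _ : Fin (n + 1) => UI) t
  let φ : (Fin n → UI) → S := fun r => ψ (e.symm (default, r))
  have hφ : Measurable φ := hψ.comp (e.symm.measurable.comp measurable_prodMk_left)
  have hψφ : ∀ u, ψ u = φ (e u).2 := fun u => by
    have : e.symm (default, (e u).2) = Function.update u t default := by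
      change t.insertNth default (t.removeNth u) = _
      rw [Fin.insertNth_removeNth]
    rw [← hind u default, ← this]
  have hlaw : ∀ f : S × UI → ENNReal, Measurable f →
      ∫⁻ u, f (ψ u, u t) = ∫⁻ r, ∫⁻ a, f (φ r, a) := fun f hf => by
    have h1 : ∫⁻ u, f (ψ u, u t) = ∫⁻ u, (fun q : UI × (Fin n → UI) => f (φ q.2, q.1)) (e u) :=
      lintegral_congr fun u => by rw [hψφ]; rfl
    rw [h1, he.lintegral_comp (f := fun q : UI × (Fin n → UI) => f (φ q.2, q.1))
      (hf.comp ((hφ.comp measurable_snd).prodMk measurable_fst))]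
    exact lintegral_prod_symm (μ := (volume : Measure UI)) (ν := (volume : Measure (Fin n → UI)))
      (fun q : UI × (Fin n → UI) => f (φ q.2, q.1))
      (hf.comp ((hφ.comp measurable_snd).prodMk measurable_fst)).aemeasurable
  refine Measure.ext_of_lintegral _ fun f hf => ?_
  rw [lintegral_map hf (hψ.prodMk (measurable_pi_apply t)), lintegral_prod _ hf.aemeasurable,
    lintegral_map (Measurable.lintegral_prod_right' hf) hψ, hlaw f hf]
  have := hlaw (fun q => ∫⁻ a, f (q.1, a))
    ((Measurable.lintegral_prod_right' hf).comp measurable_fst)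
  simpa using this.symm

/-- An almost sure property of the `t`-th coordinate may involve a function of the other ones. -/
theorem ae_of_forall_ae_eval {k : ℕ} (t : Fin k) {S : Type*} [MeasurableSpace S]
    {ψ : (Fin k → UI) → S} (hψ : Measurable ψ)
    (hind : ∀ u a, ψ (Function.update u t a) = ψ u) {P : Set (S × UI)} (hP : MeasurableSet P)
    (h : ∀ s, ∀ᵐ a, (s, a) ∈ P) : ∀ᵐ u : Fin k → UI, (ψ u, u t) ∈ P := by
  have h1 : ∀ᵐ q ∂((volume : Measure (Fin k → UI)).map ψ).prod (volume : Measure UI), q ∈ P := by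
    refine (Measure.measure_prod_null hP.compl).2 (.of_forall fun s => h s)
  rw [← map_prodMk_eval t hψ hind] at h1
  exact ae_of_ae_map (hψ.prodMk (measurable_pi_apply t)).aemeasurable h1

/-! ### The inverse Rosenblatt transform -/

/-- The conditions on a Rosenblatt transform that make it a continuous bijection of `[0,1)^d` to
itself. The condition `null_zero` makes the conditional CDFs vanish at zero, so that they take all
values in `[0,1)`. -/
structure RosenblattInvertible {d : ℕ} (κ : CondLaws d) : Prop where
  markov : ∀ i, IsMarkovKernel (κ i)
  strictMono : ∀ x i, StrictMono fun c : UI => rosenblatt κ (Function.update x i c) i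
  continuous : Continuous (rosenblatt κ)
  null_zero : ∀ i z, κ i z {default} = 0

/-- The point with prescribed coordinates before the `i`-th one, and all others equal to `c`. -/
def extendPast {d : ℕ} (i : Fin d) (z : {j : Fin d // j < i} → UI) (c : UI) : State d :=
  fun j => if h : j < i then z ⟨j, h⟩ else c

theorem past_extendPast {d : ℕ} (i : Fin d) (z : {j : Fin d // j < i} → UI) (c : UI) :
    past i (extendPast i z c) = z := by
  funext j
  simp [past, extendPast, j.2]

theorem rosenblatt_extendPast {d : ℕ} (κ : CondLaws d) (i : Fin d)
    (z : {j : Fin d // j < i} → UI) (c : UI) :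
    rosenblatt κ (extendPast i z c) i = cdfUI (κ i z) c := by
  rw [rosenblatt, past_extendPast]
  simp [extendPast]

theorem continuous_extendPast {d : ℕ} (i : Fin d) :
    Continuous fun p : ({j : Fin d // j < i} → UI) × UI => extendPast i p.1 p.2 := by
  refine continuous_pi fun j => ?_
  by_cases h : j < i
  · simp only [extendPast, h, dite_true]; fun_prop
  · simp only [extendPast, h, dite_false]; fun_prop

theorem measurable_past {d : ℕ} (i : Fin d) : Measurable (past i : State d → _) :=
  measurable_pi_lambda _ fun _ => measurable_pi_apply _

namespace RosenblattInvertible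

variable {d : ℕ} {κ : CondLaws d}

theorem strictMono_cdfUI (hκ : RosenblattInvertible κ) (i : Fin d)
    (z : {j : Fin d // j < i} → UI) : StrictMono (cdfUI (κ i z)) := fun a b hab => by
  have h : ∀ c, Function.update (extendPast i z default) i c =
      fun j => if h : j < i then z ⟨j, h⟩ else if j = i then c else default := fun c => by
    funext j
    by_cases hj : j = i
    · subst hj; simp
    · simp [extendPast, hj]
  have h2 : ∀ c, rosenblatt κ (Function.update (extendPast i z default) i c) i =
      cdfUI (κ i z) c := fun c => by
    have hp : past i (Function.update (extendPast i z default) i c) = z := by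
      funext j
      rw [h]
      simp [past, j.2]
    rw [rosenblatt, hp, Function.update_self]
  simpa only [h2] using hκ.strictMono (extendPast i z default) i hab

theorem exists_cdfUI_eq (hκ : RosenblattInvertible κ) (i : Fin d)
    (z : {j : Fin d // j < i} → UI) (v : UI) : ∃ c, cdfUI (κ i z) c = v := by
  have := hκ.markov i
  have hcont : Continuous (cdfUI (κ i z)) := by
    have h1 : Continuous fun c => rosenblatt κ (extendPast i z c) i :=
      (continuous_apply i).comp (hκ.continuous.comp
        ((continuous_extendPast i).comp (continuous_const.prodMk continuous_id)))
    simpa only [rosenblatt_extendPast] using h1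
  obtain ⟨b, hb⟩ := exists_lt_cdfUI (κ i z) v
  have h0 : cdfUI (κ i z) default ≤ v := by
    have : Set.Iic (default : UI) = {default} :=
      Set.ext fun x => ⟨fun hx => le_antisymm hx x.2.1, fun hx => le_of_eq hx⟩
    rw [cdfUI, this, Measure.real, hκ.null_zero i z, ENNReal.toReal_zero]
    exact v.2.1
  exact mem_range_of_exists_le_of_exists_ge hcont ⟨_, h0⟩ ⟨b, hb.le⟩

theorem quantile_cdfUI (hκ : RosenblattInvertible κ) (i : Fin d)
    (z : {j : Fin d // j < i} → UI) {v c : UI} (h : cdfUI (κ i z) c = v) :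
    quantile (κ i z) v = c := by
  have := hκ.markov i
  refine le_antisymm (quantile_le h.ge) ?_
  by_contra! hlt
  exact ((quantile_le_iff.1 le_rfl).trans_lt (hκ.strictMono_cdfUI i z hlt)).ne' h

/-- The Rosenblatt transform is onto: the preimage is built coordinate by coordinate. -/
theorem rosenblatt_rosenblattInv (hκ : RosenblattInvertible κ) (v : State d) :
    rosenblatt κ (rosenblattInv κ v) = fun i => (v i : ℝ) := by
  choose c hc using hκ.exists_cdfUI_eq
  refine Function.invFun_eq ?_
  let x : State d := (wellFounded_lt (α := Fin d)).fix
    fun i rec => c i (fun j => rec j.1 j.2) (v i)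
  refine ⟨x, funext fun i => ?_⟩
  have hx : x i = c i (past i x) (v i) :=
    (wellFounded_lt (α := Fin d)).fix_eq (fun i rec => c i (fun j => rec j.1 j.2) (v i)) i
  rw [rosenblatt]
  conv_lhs => rw [hx]
  exact hc i _ (v i)

theorem cdfUI_rosenblattInv (hκ : RosenblattInvertible κ) (v : State d) (i : Fin d) :
    cdfUI (κ i (past i (rosenblattInv κ v))) (rosenblattInv κ v i) = v i :=
  congrFun (hκ.rosenblatt_rosenblattInv v) i

theorem rosenblattInv_apply (hκ : RosenblattInvertible κ) (v : State d) (i : Fin d) :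
    rosenblattInv κ v i = quantile (κ i (past i (rosenblattInv κ v))) (v i) :=
  (hκ.quantile_cdfUI i _ (hκ.cdfUI_rosenblattInv v i)).symm

theorem rosenblattInv_congr (hκ : RosenblattInvertible κ) {v v' : State d} (i : Fin d)
    (h : ∀ j, j ≤ i → v j = v' j) : rosenblattInv κ v i = rosenblattInv κ v' i := by
  induction i using WellFoundedLT.induction with
  | ind i ih =>
    have : past i (rosenblattInv κ v) = past i (rosenblattInv κ v') := funext fun j =>
      ih j.1 j.2 fun k hk => h k (hk.trans j.2.le)
    rw [hκ.rosenblattInv_apply v, hκ.rosenblattInv_apply v', this, h i le_rfl]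

/-- The inverse Rosenblatt transform is jointly continuous in the level and in the parameter on
which the conditional distributions depend. -/
theorem continuous_rosenblattInv {S : Type*} [TopologicalSpace S] {κ : S → CondLaws d}
    (hκ : ∀ s, RosenblattInvertible (κ s))
    (hc : Continuous fun p : S × State d => rosenblatt (κ p.1) p.2) :
    Continuous fun p : S × State d => rosenblattInv (κ p.1) p.2 := by
  refine continuous_iff_continuousAt.2 fun p₀ => tendsto_pi_nhds.2 fun i => ?_
  induction i using WellFoundedLT.induction with
  | ind i ih =>
    have hpast : Tendsto (fun p : S × State d => past i (rosenblattInv (κ p.1) p.2)) (𝓝 p₀)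
        (𝓝 (past i (rosenblattInv (κ p₀.1) p₀.2))) :=
      tendsto_pi_nhds.2 fun j => ih j.1 j.2
    have hv : Tendsto (fun p : S × State d => (p.2 i : ℝ)) (𝓝 p₀) (𝓝 (p₀.2 i : ℝ)) :=
      Continuous.tendsto (by fun_prop) p₀
    have hF : ∀ a, Tendsto (fun p : S × State d =>
        cdfUI (κ p.1 i (past i (rosenblattInv (κ p.1) p.2))) a) (𝓝 p₀)
        (𝓝 (cdfUI (κ p₀.1 i (past i (rosenblattInv (κ p₀.1) p₀.2))) a)) := fun a => by
      simp only [← rosenblatt_extendPast]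
      have h1 : Tendsto (fun p : S × State d =>
          (p.1, extendPast i (past i (rosenblattInv (κ p.1) p.2)) a)) (𝓝 p₀)
          (𝓝 (p₀.1, extendPast i (past i (rosenblattInv (κ p₀.1) p₀.2)) a)) :=
        (continuous_fst.tendsto p₀).prodMk_nhds
          (((continuous_extendPast i).tendsto (_, a)).comp
            (hpast.prodMk_nhds tendsto_const_nhds))
      exact (((continuous_apply i).comp hc).tendsto _).comp h1
    refine tendsto_of_tendsto_cdf (fun a _ => hF a) hv (.of_forall fun p b hb => ?_)
      (.of_forall fun p b hb => ?_) (fun a _ ha => ?_) (fun a _ ha => ?_)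
    · rw [← (hκ p.1).cdfUI_rosenblattInv p.2 i] at hb
      exact (((hκ p.1).strictMono_cdfUI i _).lt_iff_lt.1 hb).le
    · rw [← (hκ p.1).cdfUI_rosenblattInv p.2 i] at hb
      exact (((hκ p.1).strictMono_cdfUI i _).lt_iff_lt.1 hb).le
    · rw [← (hκ p₀.1).cdfUI_rosenblattInv p₀.2 i]
      exact (hκ p₀.1).strictMono_cdfUI i _ ha
    · rw [← (hκ p₀.1).cdfUI_rosenblattInv p₀.2 i]
      exact (hκ p₀.1).strictMono_cdfUI i _ ha

theorem continuous_rosenblattInv_self (hκ : RosenblattInvertible κ) :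
    Continuous (rosenblattInv κ) :=
  (continuous_rosenblattInv (S := Unit) (κ := fun _ => κ) (fun _ => hκ)
    (hκ.continuous.comp continuous_snd)).comp
    ((continuous_const (y := ())).prodMk continuous_id)

end RosenblattInvertible

/-- The point whose coordinates from the `n`-th one on are reset. -/
def cutAt {d : ℕ} (n : ℕ) (x : State d) : State d := fun j => if j.1 < n then x j else default

theorem measurable_cutAt {d : ℕ} (n : ℕ) : Measurable (cutAt n : State d → State d) := by
  refine measurable_pi_lambda _ fun j => ?_
  by_cases h : j.1 < n
  · simp only [cutAt, h, if_true]; exact measurable_pi_apply j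
  · simp only [cutAt, h, if_false]; exact measurable_const

/-- The inverse Rosenblatt transform of a law maps the uniform law to it: by induction, this holds
for the law of the first `n` coordinates. -/
theorem RosenblattInvertible.map_rosenblattInv {d : ℕ} {κ : CondLaws d}
    (hκ : RosenblattInvertible κ) {π : Measure (State d)} [IsProbabilityMeasure π]
    (hπ : IsCondLaws π κ) : (volume : Measure (State d)).map (rosenblattInv κ) = π := by
  have hm : Measurable (rosenblattInv κ) := hκ.continuous_rosenblattInv_self.measurable
  have key : ∀ n ≤ d, (volume : Measure (State d)).map (fun v => cutAt n (rosenblattInv κ v)) =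
      π.map (cutAt n) := by
    intro n
    induction n with
    | zero =>
      intro _
      have : (cutAt 0 : State d → State d) = fun _ => default := by
        funext x j; simp [cutAt]
      simp [this]
    | succ n ih =>
      intro hn
      let i : Fin d := ⟨n, hn⟩
      have := hκ.markov i
      have hpc : ∀ x : State d, past i x = past i (cutAt n x) := fun x => funext fun j => by
        have : j.1.1 < n := j.2
        simp [past, cutAt, this]
      have hpast : (volume : Measure (State d)).map (fun v => past i (rosenblattInv κ v)) =
          π.map (past i) := by
        have h1 := congrArg (fun ν => Measure.map (past i) ν) (ih (by omega))
        have hm1 : Measurable fun v => cutAt n (rosenblattInv κ v) := (measurable_cutAt n).comp hm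
        rw [Measure.map_map (measurable_past i) hm1,
          Measure.map_map (measurable_past i) (measurable_cutAt n)] at h1
        simpa only [Function.comp_def, ← hpc] using h1
      have hind : ∀ (v : State d) (a : UI), past i (rosenblattInv κ (Function.update v i a)) =
          past i (rosenblattInv κ v) := fun v a => funext fun j =>
        hκ.rosenblattInv_congr j.1 fun k hk =>
          Function.update_of_ne (ne_of_lt (hk.trans_lt j.2)) _ _
      have hjoint : (volume : Measure (State d)).map
          (fun v => (past i (rosenblattInv κ v), rosenblattInv κ v i)) =
          π.map fun x => (past i x, x i) := by
        have h2 := map_prodMk_eval i ((measurable_past i).comp hm) hind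
        have h3 := congrArg (fun ν => Measure.map
          (fun p : ({j : Fin d // j < i} → UI) × UI => (p.1, quantile (κ i p.1) p.2)) ν) h2
        simp only [Function.comp_def] at h3
        have hm2 : Measurable fun v => (past i (rosenblattInv κ v), v i) :=
          ((measurable_past i).comp hm).prodMk (measurable_pi_apply i)
        rw [map_prod_quantile, hpast, (hπ i).2, Measure.map_map (g := fun p :
            ({j : Fin d // j < i} → UI) × UI => (p.1, quantile (κ i p.1) p.2))
          (measurable_fst.prodMk (measurable_quantile (κ i))) hm2] at h3
        rw [← h3]
        congr 1
        funext v
        simp only [Function.comp_apply]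
        rw [← hκ.rosenblattInv_apply v i]
      let g : ({j : Fin d // j < i} → UI) × UI → State d := fun p j =>
        if h : j < i then p.1 ⟨j, h⟩ else if j = i then p.2 else default
      have hg : Measurable g := by
        refine measurable_pi_lambda _ fun j => ?_
        by_cases h : j < i
        · simp only [g, h, dite_true]; fun_prop
        · by_cases h' : j = i
          · simp only [g, h', lt_irrefl, dite_false, if_true]; fun_prop
          · simp only [g, h, h', dite_false, if_false]; fun_prop
      have hgc : ∀ x : State d, g (past i x, x i) = cutAt (n + 1) x := fun x => funext fun j => by
        rcases lt_trichotomy j i with h | h | h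
        · have : j.1 < n + 1 := (show j.1 < n from h).trans (Nat.lt_succ_self n)
          simp [g, cutAt, h, past, this]
        · subst h; simp [g, cutAt, i]
        · have h1 : ¬ j.1 < n + 1 := not_lt.2 (show n < j.1 from h)
          simp [g, cutAt, h1, h.ne', not_lt.2 h.le]
      have h4 := congrArg (fun ν => Measure.map g ν) hjoint
      have hm3 : Measurable fun v => (past i (rosenblattInv κ v), rosenblattInv κ v i) :=
        ((measurable_past i).comp hm).prodMk ((measurable_pi_apply i).comp hm)
      rw [Measure.map_map hg hm3,
        Measure.map_map hg ((measurable_past i).prodMk (measurable_pi_apply i))] at h4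
      simpa only [Function.comp_def, hgc] using h4
  have hd := key d le_rfl
  have hid : (cutAt d : State d → State d) = id := by
    funext x j; simp [cutAt]
  simpa [hid] using hd

theorem IsHolder.continuous {α β : Type} [PseudoEMetricSpace α] [PseudoEMetricSpace β]
    {f : α → β} (hf : IsHolder f) : Continuous f := by
  obtain ⟨C, r, hr, -, h⟩ := hf
  exact h.continuous hr

theorem RosenblattRegular.invertible {d : ℕ} {K : State d → Measure (State d)}
    {κ : State d → CondLaws d} (h : RosenblattRegular K κ) (hb : BoundedCondDensities κ)
    (x' : State d) : RosenblattInvertible (κ x') where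
  markov i := (h.1 x' i).1
  strictMono x i := h.2.1 x' x i
  continuous := h.2.2.continuous.comp (continuous_const.prodMk continuous_id)
  null_zero i z := by
    obtain ⟨C, hC⟩ := hb
    obtain ⟨p, -, -, hp⟩ := hC x' i z
    rw [hp]
    exact withDensity_absolutelyContinuous _ _ (measure_singleton _)

end

/-! ### Recursions for the smoothing and filtering distributions -/

noncomputable section

/-- Appending a last coordinate. -/
def snocState {d t : ℕ} (y : Fin (t + 1) → State d) (a : State d) : Fin (t + 2) → State d :=
  Fin.snoc (α := fun _ => State d) y a

theorem snocState_castSucc {d t : ℕ} (y : Fin (t + 1) → State d) (a : State d)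
    (i : Fin (t + 1)) : snocState y a i.castSucc = y i :=
  Fin.snoc_castSucc (α := fun _ => State d) a y i

theorem snocState_last {d t : ℕ} (y : Fin (t + 1) → State d) (a : State d) :
    snocState y a (Fin.last (t + 1)) = a :=
  Fin.snoc_last (α := fun _ => State d) a y

theorem measurable_snocState {d t : ℕ} :
    Measurable fun q : (Fin (t + 1) → State d) × State d => snocState q.1 q.2 := by
  refine measurable_pi_lambda _ fun i => ?_
  refine Fin.lastCases ?_ (fun i => ?_) i
  · simp only [snocState_last]; exact measurable_snd
  · simp only [snocState_castSucc]; exact (measurable_pi_apply i).comp measurable_fst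

namespace FeynmanKac

variable {d : ℕ} (M : FeynmanKac d)

/-- The reference measures `m_0, dx, …, dx`. -/
def refMeasure (t : ℕ) : Fin (t + 1) → Measure (State d) :=
  Fin.cons (α := fun _ => Measure (State d)) M.init fun _ => volume

instance instIsProbabilityMeasureRefMeasure (t : ℕ) (i : Fin (t + 1)) :
    IsProbabilityMeasure (M.refMeasure t i) := by
  refine Fin.cases ?_ (fun i => ?_) i
  · exact M.init_prob
  · change IsProbabilityMeasure (volume : Measure (State d)); infer_instance

theorem lintegral_refMeasure_succ (t : ℕ) {f : (Fin (t + 2) → State d) → ENNReal}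
    (hf : Measurable f) :
    ∫⁻ x, f x ∂Measure.pi (M.refMeasure (t + 1)) =
      ∫⁻ y, ∫⁻ a, f (snocState y a) ∂volume ∂Measure.pi (M.refMeasure t) := by
  have he := measurePreserving_piFinSuccAbove (M.refMeasure (t + 1)) (Fin.last (t + 1))
  have hμ : (fun j => M.refMeasure (t + 1) ((Fin.last (t + 1)).succAbove j)) = M.refMeasure t := by
    funext j
    rw [Fin.succAbove_last]
    refine Fin.cases rfl (fun j => rfl) j
  have hl : M.refMeasure (t + 1) (Fin.last (t + 1)) = volume := rfl
  rw [hμ, hl] at he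
  let e := MeasurableEquiv.piFinSuccAbove (fun _ : Fin (t + 2) => State d) (Fin.last (t + 1))
  have hfe : ∀ x, f x =
      (fun q : State d × (Fin (t + 1) → State d) => f (snocState q.2 q.1)) (e x) := fun x => by
      change f x =
        f (snocState (fun j => x ((Fin.last (t + 1)).succAbove j)) (x (Fin.last (t + 1))))
      congr 1
      funext i
      refine Fin.lastCases ?_ (fun i => ?_) i
      · rw [snocState_last]
      · rw [snocState_castSucc, Fin.succAbove_last]
  have hm : Measurable fun q : State d × (Fin (t + 1) → State d) => f (snocState q.2 q.1) :=
    hf.comp (measurable_snocState.comp measurable_swap)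
  rw [lintegral_congr hfe, he.lintegral_comp hm]
  exact lintegral_prod_symm (μ := (volume : Measure (State d)))
    (ν := Measure.pi (M.refMeasure t)) _ hm.aemeasurable

/-- The density of the unnormalised smoothing distribution. -/
def pathDensity (t : ℕ) (x : Fin (t + 1) → State d) : ENNReal :=
  (∏ s : Fin t, ENNReal.ofReal (M.m (s + 1) (x s.castSucc) (x s.succ))) *
    ENNReal.ofReal (M.potential t x)

/-- The function `m_t(x', x) G_t(x', x)`. -/
def mG (t : ℕ) (x' x : State d) : ℝ := M.m t x' x * M.G t x' x

theorem measurable_mG {t : ℕ} (ht : 1 ≤ t) :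
    Measurable fun q : State d × State d => M.mG t q.1 q.2 :=
  (M.m_meas t ht).mul (M.G_meas t ht)

theorem mG_nonneg {t : ℕ} (ht : 1 ≤ t) (x' x : State d) : 0 ≤ M.mG t x' x :=
  mul_nonneg (M.m_pos t ht x' x).le (M.G_nonneg t ht x' x)

theorem measurable_potential (t : ℕ) : Measurable (M.potential t) := by
  refine (M.G₀_meas.comp (measurable_pi_apply 0)).mul (Finset.measurable_prod _ fun s _ => ?_)
  have h : Measurable fun x : Fin (t + 1) → State d => (x s.castSucc, x s.succ) :=
    (measurable_pi_apply _).prodMk (measurable_pi_apply _)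
  exact (M.G_meas (s + 1) (by omega)).comp h

theorem measurable_transitions (t : ℕ) : Measurable fun x : Fin (t + 1) → State d =>
    ∏ s : Fin t, ENNReal.ofReal (M.m (s + 1) (x s.castSucc) (x s.succ)) := by
  refine Finset.measurable_prod _ fun s _ => ?_
  have h : Measurable fun x : Fin (t + 1) → State d => (x s.castSucc, x s.succ) :=
    (measurable_pi_apply _).prodMk (measurable_pi_apply _)
  exact ((M.m_meas (s + 1) (by omega)).comp h).ennreal_ofReal

theorem measurable_pathDensity (t : ℕ) : Measurable (M.pathDensity t) :=
  (M.measurable_transitions t).mul (M.measurable_potential t).ennreal_ofReal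

theorem potential_nonneg (t : ℕ) (x : Fin (t + 1) → State d) : 0 ≤ M.potential t x :=
  mul_nonneg (M.G₀_nonneg _) (Finset.prod_nonneg fun s _ => M.G_nonneg _ (by omega) _ _)

theorem pathDensity_snocState (t : ℕ) (y : Fin (t + 1) → State d) (a : State d) :
    M.pathDensity (t + 1) (snocState y a) =
      M.pathDensity t y * ENNReal.ofReal (M.mG (t + 1) (y (Fin.last t)) a) := by
  have hpot : M.potential (t + 1) (snocState y a) =
      M.potential t y * M.G (t + 1) (y (Fin.last t)) a := by
    have h0 : snocState y a 0 = y 0 := snocState_castSucc y a 0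
    rw [potential, potential, Fin.prod_univ_castSucc, h0, ← mul_assoc]
    simp only [Fin.succ_castSucc, snocState_castSucc, Fin.succ_last, snocState_last,
      Fin.val_castSucc, Fin.val_last]
  rw [pathDensity, pathDensity, hpot, Fin.prod_univ_castSucc, mG,
    ENNReal.ofReal_mul (M.potential_nonneg t y), ENNReal.ofReal_mul (M.m_pos _ (by omega) _ _).le]
  simp only [Fin.succ_castSucc, snocState_castSucc, Fin.succ_last, snocState_last,
    Fin.val_castSucc, Fin.val_last]
  ring

/-- The unnormalised smoothing distribution. -/
def unnormalized (t : ℕ) : Measure (Fin (t + 1) → State d) :=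
  (M.chainLaw t).withDensity fun x => ENNReal.ofReal (M.potential t x)

theorem lintegral_unnormalized (t : ℕ) {f : (Fin (t + 1) → State d) → ENNReal}
    (hf : Measurable f) :
    ∫⁻ x, f x ∂M.unnormalized t =
      ∫⁻ x, M.pathDensity t x * f x ∂Measure.pi (M.refMeasure t) := by
  have h : M.unnormalized t = (Measure.pi (M.refMeasure t)).withDensity (M.pathDensity t) :=
    (withDensity_mul _ (M.measurable_transitions t)
      (M.measurable_potential t).ennreal_ofReal).symm
  rw [h, lintegral_withDensity_eq_lintegral_mul _ (M.measurable_pathDensity t) hf]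
  rfl

theorem lintegral_unnormalized_succ (t : ℕ) {f : (Fin (t + 2) → State d) → ENNReal}
    (hf : Measurable f) :
    ∫⁻ x, f x ∂M.unnormalized (t + 1) =
      ∫⁻ y, (∫⁻ a, f (snocState y a) * ENNReal.ofReal (M.mG (t + 1) (y (Fin.last t)) a))
        ∂M.unnormalized t := by
  have hq : Measurable fun q : (Fin (t + 1) → State d) × State d => (q.1 (Fin.last t), q.2) :=
    ((measurable_pi_apply _).comp measurable_fst).prodMk measurable_snd
  have hm : Measurable fun q : (Fin (t + 1) → State d) × State d =>
      f (snocState q.1 q.2) * ENNReal.ofReal (M.mG (t + 1) (q.1 (Fin.last t)) q.2) :=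
    (hf.comp measurable_snocState).mul ((M.measurable_mG (by omega)).comp hq).ennreal_ofReal
  rw [M.lintegral_unnormalized (t + 1) hf, M.lintegral_refMeasure_succ t
    (f := fun x => M.pathDensity (t + 1) x * f x) ((M.measurable_pathDensity _).mul hf),
    M.lintegral_unnormalized t hm.lintegral_prod_right']
  refine lintegral_congr fun y => ?_
  refine Eq.trans ?_ (lintegral_const_mul _ (hm.comp measurable_prodMk_left))
  refine lintegral_congr fun a => ?_
  rw [pathDensity_snocState]
  ring

theorem smoothing_eq (t : ℕ) :
    M.smoothing t = (M.unnormalized t Set.univ)⁻¹ • M.unnormalized t := rfl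

theorem unnormalized_univ_ne {t : ℕ} [IsProbabilityMeasure (M.smoothing t)] :
    M.unnormalized t Set.univ ≠ 0 ∧ M.unnormalized t Set.univ ≠ ⊤ := by
  have h : M.smoothing t Set.univ = 1 := measure_univ
  rw [smoothing_eq, Measure.smul_apply, smul_eq_mul] at h
  constructor <;> intro h0 <;> simp [h0] at h

/-- One step of the forward recursion for the smoothing distribution. -/
theorem exists_lintegral_smoothing_succ (t : ℕ) [IsProbabilityMeasure (M.smoothing t)]
    [IsProbabilityMeasure (M.smoothing (t + 1))] :
    ∃ c : ENNReal, c ≠ 0 ∧ ∀ f : (Fin (t + 2) → State d) → ENNReal, Measurable f →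
      ∫⁻ x, f x ∂M.smoothing (t + 1) =
        c * ∫⁻ y, (∫⁻ a, f (snocState y a) * ENNReal.ofReal (M.mG (t + 1) (y (Fin.last t)) a))
          ∂M.smoothing t := by
  obtain ⟨h0, h1⟩ := M.unnormalized_univ_ne (t := t)
  obtain ⟨h2, h3⟩ := M.unnormalized_univ_ne (t := t + 1)
  refine ⟨(M.unnormalized (t + 1) Set.univ)⁻¹ * M.unnormalized t Set.univ,
    mul_ne_zero (ENNReal.inv_ne_zero.2 h3) h0, fun f hf => ?_⟩
  rw [smoothing_eq, smoothing_eq, lintegral_smul_measure, lintegral_smul_measure,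
    M.lintegral_unnormalized_succ t hf, smul_eq_mul, smul_eq_mul, mul_assoc,
    ← mul_assoc (M.unnormalized t Set.univ), ENNReal.mul_inv_cancel h0 h1, one_mul]

theorem lintegral_filtering (t : ℕ) {f : State d → ENNReal} (hf : Measurable f) :
    ∫⁻ x, f x ∂M.filtering t = ∫⁻ y, f (y (Fin.last t)) ∂M.smoothing t :=
  lintegral_map hf (measurable_pi_apply _)

instance instIsProbabilityMeasureFiltering (t : ℕ) [IsProbabilityMeasure (M.smoothing t)] :
    IsProbabilityMeasure (M.filtering t) :=
  Measure.isProbabilityMeasure_map (measurable_pi_apply _).aemeasurable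

theorem isProbabilityMeasure_smoothing {t : ℕ} {p : State d → ℝ} (hp : Measurable p)
    (hpos : ∀ z, 0 < p z)
    (h : M.filtering t = volume.withDensity fun z => ENNReal.ofReal (p z)) :
    IsProbabilityMeasure (M.smoothing t) := by
  have h0 : M.smoothing t Set.univ ≠ 0 := by
    intro h0
    have h1 : M.filtering t Set.univ = 0 := by
      rw [filtering, Measure.map_apply (measurable_pi_apply _) MeasurableSet.univ,
        Set.preimage_univ, h0]
    rw [h, withDensity_apply _ MeasurableSet.univ, Measure.restrict_univ,
      lintegral_eq_zero_iff hp.ennreal_ofReal] at h1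
    obtain ⟨z, hz⟩ := h1.exists
    exact (ENNReal.ofReal_pos.2 (hpos z)).ne' hz
  refine ⟨?_⟩
  rw [smoothing_eq, Measure.smul_apply, smul_eq_mul] at h0 ⊢
  refine ENNReal.inv_mul_cancel (right_ne_zero_of_mul h0) ?_
  intro h1
  simp [h1] at h0

/-- The initial filtering distribution is proportional to `G_0(x) m_0(dx)`. -/
theorem exists_lintegral_filtering_zero : ∃ c : ENNReal, ∀ f : State d → ENNReal, Measurable f →
    ∫⁻ x, f x ∂M.filtering 0 = c * ∫⁻ x, f x * ENNReal.ofReal (M.G₀ x) ∂M.init := by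
  refine ⟨(M.unnormalized 0 Set.univ)⁻¹, fun f hf => ?_⟩
  rw [M.lintegral_filtering 0 hf, smoothing_eq, lintegral_smul_measure, smul_eq_mul,
    M.lintegral_unnormalized 0 (f := fun y => f (y (Fin.last 0)))
      (hf.comp (measurable_pi_apply _))]
  congr 1
  have he := measurePreserving_eval (M.refMeasure 0) 0
  have h0 : M.refMeasure 0 0 = M.init := rfl
  rw [h0] at he
  rw [← he.lintegral_comp (f := fun x => f x * ENNReal.ofReal (M.G₀ x))
    (hf.mul M.G₀_meas.ennreal_ofReal)]
  refine lintegral_congr fun x => ?_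
  simp only [pathDensity, potential, Finset.univ_eq_empty, Finset.prod_empty, one_mul, mul_one]
  rw [mul_comm]
  rfl

/-- One step of the filtering recursion. -/
theorem exists_lintegral_filtering_succ (t : ℕ) [IsProbabilityMeasure (M.smoothing t)]
    [IsProbabilityMeasure (M.smoothing (t + 1))] :
    ∃ c : ENNReal, c ≠ 0 ∧ (∀ f : State d → ENNReal, Measurable f →
      ∫⁻ x, f x ∂M.filtering (t + 1) =
        c * ∫⁻ y, (∫⁻ a, f a * ENNReal.ofReal (M.mG (t + 1) y a)) ∂M.filtering t) ∧
      ∀ f : (Fin (t + 2) → State d) → ENNReal, Measurable f →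
      ∫⁻ x, f x ∂M.smoothing (t + 1) =
        c * ∫⁻ y, (∫⁻ a, f (snocState y a) * ENNReal.ofReal (M.mG (t + 1) (y (Fin.last t)) a))
          ∂M.smoothing t := by
  obtain ⟨c, hc, h⟩ := M.exists_lintegral_smoothing_succ t
  refine ⟨c, hc, fun f hf => ?_, h⟩
  have hm : Measurable fun q : State d × State d =>
      f q.2 * ENNReal.ofReal (M.mG (t + 1) q.1 q.2) :=
    (hf.comp measurable_snd).mul (M.measurable_mG (by omega)).ennreal_ofReal
  rw [M.lintegral_filtering (t + 1) hf,
    h (fun y => f (y (Fin.last (t + 1)))) (hf.comp (measurable_pi_apply _)),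
    M.lintegral_filtering t hm.lintegral_prod_right']
  simp only [snocState_last]

end FeynmanKac

end

/-! ### Backward kernels of the Feynman-Kac model -/

noncomputable section

namespace FeynmanKac

variable {d : ℕ} (M : FeynmanKac d)

/-- The integral of `m_{t+1}(y, x) G_{t+1}(y, x)` with respect to the filtering law of `y`, as an
extended number. -/
def predictive (t : ℕ) (x : State d) : ENNReal :=
  ∫⁻ y, ENNReal.ofReal (M.mG (t + 1) y x) ∂M.filtering t

theorem measurable_predictive (t : ℕ) [IsProbabilityMeasure (M.smoothing t)] :
    Measurable (M.predictive t) :=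
  ((M.measurable_mG (by omega)).ennreal_ofReal).lintegral_prod_left'

theorem filtering_succ_eq_withDensity {t : ℕ} [IsProbabilityMeasure (M.smoothing t)]
    {c : ENNReal} (hrec : ∀ f : State d → ENNReal, Measurable f →
      ∫⁻ x, f x ∂M.filtering (t + 1) =
        c * ∫⁻ y, (∫⁻ a, f a * ENNReal.ofReal (M.mG (t + 1) y a)) ∂M.filtering t) :
    M.filtering (t + 1) = volume.withDensity fun x => c * M.predictive t x := by
  have hmG : Measurable fun q : State d × State d => ENNReal.ofReal (M.mG (t + 1) q.1 q.2) :=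
    (M.measurable_mG (by omega)).ennreal_ofReal
  refine Measure.ext_of_lintegral _ fun f hf => ?_
  have hm : Measurable fun q : State d × State d =>
      f q.2 * ENNReal.ofReal (M.mG (t + 1) q.1 q.2) := (hf.comp measurable_snd).mul hmG
  rw [hrec f hf, lintegral_withDensity_eq_lintegral_mul _
    ((M.measurable_predictive t).const_mul c) hf,
    lintegral_lintegral_swap hm.aemeasurable,
    ← lintegral_const_mul _ (Measurable.lintegral_prod_left' hm)]
  refine lintegral_congr fun a => ?_
  have hma : Measurable fun y => ENNReal.ofReal (M.mG (t + 1) y a) :=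
    hmG.comp measurable_prodMk_right
  rw [lintegral_const_mul (f a) hma]
  simp only [Pi.mul_apply, predictive]
  ring

/-- The density of the filtering distribution is positive and finite, and proportional to
`predictive`. -/
theorem ae_predictive_ne {t : ℕ} [IsProbabilityMeasure (M.smoothing t)]
    [IsProbabilityMeasure (M.smoothing (t + 1))] {c : ENNReal} (hc : c ≠ 0)
    (hd : M.filtering (t + 1) = volume.withDensity fun x => c * M.predictive t x)
    {p : State d → ℝ} (hp : Measurable p) (hpos : ∀ z, 0 < p z)
    (h : M.filtering (t + 1) = volume.withDensity fun z => ENNReal.ofReal (p z)) :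
    ∀ᵐ x : State d, M.predictive t x ≠ 0 ∧ M.predictive t x ≠ ⊤ := by
  have hfin : ∫⁻ z, ENNReal.ofReal (p z) ≠ ⊤ := by
    have := measure_ne_top (M.filtering (t + 1)) Set.univ
    rwa [h, withDensity_apply _ MeasurableSet.univ, Measure.restrict_univ] at this
  have hae := (withDensity_eq_iff hp.ennreal_ofReal.aemeasurable
    ((M.measurable_predictive t).const_mul c).aemeasurable hfin).1 (h.symm.trans hd)
  filter_upwards [hae] with x hx
  constructor
  · intro h0
    rw [h0, mul_zero] at hx
    exact (ENNReal.ofReal_pos.2 (hpos x)).ne' hx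
  · intro h0
    rw [h0, ENNReal.mul_top hc] at hx
    exact ENNReal.ofReal_ne_top hx

theorem integral_mG_eq_toReal (t : ℕ) (x : State d) :
    ∫ y, M.mG (t + 1) y x ∂M.filtering t = (M.predictive t x).toReal :=
  integral_eq_lintegral_of_nonneg_ae (.of_forall fun y => M.mG_nonneg (by omega) y x)
    ((M.measurable_mG (by omega)).comp measurable_prodMk_right).aestronglyMeasurable

theorem Gtilde_eq (t : ℕ) (π : Measure (State d)) (x' x : State d) :
    M.Gtilde t π x' x = M.mG t x' x / ∫ y, M.mG t y x ∂π := rfl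

theorem Gtilde_nonneg {t : ℕ} (ht : 1 ≤ t) (π : Measure (State d)) (x' x : State d) :
    0 ≤ M.Gtilde t π x' x :=
  div_nonneg (M.mG_nonneg ht x' x) (integral_nonneg fun y => M.mG_nonneg ht y x)

/-- The denominator of `G̃` vanishes nowhere. It is nonzero almost everywhere, and where it
vanishes, `G̃` is zero by the convention on division. So the total mass of the backward kernel takes
values in `{0, 1}`, and is one somewhere; being continuous on a connected space, it is one
everywhere. -/
theorem integral_mG_ne_zero {t : ℕ} [IsProbabilityMeasure (M.smoothing t)]
    (hae : ∀ᵐ x : State d, M.predictive t x ≠ 0 ∧ M.predictive t x ≠ ⊤)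
    (hcont : Continuous (Function.uncurry (M.Gtilde (t + 1) (M.filtering t)))) {C : ℝ}
    (hC : ∀ z' z, |M.Gtilde (t + 1) (M.filtering t) z' z| ≤ C) (x : State d) :
    ∫ y, M.mG (t + 1) y x ∂M.filtering t ≠ 0 := by
  let J : State d → ℝ := fun x => ∫ y, M.Gtilde (t + 1) (M.filtering t) y x ∂M.filtering t
  have hJ : Continuous J := by
    refine continuous_of_dominated (bound := fun _ => C) (fun x => ?_)
      (fun x => .of_forall fun y => hC y x) (integrable_const _) (.of_forall fun y => ?_)
    · exact (hcont.comp (continuous_id.prodMk continuous_const)).aestronglyMeasurable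
    · exact hcont.comp (continuous_const.prodMk continuous_id)
  have hJ1 : ∀ x, ∫ y, M.mG (t + 1) y x ∂M.filtering t ≠ 0 → J x = 1 := fun x hx => by
    simp only [J, Gtilde_eq]
    rw [integral_div, div_self hx]
  have hJ0 : ∀ x, ∫ y, M.mG (t + 1) y x ∂M.filtering t = 0 → J x = 0 := fun x hx => by
    simp [J, Gtilde_eq, hx]
  intro h0
  obtain ⟨x₁, h1, h2⟩ := hae.exists
  have hx₁ : J x₁ = 1 := hJ1 x₁ (by
    rw [integral_mG_eq_toReal]; exact ENNReal.toReal_ne_zero.2 ⟨h1, h2⟩)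
  obtain ⟨z, hz⟩ := mem_range_of_exists_le_of_exists_ge hJ (c := (1 / 2 : ℝ))
    ⟨x, by rw [hJ0 x h0]; norm_num⟩ ⟨x₁, by rw [hx₁]; norm_num⟩
  by_cases hI : ∫ y, M.mG (t + 1) y z ∂M.filtering t = 0
  · rw [hJ0 z hI] at hz; norm_num at hz
  · rw [hJ1 z hI] at hz; norm_num at hz

/-- The backward kernel is a probability measure where the denominator of `G̃` does not vanish:
there the integrand of the denominator is integrable. -/
theorem lintegral_Gtilde {t : ℕ} {x : State d}
    (hx : ∫ y, M.mG (t + 1) y x ∂M.filtering t ≠ 0) :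
    ∫⁻ y, ENNReal.ofReal (M.Gtilde (t + 1) (M.filtering t) y x) ∂M.filtering t = 1 := by
  have hint : Integrable (fun y => M.mG (t + 1) y x) (M.filtering t) := by
    by_contra h
    exact hx (integral_undef h)
  rw [← ofReal_integral_eq_lintegral_ofReal]
  · simp only [Gtilde_eq]
    rw [integral_div, div_self hx, ENNReal.ofReal_one]
  · simp only [Gtilde_eq]
    exact hint.div_const _
  · exact .of_forall fun y => M.Gtilde_nonneg (by omega) _ y x

/-- Disintegration of the smoothing distribution along its last coordinate, by means of the
backward kernel. -/
theorem lintegral_smoothing_succ_eq_backward {t : ℕ} [IsProbabilityMeasure (M.smoothing t)]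
    {c : ENNReal}
    (hrec : ∀ f : (Fin (t + 2) → State d) → ENNReal, Measurable f →
      ∫⁻ x, f x ∂M.smoothing (t + 1) =
        c * ∫⁻ y, (∫⁻ a, f (snocState y a) * ENNReal.ofReal (M.mG (t + 1) (y (Fin.last t)) a))
          ∂M.smoothing t)
    (hd : M.filtering (t + 1) = volume.withDensity fun x => c * M.predictive t x)
    (hae : ∀ᵐ x : State d, M.predictive t x ≠ 0 ∧ M.predictive t x ≠ ⊤)
    (hmeas : Measurable (Function.uncurry (M.Gtilde (t + 1) (M.filtering t))))
    {f : (Fin (t + 2) → State d) → ENNReal} (hf : Measurable f) :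
    ∫⁻ x, f x ∂M.smoothing (t + 1) =
      ∫⁻ a, (∫⁻ y, f (snocState y a) *
        ENNReal.ofReal (M.Gtilde (t + 1) (M.filtering t) (y (Fin.last t)) a) ∂M.smoothing t)
        ∂M.filtering (t + 1) := by
  have hq : Measurable fun q : (Fin (t + 1) → State d) × State d => (q.1 (Fin.last t), q.2) :=
    ((measurable_pi_apply _).comp measurable_fst).prodMk measurable_snd
  have hm : Measurable fun q : (Fin (t + 1) → State d) × State d =>
      f (snocState q.1 q.2) * ENNReal.ofReal (M.mG (t + 1) (q.1 (Fin.last t)) q.2) :=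
    (hf.comp measurable_snocState).mul ((M.measurable_mG (by omega)).comp hq).ennreal_ofReal
  have hm' : Measurable fun q : (Fin (t + 1) → State d) × State d =>
      f (snocState q.1 q.2) *
        ENNReal.ofReal (M.Gtilde (t + 1) (M.filtering t) (q.1 (Fin.last t)) q.2) :=
    (hf.comp measurable_snocState).mul (hmeas.comp hq).ennreal_ofReal
  have hpm := (M.measurable_predictive t).const_mul c
  rw [hrec f hf, lintegral_lintegral_swap hm.aemeasurable,
    ← lintegral_const_mul _ (Measurable.lintegral_prod_left' hm), hd,
    lintegral_withDensity_eq_lintegral_mul _ hpm (Measurable.lintegral_prod_left' hm')]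
  refine lintegral_congr_ae ?_
  filter_upwards [hae] with a ⟨h0, h1⟩
  have hma : Measurable fun y : Fin (t + 1) → State d => f (snocState y a) *
      ENNReal.ofReal (M.Gtilde (t + 1) (M.filtering t) (y (Fin.last t)) a) :=
    hm'.comp measurable_prodMk_right
  rw [Pi.mul_apply, mul_assoc, ← lintegral_const_mul _ hma]
  congr 1
  refine lintegral_congr fun y => ?_
  have hpos : 0 < (M.predictive t a).toReal := ENNReal.toReal_pos h0 h1
  have hG : ENNReal.ofReal (M.mG (t + 1) (y (Fin.last t)) a) = M.predictive t a *
      ENNReal.ofReal (M.Gtilde (t + 1) (M.filtering t) (y (Fin.last t)) a) := by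
    rw [Gtilde_eq, integral_mG_eq_toReal, ENNReal.ofReal_div_of_pos hpos,
      ENNReal.ofReal_toReal h1, ENNReal.mul_div_cancel h0 h1]
  rw [hG]
  ring

/-- A coordinate of the smoothing distribution does not charge the null sets that the filtering
distributions do not charge. -/
theorem smoothing_preimage_eq_zero {T : ℕ}
    (hprob : ∀ t ≤ T, IsProbabilityMeasure (M.smoothing t)) {E : Set (State d)}
    (hE : MeasurableSet E) (h0 : ∀ t ≤ T, M.filtering t E = 0) {t : ℕ} (ht : t ≤ T)
    (i : Fin (t + 1)) : M.smoothing t {y | y i ∈ E} = 0 := by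
  induction t with
  | zero =>
    have := h0 0 ht
    rw [filtering, Measure.map_apply (measurable_pi_apply (Fin.last _)) hE] at this
    rwa [show i = Fin.last 0 from Fin.ext (by omega)]
  | succ t ih =>
    refine Fin.lastCases ?_ (fun i => ?_) i
    · have := h0 (t + 1) ht
      rwa [filtering, Measure.map_apply (measurable_pi_apply (Fin.last _)) hE] at this
    · have := hprob t (by omega)
      have := hprob (t + 1) ht
      obtain ⟨c, -, h⟩ := M.exists_lintegral_smoothing_succ t
      have hm : MeasurableSet {y : Fin (t + 2) → State d | y i.castSucc ∈ E} :=
        measurable_pi_apply _ hE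
      rw [← lintegral_indicator_one hm, h _ (measurable_one.indicator hm)]
      refine mul_eq_zero.2 (.inr ?_)
      refine (lintegral_congr_ae ?_).trans lintegral_zero
      filter_upwards [measure_eq_zero_iff_ae_notMem.1 (ih (by omega) i)] with y hy
      have : ∀ a, snocState y a ∉ {y : Fin (t + 2) → State d | y i.castSucc ∈ E} := fun a => by
        change ¬ snocState y a i.castSucc ∈ E
        rw [snocState_castSucc]; exact hy
      simp [this]

end FeynmanKac

end

/-! ### Resampling -/

noncomputable section

section Ancestor

variable {N : ℕ} {W : Fin N → ℝ} {key : Fin N → UI}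

/-- The weighted empirical CDF of the values `key n`. -/
def weightedCDF (W : Fin N → ℝ) (key : Fin N → UI) (b : UI) : ℝ :=
  ∑ n, W n * (Set.Iic b).indicator 1 (key n)

theorem weightedCDF_eq_sum_filter (σ : Equiv.Perm (Fin N)) (b : UI) :
    weightedCDF W key b = ∑ i ∈ Finset.univ.filter (fun i => key (σ i) ≤ b), W (σ i) := by
  rw [weightedCDF, ← Equiv.sum_comp σ, Finset.sum_filter]
  refine Finset.sum_congr rfl fun i _ => ?_
  by_cases h : key (σ i) ≤ b <;> simp [h]

/-- The keys of the resampled particles are quantiles of the weighted empirical CDF of the keys, up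
to ties between levels and values of the CDF. -/
theorem ancestor_bounds (hW : ∀ n, 0 ≤ W n) (hsum : ∑ n, W n = 1) (u : UI) (n : Fin N) (b : UI) :
    (weightedCDF W key b < u → b ≤ key (ancestor W (Tuple.sort key) u n)) ∧
    ((u : ℝ) < weightedCDF W key b → key (ancestor W (Tuple.sort key) u n) ≤ b) := by
  classical
  have hmono := Tuple.monotone_sort key
  set σ := Tuple.sort key
  have hN : 0 < N := n.pos
  have hk : ∃ k : Fin N, (u : ℝ) ≤ ∑ i ∈ Finset.univ.filter (· ≤ k), W (σ i) := by
    refine ⟨⟨N - 1, by omega⟩, ?_⟩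
    rw [Finset.filter_true_of_mem fun i _ => Fin.mk_le_mk.2 (by omega), Equiv.sum_comp σ, hsum]
    exact u.2.2.le
  have ha : ancestor W σ u n = σ (Fin.find
      (fun k : Fin N => (u : ℝ) ≤ ∑ i ∈ Finset.univ.filter (· ≤ k), W (σ i)) hk) := by
    rw [ancestor, dif_pos hk]
  have hspec := Fin.find_spec hk
  have hmin := fun j => Fin.find_min hk (j := j)
  rw [ha]
  set k := Fin.find (fun k : Fin N => (u : ℝ) ≤ ∑ i ∈ Finset.univ.filter (· ≤ k), W (σ i)) hk
  refine ⟨fun h => ?_, fun h => ?_⟩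
  · by_contra! hlt
    refine absurd hspec (not_le.2 (lt_of_le_of_lt ?_ h))
    rw [weightedCDF_eq_sum_filter σ]
    refine Finset.sum_le_sum_of_subset_of_nonneg (fun i hi => ?_) fun i _ _ => hW _
    simp only [Finset.mem_filter, Finset.mem_univ, true_and] at hi ⊢
    exact (hmono hi).trans hlt.le
  · by_contra! hlt
    have hsub : ∀ i, key (σ i) ≤ b → i < k := fun i hi => by
      by_contra! hki
      exact ((hmono hki).trans hi).not_gt hlt
    rw [weightedCDF_eq_sum_filter σ] at h
    by_cases hk0 : k.1 = 0
    · rw [Finset.filter_false_of_mem fun i _ hi => by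
        have : i.1 < k.1 := hsub i hi
        omega] at h
      -- No key is at most `b`, so that the CDF at `b` is zero.
      exact absurd h (not_lt.2 (by simpa using u.2.1))
    · let k' : Fin N := ⟨k.1 - 1, by omega⟩
      refine hmin k' (Fin.lt_def.2 (by simp only [k']; omega)) (h.le.trans ?_)
      refine Finset.sum_le_sum_of_subset_of_nonneg (fun i hi => ?_) fun i _ _ => hW _
      simp only [Finset.mem_filter, Finset.mem_univ, true_and] at hi ⊢
      have : i.1 < k.1 := hsub i hi
      exact Fin.le_def.2 (by simp only [k']; omega)

end Ancestor

/-! ### Convergence of weighted empirical CDFs along the Hilbert curve -/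

/-- If weighted points converge weakly to a law that has a density, then the weighted CDFs of their
images by the pseudo-inverse of the Hilbert curve converge, also when the weights are multiplied by
functions that converge continuously. The pseudo-inverse may be replaced by a measurable
modification in the limit. -/
theorem WeakConv.tendsto_sum_indicator_pseudoInverse {d : ℕ} (hd : 0 < d) {H : HilbertOrder d}
    {h h' : State d → UI} (hh : ∀ x j, H.curve (h x) j = (x j : ℝ)) (hm : Measurable h')
    (hae : h' =ᵐ[volume] h)
    {J : Type*} {l : Filter J} [l.IsCountablyGenerated] {ι : J → Type} [∀ j, Fintype (ι j)]
    {w : ∀ j, ι j → ℝ} {p : ∀ j, ι j → State d} {Q : Measure (State d)} [IsProbabilityMeasure Q]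
    (hQ : Q ≪ volume) (hw : WeakConv l w p Q) {φ : J → State d → ℝ} {φ₀ : State d → ℝ} {C : ℝ}
    (hφC : ∀ j x, |φ j x| ≤ C) (hφ₀C : ∀ x, |φ₀ x| ≤ C) (hφ₀ : Measurable φ₀)
    (hφ : ∀ x, Tendsto (fun q : J × State d => φ q.1 q.2) (l ×ˢ 𝓝 x) (𝓝 (φ₀ x))) (b : UI) :
    Tendsto (fun j => ∑ n, w j n * ((Set.Iic b).indicator 1 (h (p j n)) * φ j (p j n))) l
      (𝓝 (∫ x, (Set.Iic b).indicator 1 (h' x) * φ₀ x ∂Q)) := by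
  have hbd : ∀ (y : UI) (r : ℝ), |r| ≤ C → |(Set.Iic b).indicator (1 : UI → ℝ) y * r| ≤ C :=
    fun y r hr => by
      rw [abs_mul]
      exact (mul_le_of_le_one_left (abs_nonneg r) (abs_indicator_one_le _ _)).trans hr
  refine hw.tendsto_sum (C := C) (fun j n => hbd _ _ (hφC _ _))
    (.of_forall fun x => hbd _ _ (hφ₀C _))
    (((measurable_one.indicator measurableSet_Iic).comp hm).mul hφ₀).aestronglyMeasurable ?_
  -- The level set `{h = b}` is contained in `{H b}`, hence in a hyperplane since `d > 0`.
  have hne : ∀ᵐ x : State d, h x ≠ b := by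
    let j₀ : Fin d := ⟨0, hd⟩
    filter_upwards [measure_eq_zero_iff_ae_notMem.1 (volume_hyperplane j₀ (H.curve b j₀))]
      with x hx hxb
    exact hx (by rw [← hxb]; exact (hh x j₀).symm)
  filter_upwards [hQ.ae_le hae, hQ.ae_le hne, hQ.ae_le ae_mem_nonDyadic] with x hx hxb hxd
  rw [hx]
  have h1 : Tendsto (fun i : Σ j, ι j => h (p i.1 i.2)) (ptFilter l p x) (𝓝 (h x)) :=
    (HilbertOrder.continuousAt_pseudoInverse hh hd hxd).tendsto.comp (tendsto_point_ptFilter p x)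
  refine Tendsto.mul (tendsto_const_nhds.congr' ?_)
    ((hφ x).comp ((tendsto_fst_ptFilter p x).prodMk (tendsto_point_ptFilter p x)))
  rcases lt_or_gt_of_ne hxb with hlt | hlt
  · filter_upwards [h1.eventually_lt_const hlt] with i hi
    rw [Set.indicator_of_mem (show h x ∈ Set.Iic b from hlt.le),
      Set.indicator_of_mem (show h (p i.1 i.2) ∈ Set.Iic b from hi.le)]
    rfl
  · filter_upwards [h1.eventually_const_lt hlt] with i hi
    rw [Set.indicator_of_notMem (show h x ∉ Set.Iic b from not_le.2 hlt),
      Set.indicator_of_notMem (show h (p i.1 i.2) ∉ Set.Iic b from not_le.2 hi)]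

theorem cdfUI_map_withDensity {d : ℕ} {h' : State d → UI} (hm : Measurable h')
    {Q : Measure (State d)} {φ : State d → ℝ} (hφ : Measurable φ) (h0 : ∀ x, 0 ≤ φ x) (b : UI) :
    cdfUI ((Q.withDensity fun x => ENNReal.ofReal (φ x)).map h') b =
      ∫ x, (Set.Iic b).indicator 1 (h' x) * φ x ∂Q := by
  rw [cdfUI, map_measureReal_apply hm measurableSet_Iic, Measure.real,
    withDensity_apply _ (hm measurableSet_Iic), integral_eq_lintegral_of_nonneg_ae,
    ← lintegral_indicator (hm measurableSet_Iic)]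
  · congr 1
    refine lintegral_congr fun x => ?_
    by_cases h : h' x ≤ b <;> simp [h]
  · refine .of_forall fun x => mul_nonneg ?_ (h0 x)
    exact Set.indicator_nonneg (fun _ _ => zero_le_one) _
  · exact (((measurable_one.indicator measurableSet_Iic).comp hm).mul hφ).aestronglyMeasurable

theorem cdfUI_map {d : ℕ} {h' : State d → UI} (hm : Measurable h') {Q : Measure (State d)}
    (b : UI) : cdfUI (Q.map h') b = ∫ x, (Set.Iic b).indicator 1 (h' x) * 1 ∂Q := by
  have := cdfUI_map_withDensity hm (Q := Q) (φ := fun _ => 1) measurable_const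
    (fun _ => zero_le_one) b
  simpa using this

theorem WeakConv.tendsto_weightedCDF {d : ℕ} (hd : 0 < d) {H : HilbertOrder d} {h h' : State d → UI}
    (hh : ∀ x j, H.curve (h x) j = (x j : ℝ)) (hm : Measurable h') (hae : h' =ᵐ[volume] h)
    {w : ∀ N : ℕ, Fin N → ℝ} {p : ∀ N : ℕ, Fin N → State d} {Q : Measure (State d)}
    [IsProbabilityMeasure Q] (hQ : Q ≪ volume) (hw : WeakConv atTop w p Q) (b : UI) :
    Tendsto (fun N => weightedCDF (w N) (fun n => h (p N n)) b) atTop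
      (𝓝 (cdfUI (Q.map h') b)) := by
  rw [cdfUI_map hm]
  have := hw.tendsto_sum_indicator_pseudoInverse hd hh hm hae hQ (φ := fun _ _ => 1)
    (φ₀ := fun _ => 1) (C := 1) (by simp) (by simp) measurable_const (fun x => tendsto_const_nhds) b
  simpa [weightedCDF] using this

/-! ### Reweighting -/

/-- Importance sampling: if equally weighted points converge weakly to `η`, then reweighting them by
`G` and projecting them gives weak convergence to the corresponding change of measure. -/
theorem WeakConv.reweight {E : Type*} [PseudoMetricSpace E] [MeasurableSpace E] [BorelSpace E]
    {d : ℕ} {e : ∀ N : ℕ, Fin N → E} {η : Measure E} [IsProbabilityMeasure η]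
    (h : WeakConv atTop (fun N (_ : Fin N) => (N : ℝ)⁻¹) e η) {G : E → ℝ} (hG : Continuous G)
    (h0 : ∀ q, 0 ≤ G q) {C : ℝ} (hC : ∀ q, G q ≤ C) {π : E → State d} (hπ : Continuous π)
    {Q : Measure (State d)} [IsProbabilityMeasure Q] {c : ENNReal}
    (hQ : ∀ f : State d → ENNReal, Measurable f →
      ∫⁻ x, f x ∂Q = c * ∫⁻ q, f (π q) * ENNReal.ofReal (G q) ∂η) :
    WeakConv atTop (fun N n => G (e N n) / ∑ k, G (e N k)) (fun N n => π (e N n)) Q ∧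
      ∀ᶠ N in atTop, ∑ n, G (e N n) / ∑ k, G (e N k) = 1 := by
  have hQm : Q = c • (η.withDensity fun q => ENNReal.ofReal (G q)).map π := by
    refine Measure.ext_of_lintegral _ fun f hf => ?_
    rw [hQ f hf, lintegral_smul_measure, lintegral_map hf hπ.measurable,
      lintegral_withDensity_eq_lintegral_mul _ hG.measurable.ennreal_ofReal
        (g := fun q => f (π q)) (hf.comp hπ.measurable), smul_eq_mul]
    congr 1
    exact lintegral_congr fun q => mul_comm _ _
  have hint : ∀ f : State d → ℝ, Measurable f →
      ∫ x, f x ∂Q = c.toReal * ∫ q, G q * f (π q) ∂η := fun f hf => by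
    rw [hQm, integral_smul_measure, integral_map hπ.measurable.aemeasurable
      hf.aestronglyMeasurable, integral_withDensity_eq_integral_toReal_smul
      hG.measurable.ennreal_ofReal (.of_forall fun _ => ENNReal.ofReal_lt_top), smul_eq_mul]
    simp only [smul_eq_mul, ENNReal.toReal_ofReal (h0 _)]
  have h1 : 1 = c.toReal * ∫ q, G q ∂η := by
    simpa using hint (fun _ => 1) measurable_const
  have hG0 : ∫ q, G q ∂η ≠ 0 := fun h => by simp [h] at h1
  have hlim : ∀ f : State d → ℝ, Continuous f → (∃ B, ∀ x, |f x| ≤ B) →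
      Tendsto (fun N : ℕ => ∑ n, (N : ℝ)⁻¹ * (G (e N n) * f (π (e N n)))) atTop
        (𝓝 (∫ q, G q * f (π q) ∂η)) := fun f hf ⟨B, hB⟩ => by
    have hb : ∀ q, |G q * f (π q)| ≤ C * B := fun q => by
      rw [abs_mul, abs_of_nonneg (h0 q)]
      exact mul_le_mul (hC q) (hB _) (abs_nonneg _) ((h0 q).trans (hC q))
    have hcont : Continuous fun q => G q * f (π q) := hG.mul (hf.comp hπ)
    exact h.tendsto_sum (fun N n => hb _) (.of_forall hb) hcont.measurable.aestronglyMeasurable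
      (.of_forall fun q => (hcont.tendsto q).comp (tendsto_point_ptFilter _ _))
  have hden : Tendsto (fun N : ℕ => ∑ n, (N : ℝ)⁻¹ * G (e N n)) atTop (𝓝 (∫ q, G q ∂η)) := by
    simpa using hlim (fun _ => 1) continuous_const ⟨1, by simp⟩
  refine ⟨⟨fun N n => div_nonneg (h0 _) (Finset.sum_nonneg fun _ _ => h0 _), ?_⟩, ?_⟩
  · rintro f ⟨K, hK⟩ hB
    have ht := (hlim f hK.continuous hB).div hden hG0
    have hval : (∫ q, G q * f (π q) ∂η) / ∫ q, G q ∂η = ∫ x, f x ∂Q := by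
      rw [hint f hK.continuous.measurable, div_eq_iff hG0, mul_right_comm, ← h1, one_mul]
    rw [hval] at ht
    refine ht.congr' ?_
    filter_upwards [eventually_gt_atTop 0] with N hN
    -- The common factor `1 / N` cancels in the normalised weights.
    have hN' : (N : ℝ)⁻¹ ≠ 0 := inv_ne_zero (by exact_mod_cast hN.ne')
    rw [Pi.div_apply, ← Finset.mul_sum, ← Finset.mul_sum, mul_div_mul_left _ _ hN',
      Finset.sum_div]
    exact Finset.sum_congr rfl fun n _ => by ring
  · filter_upwards [hden.eventually_ne hG0] with N hN
    rw [← Finset.sum_div]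
    refine div_self fun h => hN ?_
    rw [← Finset.mul_sum, h, mul_zero]

end

/-! ### Convergence of the forward pass -/

noncomputable section

namespace FeynmanKac

variable {d : ℕ} (M : FeynmanKac d)

theorem isProbabilityMeasure_transition {t : ℕ} (ht : 1 ≤ t) (x' : State d) :
    IsProbabilityMeasure (M.transition t x') := ⟨by
  rw [transition, withDensity_apply _ MeasurableSet.univ, Measure.restrict_univ]
  exact M.m_int t ht x'⟩

theorem lintegral_transition {t : ℕ} (ht : 1 ≤ t) (x' : State d) {f : State d → ENNReal}
    (hf : Measurable f) :
    ∫⁻ x, f x ∂M.transition t x' = ∫⁻ x, ENNReal.ofReal (M.m t x' x) * f x :=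
  lintegral_withDensity_eq_lintegral_mul _
    ((M.m_meas t ht).comp measurable_prodMk_left).ennreal_ofReal hf

/-- The joint law `π(dx') m_t(x', dx)`. -/
def pairLaw (t : ℕ) (π : Measure (State d)) : Measure (State d × State d) :=
  (π.prod volume).withDensity fun q => ENNReal.ofReal (M.m t q.1 q.2)

theorem lintegral_pairLaw {t : ℕ} (ht : 1 ≤ t) (π : Measure (State d)) [SFinite π]
    {f : State d × State d → ENNReal} (hf : Measurable f) :
    ∫⁻ q, f q ∂M.pairLaw t π = ∫⁻ x', (∫⁻ x, f (x', x) ∂M.transition t x') ∂π := by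
  have hm : Measurable fun q : State d × State d => ENNReal.ofReal (M.m t q.1 q.2) :=
    (M.m_meas t ht).ennreal_ofReal
  rw [pairLaw, lintegral_withDensity_eq_lintegral_mul _ hm hf,
    lintegral_prod _ (hm.mul hf).aemeasurable]
  refine lintegral_congr fun x' => ?_
  exact (M.lintegral_transition ht x' (hf.comp measurable_prodMk_left)).symm

theorem isProbabilityMeasure_pairLaw {t : ℕ} (ht : 1 ≤ t) (π : Measure (State d))
    [IsProbabilityMeasure π] : IsProbabilityMeasure (M.pairLaw t π) := ⟨by
  rw [← setLIntegral_one, Measure.restrict_univ, M.lintegral_pairLaw ht π measurable_const]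
  have h : ∀ x', ∫⁻ _, 1 ∂M.transition t x' = 1 := fun x' => by
    have := M.isProbabilityMeasure_transition ht x'
    simp
  simp [h]⟩

end FeynmanKac

/-- Splitting a uniform point of `[0,1)^(d+1)` into its first coordinate and the others. -/
theorem lintegral_volume_cons {d : ℕ} {f : UI × State d → ENNReal} (hf : Measurable f) :
    ∫⁻ u : Fin (d + 1) → UI, f (u 0, Fin.tail u) = ∫⁻ a : UI, ∫⁻ r : State d, f (a, r) := by
  have he := volume_preserving_piFinSuccAbove (fun _ : Fin (d + 1) => UI) 0
  rw [← lintegral_prod _ hf.aemeasurable]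
  exact he.lintegral_comp hf

theorem measurable_tail_UI {d : ℕ} : Measurable (Fin.tail : (Fin (d + 1) → UI) → State d) :=
  measurable_pi_lambda _ fun _ => measurable_pi_apply _

section Forward

variable {d : ℕ} {M : FeynmanKac d} {H : HilbertOrder d} {h h' : State d → UI}

/-- The law of the pair obtained from a uniform point by the limit of the resampling and mutation
steps. -/
theorem map_resample_mutate (hh : ∀ x j, H.curve (h x) j = (x j : ℝ)) (hm : Measurable h')
    (hae : h' =ᵐ[volume] h) {t : ℕ} (ht : 1 ≤ t) {κ : State d → CondLaws d}
    (hreg : RosenblattRegular (M.transition t) κ) (hbd : BoundedCondDensities κ)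
    {Q : Measure (State d)} [IsProbabilityMeasure Q] [IsProbabilityMeasure (Q.map h')]
    (hQ : Q ≪ volume) :
    (volume : Measure (Fin (d + 1) → UI)).map
      (fun u => (H.toState (quantile (Q.map h') (u 0)),
        rosenblattInv (κ (H.toState (quantile (Q.map h') (u 0)))) (Fin.tail u))) =
      M.pairLaw t Q := by
  have hinv := hreg.invertible hbd
  have hcont : Continuous fun p : State d × State d => rosenblattInv (κ p.1) p.2 :=
    RosenblattInvertible.continuous_rosenblattInv hinv hreg.2.2.continuous
  have hq := measurable_quantile_const (Q.map h')
  have h1 : Measurable fun q : UI × State d => (H.toState (quantile (Q.map h') q.1), q.2) :=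
    (H.measurable_toState.comp (hq.comp measurable_fst)).prodMk measurable_snd
  have h2 : Measurable fun p : State d × State d => (p.1, rosenblattInv (κ p.1) p.2) :=
    measurable_fst.prodMk hcont.measurable
  have hsplit : Measurable fun u : Fin (d + 1) → UI => (u 0, Fin.tail u) :=
    (measurable_pi_apply 0).prodMk measurable_tail_UI
  refine Measure.ext_of_lintegral _ fun f hf => ?_
  have hF : Measurable fun p : State d × State d => f (p.1, rosenblattInv (κ p.1) p.2) :=
    hf.comp h2
  refine (lintegral_map hf (h2.comp (h1.comp hsplit))).trans ?_
  rw [M.lintegral_pairLaw ht Q hf]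
  have e1 := lintegral_volume_cons (f := fun q : UI × State d =>
    f (H.toState (quantile (Q.map h') q.1),
      rosenblattInv (κ (H.toState (quantile (Q.map h') q.1))) q.2)) (hf.comp (h2.comp h1))
  refine e1.trans ?_
  have hg : Measurable fun x' : State d => ∫⁻ r, f (x', rosenblattInv (κ x') r) :=
    hF.lintegral_prod_right'
  have e2 := lintegral_map (μ := (volume : Measure UI)) (hg.comp H.measurable_toState) hq
  rw [map_quantile_volume, lintegral_map (hg.comp H.measurable_toState) hm] at e2
  refine e2.symm.trans (lintegral_congr_ae ?_)
  filter_upwards [hQ.ae_le hae] with x hx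
  have hp := M.isProbabilityMeasure_transition ht x
  simp only [Function.comp_apply]
  rw [hx, HilbertOrder.toState_pseudoInverse hh, ← (hinv x).map_rosenblattInv (hreg.1 x)]
  exact (lintegral_map (hf.comp measurable_prodMk_left)
    (hinv x).continuous_rosenblattInv_self.measurable).symm

/-- One resampling step: the resampled particles converge to the quantile transform of the first
coordinate of the point set, carried to the state space by the Hilbert curve. -/
theorem tendsto_resample (hd : 0 < d) (hh : ∀ x j, H.curve (h x) j = (x j : ℝ))
    (hm : Measurable h') (hae : h' =ᵐ[volume] h) {W : ∀ N : ℕ, Fin N → ℝ}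
    {x : ∀ N : ℕ, Fin N → State d} {Q : Measure (State d)} [IsProbabilityMeasure Q]
    [IsProbabilityMeasure (Q.map h')] (hQ : Q ≪ volume) (hW : WeakConv atTop W x Q)
    (hsum : ∀ᶠ N in atTop, ∑ n, W N n = 1) (u : ∀ N : ℕ, Fin N → Fin (d + 1) → UI)
    {u₀ : Fin (d + 1) → UI} (hne : ∀ a ∈ ratUI, (u₀ 0 : ℝ) ≠ cdfUI (Q.map h') a)
    (hdom : quantile (Q.map h') (u₀ 0) ∈ H.domain) :
    Tendsto (fun i : Σ N, Fin N => x i.1 (ancestor (W i.1) (Tuple.sort fun n => h (x i.1 n))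
        (u i.1 i.2 0) i.2)) (ptFilter atTop u u₀)
      (𝓝 (H.toState (quantile (Q.map h') (u₀ 0)))) := by
  have hfst := tendsto_fst_ptFilter (l := atTop) u u₀
  have hev := hfst.eventually hsum
  have hkey : Tendsto (fun i : Σ N, Fin N => h (x i.1 (ancestor (W i.1)
      (Tuple.sort fun n => h (x i.1 n)) (u i.1 i.2 0) i.2))) (ptFilter atTop u u₀)
      (𝓝 (quantile (Q.map h') (u₀ 0))) := by
    have hF : ∀ a ∈ ratUI, Tendsto (fun i : Σ N, Fin N =>
        weightedCDF (W i.1) (fun n => h (x i.1 n)) a) (ptFilter atTop u u₀)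
        (𝓝 (cdfUI (Q.map h') a)) := fun a _ =>
      (hW.tendsto_weightedCDF hd hh hm hae hQ a).comp hfst
    refine tendsto_quantile_of_ne (u := fun i => (u i.1 i.2 0 : ℝ)) hF ?_ ?_ ?_ hne
    · exact (Continuous.tendsto (f := fun v : Fin (d + 1) → UI => (v 0 : ℝ)) (by fun_prop) u₀).comp
        (tendsto_point_ptFilter u u₀)
    · filter_upwards [hev] with i hi b
      exact (ancestor_bounds (hW.nonneg i.1) hi _ _ b).1
    · filter_upwards [hev] with i hi b
      exact (ancestor_bounds (hW.nonneg i.1) hi _ _ b).2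
  have := (H.continuousAt_toState hdom).tendsto.comp hkey
  simpa only [Function.comp_def, HilbertOrder.toState_pseudoInverse hh] using this

theorem map_pseudoInverse_domain (hh : ∀ x j, H.curve (h x) j = (x j : ℝ)) (hm : Measurable h')
    (hae : h' =ᵐ[volume] h) {Q : Measure (State d)} (hQ : Q ≪ volume) :
    ∀ᵐ s ∂Q.map h', s ∈ H.domain := by
  refine (ae_map_iff hm.aemeasurable H.isOpen_domain.measurableSet).2 ?_
  filter_upwards [hQ.ae_le hae] with x hx
  rw [hx]
  exact HilbertOrder.mem_domain_of_pseudoInverse hh x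

/-- The particles of the forward pass converge weakly to the filtering distributions. The induction
also carries the statement that the weights are eventually normalised, without which resampling is
not a quantile transform. -/
theorem weakConv_sqmc {T : ℕ} (hd : 0 < d) (hh : ∀ x j, H.curve (h x) j = (x j : ℝ))
    (hm : Measurable h') (hae : h' =ᵐ[volume] h)
    {κ₀ : CondLaws d} {κ : ℕ → State d → CondLaws d}
    {u₀ : ∀ N : ℕ, Fin N → Fin d → UI} {u : ∀ N : ℕ, ℕ → Fin N → Fin (d + 1) → UI}
    (hu₀ : Tendsto (fun N => discrepancy (u₀ N)) atTop (𝓝 0))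
    (hu : ∀ t, 1 ≤ t → t ≤ T → Tendsto (fun N => discrepancy (u N t)) atTop (𝓝 0))
    (hG₀ : Continuous M.G₀ ∧ ∃ C, ∀ z, M.G₀ z ≤ C)
    (hG : ∀ t, 1 ≤ t → t ≤ T →
      Continuous (Function.uncurry (M.G t)) ∧ ∃ C, ∀ z' z, M.G t z' z ≤ C)
    (hm₀ : RosenblattRegular (fun _ => M.init) (fun _ => κ₀) ∧ BoundedCondDensities fun _ => κ₀)
    (hmt : ∀ t, 1 ≤ t → t ≤ T →
      RosenblattRegular (M.transition t) (κ t) ∧ BoundedCondDensities (κ t))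
    (hprob : ∀ t ≤ T, IsProbabilityMeasure (M.smoothing t))
    (hac : ∀ t ≤ T, M.filtering t ≪ volume) {t : ℕ} (ht : t ≤ T) :
    WeakConv atTop (fun N => (sqmc M κ₀ κ h (u₀ N) (u N) t).2)
      (fun N => (sqmc M κ₀ κ h (u₀ N) (u N) t).1) (M.filtering t) ∧
    ∀ᶠ N in atTop, ∑ n, (sqmc M κ₀ κ h (u₀ N) (u N) t).2 n = 1 := by
  induction t with
  | zero =>
    have := hprob 0 ht
    have := M.init_prob
    obtain ⟨C, hC⟩ := hG₀.2
    obtain ⟨c, hc⟩ := M.exists_lintegral_filtering_zero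
    have hinv := hm₀.1.invertible hm₀.2 default
    have hcont := hinv.continuous_rosenblattInv_self
    have h1 := (weakConv_of_discrepancy hu₀).map (y := fun N n => rosenblattInv κ₀ (u₀ N n))
      hcont.measurable (.of_forall fun v => (hcont.tendsto v).comp (tendsto_point_ptFilter _ _))
    rw [hinv.map_rosenblattInv (hm₀.1.1 default)] at h1
    exact h1.reweight hG₀.1 M.G₀_nonneg hC continuous_id hc
  | succ t ih =>
    obtain ⟨ihW, ihs⟩ := ih (by omega)
    have := hprob t (by omega)
    have := hprob (t + 1) ht
    have hmap : IsProbabilityMeasure ((M.filtering t).map h') :=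
      Measure.isProbabilityMeasure_map hm.aemeasurable
    obtain ⟨hreg, hbd⟩ := hmt (t + 1) (by omega) ht
    obtain ⟨hGc, C, hC⟩ := hG (t + 1) (by omega) ht
    obtain ⟨c, -, hc, -⟩ := M.exists_lintegral_filtering_succ t
    have hinv := hreg.invertible hbd
    have hcont : Continuous fun p : State d × State d => rosenblattInv (κ (t + 1) p.1) p.2 :=
      RosenblattInvertible.continuous_rosenblattInv hinv hreg.2.2.continuous
    have hpair := M.isProbabilityMeasure_pairLaw (t := t + 1) (by omega) (M.filtering t)
    let x : ∀ N : ℕ, Fin N → State d := fun N => (sqmc M κ₀ κ h (u₀ N) (u N) t).1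
    let W : ∀ N : ℕ, Fin N → ℝ := fun N => (sqmc M κ₀ κ h (u₀ N) (u N) t).2
    let xh : ∀ N : ℕ, Fin N → State d := fun N n =>
      x N (ancestor (W N) (Tuple.sort fun n => h (x N n)) (u N (t + 1) n 0) n)
    let e : ∀ N : ℕ, Fin N → State d × State d := fun N n =>
      (xh N n, rosenblattInv (κ (t + 1) (xh N n)) (Fin.tail (u N (t + 1) n)))
    have hq := measurable_quantile_const ((M.filtering t).map h')
    have hΨ : Measurable fun v : Fin (d + 1) → UI =>
        (H.toState (quantile ((M.filtering t).map h') (v 0)),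
          rosenblattInv (κ (t + 1) (H.toState (quantile ((M.filtering t).map h') (v 0))))
            (Fin.tail v)) := by
      have h1 : Measurable fun v : Fin (d + 1) → UI =>
          (H.toState (quantile ((M.filtering t).map h') (v 0)), (Fin.tail v : State d)) :=
        (H.measurable_toState.comp (hq.comp (measurable_pi_apply 0))).prodMk measurable_tail_UI
      exact (measurable_fst.prodMk hcont.measurable).comp h1
    have hev : MeasurePreserving (Function.eval 0) (volume : Measure (Fin (d + 1) → UI)) volume :=
      measurePreserving_eval (fun _ : Fin (d + 1) => (volume : Measure UI)) 0
    have hae1 : ∀ᵐ v : Fin (d + 1) → UI, ∀ a ∈ ratUI,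
        (v 0 : ℝ) ≠ cdfUI ((M.filtering t).map h') a :=
      hev.quasiMeasurePreserving.ae (ae_ne_cdfUI _)
    have hae2 : ∀ᵐ v : Fin (d + 1) → UI,
        quantile ((M.filtering t).map h') (v 0) ∈ H.domain := by
      have h1 := map_pseudoInverse_domain hh hm hae (hac t (by omega))
      rw [← map_quantile_volume ((M.filtering t).map h')] at h1
      exact hev.quasiMeasurePreserving.ae (ae_of_ae_map hq.aemeasurable h1)
    have h1 : WeakConv atTop (fun N (_ : Fin N) => (N : ℝ)⁻¹) e
        (M.pairLaw (t + 1) (M.filtering t)) := by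
      have h2 := (weakConv_of_discrepancy (hu (t + 1) (by omega) ht)).map (y := e) hΨ (by
        filter_upwards [hae1, hae2] with v hv1 hv2
        have h3 := tendsto_resample hd hh hm hae (hac t (by omega)) ihW ihs
          (fun N => u N (t + 1)) hv1 hv2
        have htail : Tendsto (fun i : Σ N, Fin N => (Fin.tail (u i.1 (t + 1) i.2) : State d))
            (ptFilter atTop (fun N => u N (t + 1)) v) (𝓝 (Fin.tail v)) :=
          tendsto_pi_nhds.2 fun j =>
            ((continuous_apply j.succ).tendsto v).comp (tendsto_point_ptFilter _ _)
        exact h3.prodMk_nhds ((hcont.tendsto _).comp (h3.prodMk_nhds htail)))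
      rwa [map_resample_mutate hh hm hae (by omega) hreg hbd (hac t (by omega))] at h2
    have hQ : ∀ f : State d → ENNReal, Measurable f → ∫⁻ x, f x ∂M.filtering (t + 1) =
        c * ∫⁻ q, f q.2 * ENNReal.ofReal (Function.uncurry (M.G (t + 1)) q)
          ∂M.pairLaw (t + 1) (M.filtering t) := fun f hf => by
      have hGm : Measurable fun q : State d × State d =>
          f q.2 * ENNReal.ofReal (Function.uncurry (M.G (t + 1)) q) :=
        (hf.comp measurable_snd).mul hGc.measurable.ennreal_ofReal
      rw [hc f hf, M.lintegral_pairLaw (by omega) _ hGm]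
      congr 1
      refine lintegral_congr fun y => ?_
      refine Eq.trans ?_
        (M.lintegral_transition (by omega) y (hGm.comp measurable_prodMk_left)).symm
      refine lintegral_congr fun a => ?_
      rw [FeynmanKac.mG, ENNReal.ofReal_mul (M.m_pos _ (by omega) _ _).le]
      exact mul_left_comm _ _ _
    exact h1.reweight hGc (fun q => M.G_nonneg _ (by omega) _ _) (fun q => hC q.1 q.2)
      continuous_snd hQ

end Forward

end

/-! ### The inverse Rosenblatt transform of the backward chain -/

noncomputable section

section BackwardInv

variable {T : ℕ}

theorem backwardInv_last (Q : Measure UI) (K : ℕ → Kernel UI UI) (u : Fin (T + 1) → UI) :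
    backwardInv Q K u (Fin.last T) = quantile Q (u (Fin.last T)) :=
  Fin.reverseInduction_last ..

theorem backwardInv_castSucc (Q : Measure UI) (K : ℕ → Kernel UI UI) (u : Fin (T + 1) → UI)
    (i : Fin T) : backwardInv Q K u i.castSucc =
      quantile (K (i + 1) (backwardInv Q K u i.succ)) (u i.castSucc) :=
  Fin.reverseInduction_castSucc ..

/-- After the first step, the backward pass is a backward pass over one time step less. -/
theorem backwardInv_castSucc_eq (Q : Measure UI) (K : ℕ → Kernel UI UI) (u : Fin (T + 2) → UI)
    (i : Fin (T + 1)) : backwardInv Q K u i.castSucc =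
      backwardInv (K (T + 1) (quantile Q (u (Fin.last (T + 1))))) K (fun j => u j.castSucc) i := by
  induction i using Fin.reverseInduction with
  | last => rw [backwardInv_castSucc, Fin.succ_last, backwardInv_last, backwardInv_last,
      Fin.val_last]
  | cast i ih => rw [backwardInv_castSucc, Fin.succ_castSucc, ih, backwardInv_castSucc,
      Fin.val_castSucc]

theorem backwardInv_update (Q : Measure UI) (K : ℕ → Kernel UI UI) (u : Fin (T + 1) → UI)
    (t : Fin (T + 1)) (a : UI) (j : Fin (T + 1)) (hj : t < j) :
    backwardInv Q K (Function.update u t a) j = backwardInv Q K u j := by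
  induction j using Fin.reverseInduction with
  | last => rw [backwardInv_last, backwardInv_last, Function.update_of_ne hj.ne']
  | cast i ih => rw [backwardInv_castSucc, backwardInv_castSucc, Function.update_of_ne hj.ne',
      ih (hj.trans i.castSucc_lt_succ)]

theorem measurable_backwardInv_kernel {S : Type*} [MeasurableSpace S] (κ : Kernel S UI)
    [IsMarkovKernel κ] (K : ℕ → Kernel UI UI) [∀ t, IsMarkovKernel (K t)] :
    Measurable fun q : S × (Fin (T + 1) → UI) => backwardInv (κ q.1) K q.2 := by
  refine measurable_pi_lambda _ fun i => ?_
  induction i using Fin.reverseInduction with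
  | last =>
    simp only [backwardInv_last]
    exact (measurable_quantile κ).comp
      (measurable_fst.prodMk ((measurable_pi_apply (Fin.last T)).comp measurable_snd))
  | cast i ih =>
    simp only [backwardInv_castSucc]
    exact (measurable_quantile (K (i + 1))).comp
      (ih.prodMk ((measurable_pi_apply i.castSucc).comp measurable_snd))

theorem measurable_backwardInv (Q : Measure UI) [IsProbabilityMeasure Q] (K : ℕ → Kernel UI UI)
    [∀ t, IsMarkovKernel (K t)] :
    Measurable fun u : Fin (T + 1) → UI => backwardInv Q K u :=
  (measurable_backwardInv_kernel (Kernel.const Unit Q) K).comp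
    (measurable_prodMk_left (x := ()))

/-- The uniform points at which the limit of the backward passes is taken: every level avoids the
values of the relevant CDF at rational points, and every quantile lies in `dom`. -/
def backwardGood (dom : Set UI) (Q : Measure UI) (K : ℕ → Kernel UI UI) (u : Fin (T + 1) → UI) :
    Prop :=
  (∀ i, backwardInv Q K u i ∈ dom) ∧
  (∀ a ∈ ratUI, (u (Fin.last T) : ℝ) ≠ cdfUI Q a) ∧
  ∀ i : Fin T, ∀ a ∈ ratUI,
    (u i.castSucc : ℝ) ≠ cdfUI (K (i + 1) (backwardInv Q K u i.succ)) a

theorem ae_quantile_mem {dom : Set UI} {μ : Measure UI} [IsProbabilityMeasure μ]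
    (h : ∀ᵐ s ∂μ, s ∈ dom) : ∀ᵐ v : UI, quantile μ v ∈ dom := by
  rw [← map_quantile_volume μ] at h
  exact ae_of_ae_map (measurable_quantile_const μ).aemeasurable h

/-- Each level is independent of the later steps of the backward pass, which determine the CDF that
it has to avoid. -/
theorem ae_backwardGood {dom : Set UI} (hdom : MeasurableSet dom) (Q : Measure UI)
    [IsProbabilityMeasure Q] (K : ℕ → Kernel UI UI) [∀ t, IsMarkovKernel (K t)]
    (hQ : ∀ᵐ s ∂Q, s ∈ dom) (hK : ∀ t s, ∀ᵐ s' ∂K t s, s' ∈ dom) :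
    ∀ᵐ u : Fin (T + 1) → UI, backwardGood dom Q K u := by
  have hev : MeasurePreserving (Function.eval (Fin.last T))
      (volume : Measure (Fin (T + 1) → UI)) volume :=
    measurePreserving_eval (fun _ : Fin (T + 1) => (volume : Measure UI)) (Fin.last T)
  have h1 : ∀ᵐ u : Fin (T + 1) → UI, quantile Q (u (Fin.last T)) ∈ dom :=
    hev.quasiMeasurePreserving.ae (ae_quantile_mem hQ)
  have h2 : ∀ᵐ u : Fin (T + 1) → UI, ∀ a ∈ ratUI, (u (Fin.last T) : ℝ) ≠ cdfUI Q a :=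
    hev.quasiMeasurePreserving.ae (ae_ne_cdfUI Q)
  have h3 : ∀ i : Fin T, ∀ᵐ u : Fin (T + 1) → UI,
      (backwardInv Q K u i.succ, u i.castSucc) ∈ {q : UI × UI |
        quantile (K (i + 1) q.1) q.2 ∈ dom ∧
          ∀ a ∈ ratUI, (q.2 : ℝ) ≠ cdfUI (K (i + 1) q.1) a} := fun i => by
    refine ae_of_forall_ae_eval i.castSucc (ψ := fun u => backwardInv Q K u i.succ)
      ((measurable_pi_apply i.succ).comp (measurable_backwardInv Q K))
      (fun u a => backwardInv_update Q K u _ a _ i.castSucc_lt_succ) ?_ fun s => ?_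
    · have hset : {q : UI × UI | ∀ a ∈ ratUI, (q.2 : ℝ) ≠ cdfUI (K (i + 1) q.1) a} =
          ⋂ a ∈ ratUI, {q : UI × UI | (q.2 : ℝ) = cdfUI (K (i + 1) q.1) a}ᶜ := by
        ext q; simp
      have hmeas : MeasurableSet
          {q : UI × UI | ∀ a ∈ ratUI, (q.2 : ℝ) ≠ cdfUI (K (i + 1) q.1) a} := by
        rw [hset]
        refine .biInter countable_ratUI fun a _ => MeasurableSet.compl ?_
        refine measurableSet_eq_fun (measurable_subtype_coe.comp measurable_snd) ?_
        exact (((K (i + 1)).measurable_coe measurableSet_Iic).comp measurable_fst).ennreal_toReal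
      exact (measurable_quantile (K (i + 1)) hdom).inter hmeas
    · exact (ae_quantile_mem (hK (i + 1) s)).and (ae_ne_cdfUI (K (i + 1) s))
  filter_upwards [h1, h2, ae_all_iff.2 h3] with u hu1 hu2 hu3
  refine ⟨fun i => ?_, hu2, fun i => (hu3 i).2⟩
  refine Fin.lastCases ?_ (fun i => ?_) i
  · rw [backwardInv_last]; exact hu1
  · rw [backwardInv_castSucc]; exact (hu3 i).1

theorem tendsto_quantile {I : Type*} {l : Filter I} {μ : I → Measure UI}
    [∀ i, IsProbabilityMeasure (μ i)] {ν : Measure UI} [IsProbabilityMeasure ν] {v : I → UI}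
    {v₀ : UI} (hμ : ∀ a ∈ ratUI, Tendsto (fun i => cdfUI (μ i) a) l (𝓝 (cdfUI ν a)))
    (hv : Tendsto v l (𝓝 v₀)) (hne : ∀ a ∈ ratUI, (v₀ : ℝ) ≠ cdfUI ν a) :
    Tendsto (fun i => quantile (μ i) (v i)) l (𝓝 (quantile ν v₀)) :=
  tendsto_quantile_of_ne hμ ((continuous_subtype_val.tendsto v₀).comp hv)
    (.of_forall fun _ _ hb => le_quantile hb) (.of_forall fun _ _ hb => quantile_le hb.le) hne

/-- Convergence of the backward passes at good points. The convergence of the kernels is assumed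
along converging conditioning points, since the conditioning points are themselves quantiles. -/
theorem tendsto_backwardInv {I : Type*} {l : Filter I} {dom : Set UI} {Q : I → Measure UI}
    [∀ i, IsProbabilityMeasure (Q i)] {Q₀ : Measure UI} [IsProbabilityMeasure Q₀]
    {K : I → ℕ → Kernel UI UI} [∀ i t, IsMarkovKernel (K i t)] {K₀ : ℕ → Kernel UI UI}
    [∀ t, IsMarkovKernel (K₀ t)]
    (hQ : ∀ a ∈ ratUI, Tendsto (fun i => cdfUI (Q i) a) l (𝓝 (cdfUI Q₀ a)))
    (hK : ∀ t, 1 ≤ t → t ≤ T → ∀ (s : I → UI) (s₀ : UI), s₀ ∈ dom → Tendsto s l (𝓝 s₀) →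
      ∀ a ∈ ratUI, Tendsto (fun i => cdfUI (K i t (s i)) a) l (𝓝 (cdfUI (K₀ t s₀) a)))
    {v : I → Fin (T + 1) → UI} {v₀ : Fin (T + 1) → UI} (hv : Tendsto v l (𝓝 v₀))
    (hgood : backwardGood dom Q₀ K₀ v₀) (j : Fin (T + 1)) :
    Tendsto (fun i => backwardInv (Q i) (K i) (v i) j) l (𝓝 (backwardInv Q₀ K₀ v₀ j)) := by
  have hvj : ∀ j, Tendsto (fun i => v i j) l (𝓝 (v₀ j)) := tendsto_pi_nhds.1 hv
  induction j using Fin.reverseInduction with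
  | last =>
    simp only [backwardInv_last]
    exact tendsto_quantile hQ (hvj _) hgood.2.1
  | cast j ih =>
    simp only [backwardInv_castSucc]
    exact tendsto_quantile (hK (j + 1) (by omega) (by omega) _ _ (hgood.1 j.succ) ih) (hvj _)
      (hgood.2.2 j)

end BackwardInv

/-! ### The law of the limit of the backward passes -/

theorem lintegral_volume_snoc {k : ℕ} {f : UI × (Fin k → UI) → ENNReal} (hf : Measurable f) :
    ∫⁻ u : Fin (k + 1) → UI, f (u (Fin.last k), fun j => u j.castSucc) =
      ∫⁻ a : UI, ∫⁻ r : Fin k → UI, f (a, r) := by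
  have he := volume_preserving_piFinSuccAbove (fun _ : Fin (k + 1) => UI) (Fin.last k)
  rw [← lintegral_prod _ hf.aemeasurable]
  refine Eq.trans (lintegral_congr fun u => ?_) (he.lintegral_comp hf)
  change _ = f (u (Fin.last k), fun j => u ((Fin.last k).succAbove j))
  simp only [Fin.succAbove_last]

/-- The backward chain started from the law `g(x) Q_k(dx)` has law `g(x_k)` times the smoothing
distribution. By induction on `k`, since the backward kernels disintegrate the smoothing
distributions along their last coordinates. -/
theorem lintegral_toState_backwardInv {d T : ℕ} {M : FeynmanKac d} {H : HilbertOrder d}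
    {h h' : State d → UI} (hh : ∀ x j, H.curve (h x) j = (x j : ℝ)) (hm : Measurable h')
    (hae : h' =ᵐ[volume] h) (hac : ∀ t ≤ T, M.filtering t ≪ volume)
    (hprob : ∀ t ≤ T, IsProbabilityMeasure (M.smoothing t))
    (hGm : ∀ t, t + 1 ≤ T → Measurable (Function.uncurry (M.Gtilde (t + 1) (M.filtering t))))
    (hnorm : ∀ t, t + 1 ≤ T → ∀ x,
      ∫⁻ y, ENNReal.ofReal (M.Gtilde (t + 1) (M.filtering t) y x) ∂M.filtering t = 1)
    (hstep : ∀ t, t + 1 ≤ T → ∀ f : (Fin (t + 2) → State d) → ENNReal, Measurable f →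
      ∫⁻ x, f x ∂M.smoothing (t + 1) =
        ∫⁻ a, (∫⁻ y, f (snocState y a) *
          ENNReal.ofReal (M.Gtilde (t + 1) (M.filtering t) (y (Fin.last t)) a) ∂M.smoothing t)
          ∂M.filtering (t + 1))
    {K : ℕ → Kernel UI UI} [∀ t, IsMarkovKernel (K t)]
    (hK : ∀ t, t + 1 ≤ T → ∀ s, K (t + 1) s =
      (M.backward (t + 1) (M.filtering t) (H.toState s)).map h')
    {k : ℕ} (hk : k ≤ T) {g : State d → ENNReal} (hg : Measurable g)
    (hg1 : ∫⁻ x, g x ∂M.filtering k = 1) {f : (Fin (k + 1) → State d) → ENNReal}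
    (hf : Measurable f) :
    ∫⁻ u : Fin (k + 1) → UI, f (fun i => H.toState
        (backwardInv (((M.filtering k).withDensity g).map h') K u i)) =
      ∫⁻ x, f x * g (x (Fin.last k)) ∂M.smoothing k := by
  induction k generalizing g with
  | zero =>
    have hp : IsProbabilityMeasure ((M.filtering 0).withDensity g) := ⟨by
      rw [withDensity_apply _ MeasurableSet.univ, Measure.restrict_univ, hg1]⟩
    have hp' : IsProbabilityMeasure (((M.filtering 0).withDensity g).map h') :=
      Measure.isProbabilityMeasure_map hm.aemeasurable
    set Q := ((M.filtering 0).withDensity g).map h' with hQ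
    have hev : MeasurePreserving (Function.eval 0) (volume : Measure (Fin 1 → UI)) volume :=
      measurePreserving_eval (fun _ : Fin 1 => (volume : Measure UI)) 0
    have hconst : Measurable fun x : State d => fun _ : Fin 1 => x :=
      measurable_pi_lambda _ fun _ => measurable_id
    have hfc : Measurable fun s : UI => f (fun _ => H.toState s) :=
      (hf.comp hconst).comp H.measurable_toState
    have e1 : ∀ u : Fin 1 → UI, f (fun i => H.toState (backwardInv Q K u i)) =
        (fun a : UI => f (fun _ => H.toState (quantile Q a))) (Function.eval 0 u) := fun u => by
      congr 1
      funext i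
      rw [show i = Fin.last 0 from Fin.ext (by omega), backwardInv_last]
      rfl
    have hf0 : Measurable fun x : State d => f (fun _ => x) := hf.comp hconst
    rw [lintegral_congr e1, hev.lintegral_comp
        (f := fun a : UI => f (fun _ => H.toState (quantile Q a)))
        (hfc.comp (measurable_quantile_const Q)),
      ← lintegral_map (f := fun s => f (fun _ => H.toState s)) hfc (measurable_quantile_const Q),
      map_quantile_volume, hQ, lintegral_map hfc hm,
      lintegral_withDensity_eq_lintegral_mul _ hg
        (g := fun x => f (fun _ => H.toState (h' x))) (hfc.comp hm)]
    have e2 : ∀ᵐ x ∂M.filtering 0, (g * fun x => f (fun _ => H.toState (h' x))) x =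
        f (fun _ => x) * g x := by
      filter_upwards [(hac 0 hk).ae_le hae] with x hx
      rw [Pi.mul_apply, hx, HilbertOrder.toState_pseudoInverse hh, mul_comm]
    rw [lintegral_congr_ae e2]
    refine (M.lintegral_filtering 0 (hf0.mul hg)).trans ?_
    simp only [Pi.mul_apply]
    refine lintegral_congr fun y => ?_
    rw [show (fun _ => y (Fin.last 0)) = y from
      funext fun i => by rw [show i = Fin.last 0 from Fin.ext (by omega)]]
  | succ k ih =>
    have hp : IsProbabilityMeasure ((M.filtering (k + 1)).withDensity g) := ⟨by
      rw [withDensity_apply _ MeasurableSet.univ, Measure.restrict_univ, hg1]⟩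
    have hp' : IsProbabilityMeasure (((M.filtering (k + 1)).withDensity g).map h') :=
      Measure.isProbabilityMeasure_map hm.aemeasurable
    have hps := hprob k (by omega)
    set Q := ((M.filtering (k + 1)).withDensity g).map h' with hQ
    let Φ : UI × (Fin (k + 1) → UI) → Fin (k + 2) → State d := fun q =>
      snocState (fun i => H.toState (backwardInv (K (k + 1) q.1) K q.2 i)) (H.toState q.1)
    have hΦ : Measurable Φ := by
      refine measurable_snocState.comp (Measurable.prodMk ?_
        (H.measurable_toState.comp measurable_fst))
      exact measurable_pi_lambda _ fun i => H.measurable_toState.comp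
        ((measurable_pi_apply i).comp (measurable_backwardInv_kernel (K (k + 1)) K))
    have e1 : ∀ u : Fin (k + 2) → UI, f (fun i => H.toState (backwardInv Q K u i)) =
        (fun q : UI × (Fin (k + 1) → UI) => f (Φ (quantile Q q.1, q.2)))
          (u (Fin.last (k + 1)), fun j => u j.castSucc) := fun u => by
      congr 1
      funext i
      refine Fin.lastCases ?_ (fun i => ?_) i
      · simp only [Φ, snocState_last, backwardInv_last]
      · simp only [Φ, snocState_castSucc, backwardInv_castSucc_eq]
    have hq := measurable_quantile_const Q
    have hΘ : Measurable fun s : UI => ∫⁻ r : Fin (k + 1) → UI, f (Φ (s, r)) :=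
      (hf.comp hΦ).lintegral_prod_right'
    have hfΦ : Measurable fun q : UI × (Fin (k + 1) → UI) => f (Φ (quantile Q q.1, q.2)) :=
      (hf.comp hΦ).comp ((hq.comp measurable_fst).prodMk measurable_snd)
    rw [lintegral_congr e1, lintegral_volume_snoc hfΦ,
      ← lintegral_map (f := fun s => ∫⁻ r : Fin (k + 1) → UI, f (Φ (s, r))) hΘ hq,
      map_quantile_volume, hQ, lintegral_map hΘ hm,
      lintegral_withDensity_eq_lintegral_mul _ hg
        (g := fun x => ∫⁻ r : Fin (k + 1) → UI, f (Φ (h' x, r))) (hΘ.comp hm),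
      hstep k hk (fun x => f x * g (x (Fin.last (k + 1))))
        (hf.mul (hg.comp (measurable_pi_apply _)))]
    refine lintegral_congr_ae ?_
    filter_upwards [(hac (k + 1) hk).ae_le hae] with x hx
    have hGx : Measurable fun y => ENNReal.ofReal (M.Gtilde (k + 1) (M.filtering k) y x) :=
      ((hGm k hk).comp measurable_prodMk_right).ennreal_ofReal
    have hfx : Measurable fun y : Fin (k + 1) → State d => f (snocState y x) :=
      hf.comp (measurable_snocState.comp measurable_prodMk_right)
    have hts : H.toState (h' x) = x := by rw [hx, HilbertOrder.toState_pseudoInverse hh]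
    have e2 := ih (by omega) hGx (hnorm k hk x) hfx
    have e3 : ∫⁻ r : Fin (k + 1) → UI, f (Φ (h' x, r)) = ∫⁻ y, f (snocState y x) *
        ENNReal.ofReal (M.Gtilde (k + 1) (M.filtering k) (y (Fin.last k)) x) ∂M.smoothing k := by
      rw [← e2]
      refine lintegral_congr fun r => ?_
      simp only [Φ]
      rw [hts, hK k hk, hts]
      rfl
    have hGl : Measurable fun y : Fin (k + 1) → State d => f (snocState y x) *
        ENNReal.ofReal (M.Gtilde (k + 1) (M.filtering k) (y (Fin.last k)) x) :=
      hfx.mul (hGx.comp (measurable_pi_apply (Fin.last k)))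
    simp only [Pi.mul_apply, snocState_last]
    rw [e3, ← lintegral_const_mul _ hGl]
    exact lintegral_congr fun y => by ring

end

/-! ### Convergence of the particle backward kernels -/

noncomputable section

theorem weightedDirac_withDensity_real {α : Type} [MeasurableSpace α] [MeasurableSingletonClass α]
    {N : ℕ} {w : Fin N → ℝ} {p : Fin N → α} (hw : ∀ n, 0 ≤ w n) {g : α → ℝ} (hg : ∀ y, 0 ≤ g y)
    {s : Set α} (hs : MeasurableSet s) :
    ((weightedDirac w p).withDensity fun y => ENNReal.ofReal (g y)).real s =
      ∑ n, w n * (s.indicator 1 (p n) * g (p n)) := by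
  have hnn : ∀ n, 0 ≤ s.indicator (1 : α → ℝ) (p n) * g (p n) := fun n =>
    mul_nonneg (Set.indicator_nonneg (fun _ _ => zero_le_one) _) (hg _)
  rw [measureReal_def, withDensity_apply _ hs, ← lintegral_indicator hs, lintegral_weightedDirac]
  have : ∀ n, ENNReal.ofReal (w n) * s.indicator (fun y => ENNReal.ofReal (g y)) (p n) =
      ENNReal.ofReal (w n * (s.indicator 1 (p n) * g (p n))) := fun n => by
    rw [ENNReal.ofReal_mul (hw n)]
    by_cases hn : p n ∈ s <;> simp [hn]
  rw [Finset.sum_congr rfl fun n _ => this n,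
    ← ENNReal.ofReal_sum_of_nonneg fun n _ => mul_nonneg (hw n) (hnn n),
    ENNReal.toReal_ofReal (Finset.sum_nonneg fun n _ => mul_nonneg (hw n) (hnn n))]

theorem normalizeMeasure_univ_le_one {α : Type} [MeasurableSpace α] (μ : Measure α) :
    normalizeMeasure μ Set.univ ≤ 1 := by
  rw [normalizeMeasure, Measure.smul_apply, smul_eq_mul]
  exact ENNReal.inv_mul_le_one _

theorem normalizeMeasure_real {α : Type} [MeasurableSpace α] (μ : Measure α) (s : Set α) :
    (normalizeMeasure μ).real s = μ.real s / μ.real Set.univ := by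
  rw [normalizeMeasure, measureReal_ennreal_smul_apply, ENNReal.toReal_inv, measureReal_def,
    measureReal_def, div_eq_inv_mul]

namespace FeynmanKac

variable {d : ℕ} {M : FeynmanKac d} {H : HilbertOrder d} {h h' : State d → UI}

/-- In the particle backward kernel the function `m_t G_t` may be replaced by `G̃_t`, from which it
differs by a factor that depends only on the conditioning state. -/
theorem cdfUI_backwardHilbert (hh : ∀ x j, H.curve (h x) j = (x j : ℝ)) {N t : ℕ} (ht : 1 ≤ t)
    {W : Fin N → ℝ} (hW : ∀ n, 0 ≤ W n) (x : Fin N → State d) (Q : Measure (State d)) {s : UI}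
    (hne : ∫ y, M.mG t y (H.toState s) ∂Q ≠ 0) (b : UI) :
    cdfUI (M.backwardHilbert H t (weightedDirac W fun n => h (x n)) s) b =
      (∑ n, W n * ((Set.Iic b).indicator 1 (h (x n)) * M.Gtilde t Q (x n) (H.toState s))) /
        ∑ n, W n * M.Gtilde t Q (x n) (H.toState s) := by
  have hnn : ∀ s', 0 ≤ M.mG t (H.toState s') (H.toState s) := fun s' => M.mG_nonneg ht _ _
  have e := fun S hS => weightedDirac_withDensity_real (p := fun n => h (x n)) hW hnn (s := S) hS
  rw [cdfUI, backwardHilbert, normalizeMeasure_real]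
  refine (congrArg₂ (· / ·) (e _ measurableSet_Iic) (e _ MeasurableSet.univ)).trans ?_
  simp only [HilbertOrder.toState_pseudoInverse hh, Set.indicator_univ, Pi.one_apply, one_mul,
    Gtilde_eq, ← mul_div_assoc]
  rw [← Finset.sum_div, ← Finset.sum_div, div_div_div_cancel_right₀ hne]

/-- The particle backward kernels converge continuously on the domain of the curve. Their CDFs are
ratios of weighted sums of `G̃`, which converge jointly in `N` and in the conditioning state; the
denominators tend to one. -/
theorem tendsto_cdfUI_backwardHilbert (hd : 0 < d) (hh : ∀ x j, H.curve (h x) j = (x j : ℝ))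
    (hm : Measurable h') (hae : h' =ᵐ[volume] h) {t : ℕ} (ht : 1 ≤ t)
    {W : ∀ N : ℕ, Fin N → ℝ} {x : ∀ N : ℕ, Fin N → State d} {Q : Measure (State d)}
    [IsProbabilityMeasure Q] (hQ : Q ≪ volume) (hw : WeakConv atTop W x Q)
    (hcont : Continuous (Function.uncurry (M.Gtilde t Q))) {C : ℝ}
    (hC : ∀ z' z, |M.Gtilde t Q z' z| ≤ C) (hne : ∀ z, ∫ y, M.mG t y z ∂Q ≠ 0)
    (hnorm : ∀ z, ∫⁻ y, ENNReal.ofReal (M.Gtilde t Q y z) ∂Q = 1)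
    {I : Type*} {l : Filter I} {N : I → ℕ} (hN : Tendsto N l atTop) {s : I → UI} {s₀ : UI}
    (hs₀ : s₀ ∈ H.domain) (hs : Tendsto s l (𝓝 s₀)) (b : UI) :
    Tendsto (fun i => cdfUI
        (M.backwardHilbert H t (weightedDirac (W (N i)) fun n => h (x (N i) n)) (s i)) b) l
      (𝓝 (cdfUI ((M.backward t Q (H.toState s₀)).map h') b)) := by
  set z₀ := H.toState s₀ with hz₀
  have hz : Tendsto (fun i => (N i, H.toState (s i))) l (atTop ×ˢ 𝓝 z₀) :=
    hN.prodMk ((HilbertOrder.continuousAt_toState H hs₀).tendsto.comp hs)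
  have hw' : WeakConv (atTop ×ˢ 𝓝 z₀) (fun q : ℕ × State d => W q.1) (fun q => x q.1) Q :=
    hw.comp tendsto_fst
  have hG₀ : Continuous fun y => M.Gtilde t Q y z₀ := hcont.comp (Continuous.prodMk_left z₀)
  have hφ : ∀ y, Tendsto (fun q : (ℕ × State d) × State d => M.Gtilde t Q q.2 q.1.2)
      ((atTop ×ˢ 𝓝 z₀) ×ˢ 𝓝 y) (𝓝 (M.Gtilde t Q y z₀)) := fun y => by
    have h1 : Tendsto (fun q : (ℕ × State d) × State d => (q.2, q.1.2))
        ((atTop ×ˢ 𝓝 z₀) ×ˢ 𝓝 y) (𝓝 (y, z₀)) := by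
      rw [nhds_prod_eq]
      exact tendsto_snd.prodMk (tendsto_snd.comp tendsto_fst)
    exact (hcont.tendsto (y, z₀)).comp h1
  have hnum := (WeakConv.tendsto_sum_indicator_pseudoInverse hd hh hm hae hQ hw'
    (φ := fun q y => M.Gtilde t Q y q.2) (φ₀ := fun y => M.Gtilde t Q y z₀)
    (fun q y => hC y q.2) (fun y => hC y z₀) hG₀.measurable hφ b).comp hz
  have hden := (hw'.tendsto_sum (y := fun q n => M.Gtilde t Q (x q.1 n) q.2)
    (g := fun y => M.Gtilde t Q y z₀) (fun q n => hC _ _) (.of_forall fun y => hC y z₀)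
    hG₀.aestronglyMeasurable (.of_forall fun y => (hφ y).comp
      ((tendsto_fst_ptFilter _ _).prodMk (tendsto_point_ptFilter _ _)))).comp hz
  have hone : ∫ y, M.Gtilde t Q y z₀ ∂Q = 1 := by
    rw [integral_eq_lintegral_of_nonneg_ae (.of_forall fun y => M.Gtilde_nonneg ht Q y z₀)
      hG₀.aestronglyMeasurable, hnorm, ENNReal.toReal_one]
  have := hnum.div hden (by rw [hone]; exact one_ne_zero)
  rw [hone, div_one, ← cdfUI_map_withDensity hm hG₀.measurable
    (fun y => M.Gtilde_nonneg ht Q y z₀)] at this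
  refine this.congr fun i => ?_
  exact (cdfUI_backwardHilbert hh ht (hw.nonneg (N i)) (x (N i)) Q (hne _) b).symm

/-- Kernels that are uniformly close to the particle backward kernels on the domain of the curve
converge, at converging conditioning points, to the image of the limiting backward kernel. -/
theorem tendsto_cdfUI_kernel (hd : 0 < d) (hh : ∀ x j, H.curve (h x) j = (x j : ℝ))
    (hm : Measurable h') (hae : h' =ᵐ[volume] h) {t : ℕ} (ht : 1 ≤ t)
    {W : ∀ N : ℕ, Fin N → ℝ} {x : ∀ N : ℕ, Fin N → State d} {Q : Measure (State d)}
    [IsProbabilityMeasure Q] (hQ : Q ≪ volume) (hw : WeakConv atTop W x Q)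
    (hcont : Continuous (Function.uncurry (M.Gtilde t Q))) {C : ℝ}
    (hC : ∀ z' z, |M.Gtilde t Q z' z| ≤ C) (hne : ∀ z, ∫ y, M.mG t y z ∂Q ≠ 0)
    (hnorm : ∀ z, ∫⁻ y, ENNReal.ofReal (M.Gtilde t Q y z) ∂Q = 1)
    {K : ℕ → Kernel UI UI} [∀ N, IsMarkovKernel (K N)]
    (hK : Tendsto (fun N => ⨆ s : H.domain, extremeNormUI (K N s)
      (M.backwardHilbert H t (weightedDirac (W N) fun n => h (x N n)) s)) atTop (𝓝 0))
    {I : Type*} {l : Filter I} {N : I → ℕ} (hN : Tendsto N l atTop) {s : I → UI} {s₀ : UI}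
    (hs₀ : s₀ ∈ H.domain) (hs : Tendsto s l (𝓝 s₀)) {b : UI} (hb : 0 < (b : ℝ)) :
    Tendsto (fun i => cdfUI (K (N i) (s i)) b) l
      (𝓝 (cdfUI ((M.backward t Q (H.toState s₀)).map h') b)) := by
  have h1 := tendsto_cdfUI_backwardHilbert hd hh hm hae ht hQ hw hcont hC hne hnorm hN hs₀ hs b
  have hmass : ∀ N s, M.backwardHilbert H t (weightedDirac (W N) fun n => h (x N n)) s Set.univ
      ≤ 1 := fun N s => normalizeMeasure_univ_le_one _
  have h2 : Tendsto (fun i => cdfUI (K (N i) (s i)) b - cdfUI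
      (M.backwardHilbert H t (weightedDirac (W (N i)) fun n => h (x (N i) n)) (s i)) b) l
      (𝓝 0) := by
    refine squeeze_zero_norm' ?_ (hK.comp hN)
    filter_upwards [hs.eventually ((HilbertOrder.isOpen_domain H).mem_nhds hs₀)] with i hi
    have hfin : IsFiniteMeasure
        (M.backwardHilbert H t (weightedDirac (W (N i)) fun n => h (x (N i) n)) (s i)) :=
      ⟨(hmass _ _).trans_lt ENNReal.one_lt_top⟩
    refine (abs_cdfUI_sub_le _ _ hb).trans ?_
    refine le_ciSup (f := fun s : H.domain => extremeNormUI (K (N i) s)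
      (M.backwardHilbert H t (weightedDirac (W (N i)) fun n => h (x (N i) n)) s))
      ⟨1, ?_⟩ ⟨s i, hi⟩
    rintro _ ⟨s', rfl⟩
    exact extremeNormUI_le_one prob_le_one (hmass _ _)
  simpa using h2.add h1

/-- The backward kernel, transported to `[0,1)` by the pseudo-inverse of the Hilbert curve. -/
theorem exists_kernel_backward (H : HilbertOrder d) (hm : Measurable h') {t : ℕ}
    {Q : Measure (State d)} [IsProbabilityMeasure Q]
    (hG : Measurable (Function.uncurry (M.Gtilde t Q)))
    (hnorm : ∀ z, ∫⁻ y, ENNReal.ofReal (M.Gtilde t Q y z) ∂Q = 1) :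
    ∃ κ : Kernel UI UI, IsMarkovKernel κ ∧
      ∀ s, κ s = (M.backward t Q (H.toState s)).map h' := by
  have hf : Measurable (Function.uncurry fun z y : State d => ENNReal.ofReal (M.Gtilde t Q y z)) :=
    (hG.comp measurable_swap).ennreal_ofReal
  let κ : Kernel UI UI :=
    (((Kernel.const (State d) Q).withDensity fun z y => ENNReal.ofReal (M.Gtilde t Q y z)).comap
      H.toState (HilbertOrder.measurable_toState H)).map h'
  have hκ : ∀ s, κ s = (M.backward t Q (H.toState s)).map h' := fun s => by
    rw [Kernel.map_apply _ hm, Kernel.comap_apply, Kernel.withDensity_apply _ hf,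
      Kernel.const_apply, backward]
  refine ⟨κ, ⟨fun s => ?_⟩, hκ⟩
  have : IsProbabilityMeasure (M.backward t Q (H.toState s)) := ⟨by
    rw [backward, withDensity_apply _ MeasurableSet.univ, Measure.restrict_univ, hnorm]⟩
  rw [hκ]
  exact Measure.isProbabilityMeasure_map hm.aemeasurable

end FeynmanKac

end

/-! ### Convergence of the backward passes -/

noncomputable section

variable {d T : ℕ} {M : FeynmanKac d} {H : HilbertOrder d} {h h' : State d → UI}

theorem measurable_coe_path :
    Measurable fun (y : Fin (T + 1) → State d) (p : Fin (T + 1) × Fin d) => (y p.1 p.2 : ℝ) := by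
  fun_prop

/-- The law of the limit of the backward passes is the smoothing distribution. Good points are
needed because the curve and `toState` agree on the domain only. -/
theorem map_backwardInv_curve (hh : ∀ x j, H.curve (h x) j = (x j : ℝ)) (hm : Measurable h')
    (hae : h' =ᵐ[volume] h) (hac : ∀ t ≤ T, M.filtering t ≪ volume)
    (hprob : ∀ t ≤ T, IsProbabilityMeasure (M.smoothing t))
    (hGm : ∀ t, t + 1 ≤ T → Measurable (Function.uncurry (M.Gtilde (t + 1) (M.filtering t))))
    (hnorm : ∀ t, t + 1 ≤ T → ∀ x,
      ∫⁻ y, ENNReal.ofReal (M.Gtilde (t + 1) (M.filtering t) y x) ∂M.filtering t = 1)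
    (hstep : ∀ t, t + 1 ≤ T → ∀ f : (Fin (t + 2) → State d) → ENNReal, Measurable f →
      ∫⁻ x, f x ∂M.smoothing (t + 1) =
        ∫⁻ a, (∫⁻ y, f (snocState y a) *
          ENNReal.ofReal (M.Gtilde (t + 1) (M.filtering t) (y (Fin.last t)) a) ∂M.smoothing t)
          ∂M.filtering (t + 1))
    {K : ℕ → Kernel UI UI} [∀ t, IsMarkovKernel (K t)]
    (hK : ∀ t, t + 1 ≤ T → ∀ s, K (t + 1) s =
      (M.backward (t + 1) (M.filtering t) (H.toState s)).map h')
    (hgood : ∀ᵐ u : Fin (T + 1) → UI, backwardGood H.domain ((M.filtering T).map h') K u) :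
    (volume : Measure (Fin (T + 1) → UI)).map (fun u (p : Fin (T + 1) × Fin d) =>
        H.curve (backwardInv ((M.filtering T).map h') K u p.1) p.2) =
      (M.smoothing T).map fun y (p : Fin (T + 1) × Fin d) => (y p.1 p.2 : ℝ) := by
  have hpT := hprob T le_rfl
  have hp' : IsProbabilityMeasure ((M.filtering T).map h') :=
    Measure.isProbabilityMeasure_map hm.aemeasurable
  have hΨ : Measurable fun (u : Fin (T + 1) → UI) (p : Fin (T + 1) × Fin d) =>
      H.curve (backwardInv ((M.filtering T).map h') K u p.1) p.2 :=
    measurable_pi_lambda _ fun p => (measurable_pi_apply p.2).comp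
      ((HilbertOrder.continuous_curve H).measurable.comp
        ((measurable_pi_apply p.1).comp (measurable_backwardInv _ K)))
  refine Measure.ext_of_lintegral _ fun f hf => ?_
  rw [lintegral_map hf hΨ, lintegral_map hf measurable_coe_path]
  have key := lintegral_toState_backwardInv hh hm hae hac hprob hGm hnorm hstep hK le_rfl
    (g := 1) measurable_one (by simp) (hf.comp measurable_coe_path)
  rw [withDensity_one] at key
  refine Eq.trans (lintegral_congr_ae ?_) (key.trans (lintegral_congr fun y => ?_))
  · filter_upwards [hgood] with u hu
    refine congrArg f (funext fun p => ?_)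
    exact (HilbertOrder.toState_apply H (hu.1 p.1) p.2).symm
  · simp

/-- The smoothing distribution does not charge hyperplanes, as the filtering distributions have
densities. -/
theorem smoothing_map_hyperplane (hac : ∀ t ≤ T, M.filtering t ≪ volume)
    (hprob : ∀ t ≤ T, IsProbabilityMeasure (M.smoothing t)) (i : Fin (T + 1) × Fin d) (c : ℝ) :
    ((M.smoothing T).map fun y (p : Fin (T + 1) × Fin d) => (y p.1 p.2 : ℝ)) {x | x i = c} =
      0 := by
  have hc : MeasurableSet {x : Fin (T + 1) × Fin d → ℝ | x i = c} :=
    (measurableSet_singleton c).preimage (measurable_pi_apply i)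
  rw [Measure.map_apply measurable_coe_path hc]
  refine M.smoothing_preimage_eq_zero hprob (E := {z : State d | (z i.2 : ℝ) = c}) ?_
    (fun t ht => hac t ht (volume_hyperplane i.2 c)) le_rfl i.1
  exact (measurableSet_singleton c).preimage
    (measurable_subtype_coe.comp (measurable_pi_apply i.2))

end

theorem mainTheorem8 {d T : ℕ} (hd : 0 < d)
    -- the model, the Hilbert curve with `H(0) = 0`, and its pseudo-inverse
    (M : FeynmanKac d) (H : HilbertOrder d)
    (hH : ∀ s : UI, (s : ℝ) = 0 → ∀ j, H.curve s j = 0)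
    (h : State d → UI) (hh : ∀ x j, H.curve (h x) j = (x j : ℝ))
    -- conditional distributions for `m_0` and for `m_t(x', dx)`
    (κ₀ : CondLaws d) (κ : ℕ → State d → CondLaws d)
    -- the point sets of the forward pass
    (u₀ : ∀ N : ℕ, Fin N → Fin d → UI) (u : ∀ N : ℕ, ℕ → Fin N → Fin (d + 1) → UI)
    (hu₀ : Tendsto (fun N => discrepancy (u₀ N)) atTop (𝓝 0))
    (hu : ∀ t, 1 ≤ t → t ≤ T → Tendsto (fun N => discrepancy (u N t)) atTop (𝓝 0))
    (hu_sorted : ∀ N t, 1 ≤ t → t ≤ T → Monotone fun n => u N t n 0)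
    -- the particles and weights of the forward pass
    (x : ∀ N : ℕ, ℕ → Fin N → State d) (W : ∀ N : ℕ, ℕ → Fin N → ℝ)
    (hx : ∀ N t, x N t = (sqmc M κ₀ κ h (u₀ N) (u N) t).1)
    (hW : ∀ N t, W N t = (sqmc M κ₀ κ h (u₀ N) (u N) t).2)
    -- the particles are pairwise distinct
    (hdist : ∀ N t, t ≤ T → Function.Injective (x N t))
    -- the potentials are continuous and bounded
    (hG₀ : Continuous M.G₀ ∧ ∃ C, ∀ z, M.G₀ z ≤ C)
    (hG : ∀ t, 1 ≤ t → t ≤ T →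
      Continuous (Function.uncurry (M.G t)) ∧ ∃ C, ∀ z' z, M.G t z' z ≤ C)
    -- regularity of the Rosenblatt transforms of `m_0` and of `m_t`
    (hm₀ : RosenblattRegular (fun _ => M.init) (fun _ => κ₀) ∧ BoundedCondDensities fun _ => κ₀)
    (hm : ∀ t, 1 ≤ t → t ≤ T →
      RosenblattRegular (M.transition t) (κ t) ∧ BoundedCondDensities (κ t))
    -- `Q_t` has a strictly positive bounded density
    (hQ : ∀ t, t ≤ T → ∃ p : State d → ℝ, Measurable p ∧ (∀ z, 0 < p z) ∧ (∃ C, ∀ z, p z ≤ C) ∧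
      M.filtering t = volume.withDensity fun z => ENNReal.ofReal (p z))
    -- `G̃_t`, normalised with `Q_{t-1}`, is continuous and bounded
    (hH1 : ∀ t, 1 ≤ t → t ≤ T →
      Continuous (Function.uncurry (M.Gtilde t (M.filtering (t - 1)))) ∧
      ∃ C, ∀ z' z, |M.Gtilde t (M.filtering (t - 1)) z' z| ≤ C)
    -- regularity of the Rosenblatt transform of the backward kernel of `Q_{t-1}`
    (hH2 : ∀ t, 1 ≤ t → t ≤ T →
      ∃ ρ : State d → CondLaws d, RosenblattRegular (M.backward t (M.filtering (t - 1))) ρ)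
    -- the CDF of the backward kernel is Hölder continuous
    (hcdf : ∀ t, 1 ≤ t → t ≤ T →
      IsHolder fun p : State d × State d =>
        (M.backward t (M.filtering (t - 1)) p.1).real (Set.Iic p.2))
    -- the continuous approximation of the image by `h` of the particle approximation of `Q_T`
    (Qc : ℕ → Measure UI) (hQc_prob : ∀ N, IsProbabilityMeasure (Qc N))
    (hQc_cont : ∀ N, 1 ≤ N → Continuous (cdfUI (Qc N)))
    (hQc_strict : ∀ N, 1 ≤ N → StrictCDFUpTo (Qc N) (⨆ n, (h (x N T n) : ℝ)))
    (hQc : Tendsto (fun N => extremeNormUI (Qc N)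
      (weightedDirac (W N T) fun n => h (x N T n))) atTop (𝓝 0))
    -- the continuous approximations of the backward kernels
    (K : ℕ → ℕ → Kernel UI UI) (hK_markov : ∀ N t, IsMarkovKernel (K N t))
    (hK_cont : ∀ N t, 1 ≤ N → 1 ≤ t → t ≤ T →
      ContinuousOn (fun p : UI × UI => cdfUI (K N t p.1) p.2)
        (H.domain ×ˢ {s : UI | (s : ℝ) ≤ ⨆ n, (h (x N (t - 1) n) : ℝ)}))
    (hK_strict : ∀ N t, 1 ≤ N → 1 ≤ t → t ≤ T →
      ∀ s, StrictCDFUpTo (K N t s) (⨆ n, (h (x N (t - 1) n) : ℝ)))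
    (hK : ∀ t, 1 ≤ t → t ≤ T →
      Tendsto (fun N => ⨆ s : H.domain, extremeNormUI (K N t s)
        (M.backwardHilbert H t (weightedDirac (W N (t - 1)) fun n => h (x N (t - 1) n)) s))
        atTop (𝓝 0))
    -- the point sets of the backward pass
    (v : ∀ N : ℕ, Fin N → Fin (T + 1) → UI)
    (hv : Tendsto (fun N => discrepancy (v N)) atTop (𝓝 0)) :
    Tendsto (fun N => extremeNorm
      (empirical fun (n : Fin N) (p : Fin (T + 1) × Fin d) =>
        H.curve (backwardInv (Qc N) (K N) (v N n) p.1) p.2)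
      ((M.smoothing T).map fun y (p : Fin (T + 1) × Fin d) => (y p.1 p.2 : ℝ)))
      atTop (𝓝 0) := by
  choose! p hp hpos _ hpQ using hQ
  have hprob : ∀ t ≤ T, IsProbabilityMeasure (M.smoothing t) := fun t ht =>
    M.isProbabilityMeasure_smoothing (hp t ht) (hpos t ht) (hpQ t ht)
  have hfprob : ∀ t ≤ T, IsProbabilityMeasure (M.filtering t) := fun t ht => by
    have := hprob t ht
    infer_instance
  have hac : ∀ t ≤ T, M.filtering t ≪ volume := fun t ht => by
    rw [hpQ t ht]; exact withDensity_absolutelyContinuous _ _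
  -- `h'` is a measurable modification of `h`. All limiting laws have densities, so that they do not
  -- see the difference.
  have haem := HilbertOrder.aemeasurable_pseudoInverse hd hh
  let h' := haem.mk
  have hm' : Measurable h' := haem.measurable_mk
  have hae : h' =ᵐ[volume] h := haem.ae_eq_mk.symm
  have hfwd : ∀ t ≤ T, WeakConv atTop (fun N => W N t) (fun N => x N t) (M.filtering t) :=
    fun t ht => by
      simp only [hx, hW]
      exact (weakConv_sqmc hd hh hm' hae hu₀ hu hG₀ hG hm₀ hm hprob hac ht).1
  -- The denominators of `G̃` do not vanish, and the backward kernels disintegrate the smoothing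
  -- distributions.
  have hcont : ∀ t, t + 1 ≤ T →
      Continuous (Function.uncurry (M.Gtilde (t + 1) (M.filtering t))) := fun t ht =>
    (hH1 (t + 1) (by omega) ht).1
  have hpred : ∀ t, t + 1 ≤ T → (∀ z, ∫ y, M.mG (t + 1) y z ∂M.filtering t ≠ 0) ∧
      ∀ f : (Fin (t + 2) → State d) → ENNReal, Measurable f →
      ∫⁻ x, f x ∂M.smoothing (t + 1) =
        ∫⁻ a, (∫⁻ y, f (snocState y a) *
          ENNReal.ofReal (M.Gtilde (t + 1) (M.filtering t) (y (Fin.last t)) a) ∂M.smoothing t)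
          ∂M.filtering (t + 1) := fun t ht => by
    have := hprob t (by omega)
    have := hprob (t + 1) ht
    obtain ⟨c, hc, hrec, hrec'⟩ := M.exists_lintegral_filtering_succ t
    have hden := M.filtering_succ_eq_withDensity hrec
    have hne := M.ae_predictive_ne hc hden (hp _ ht) (hpos _ ht) (hpQ _ ht)
    obtain ⟨C, hC⟩ := (hH1 (t + 1) (by omega) ht).2
    exact ⟨M.integral_mG_ne_zero hne (hcont t ht) hC, fun f hf =>
      M.lintegral_smoothing_succ_eq_backward hrec' hden hne (hcont t ht).measurable hf⟩
  have hnorm : ∀ t, t + 1 ≤ T → ∀ z,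
      ∫⁻ y, ENNReal.ofReal (M.Gtilde (t + 1) (M.filtering t) y z) ∂M.filtering t = 1 :=
    fun t ht z => M.lintegral_Gtilde ((hpred t ht).1 z)
  -- The limits of the laws and kernels used in the backward passes.
  have hpT := hfprob T le_rfl
  set Q := (M.filtering T).map h' with hQdef
  have hpQ' : IsProbabilityMeasure Q := Measure.isProbabilityMeasure_map hm'.aemeasurable
  have hQdom : ∀ᵐ s ∂Q, s ∈ H.domain := map_pseudoInverse_domain hh hm' hae (hac T le_rfl)
  have hex : ∀ t, ∃ κ : Kernel UI UI, IsMarkovKernel κ ∧ (∀ s, ∀ᵐ s' ∂κ s, s' ∈ H.domain) ∧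
      (t + 1 ≤ T → ∀ s, κ s = (M.backward (t + 1) (M.filtering t) (H.toState s)).map h') :=
    fun t => by
    by_cases ht : t + 1 ≤ T
    · have := hfprob t (by omega)
      obtain ⟨κ', hκ', e⟩ := FeynmanKac.exists_kernel_backward H hm' (hcont t ht).measurable
        (hnorm t ht)
      refine ⟨κ', hκ', fun s => ?_, fun _ => e⟩
      rw [e]
      exact map_pseudoInverse_domain hh hm' hae
        ((withDensity_absolutelyContinuous _ _).trans (hac t (by omega)))
    · exact ⟨Kernel.const UI Q, inferInstance, fun s => by simpa using hQdom,
        fun h => absurd h ht⟩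
  choose L hL hLdom hLeq using hex
  -- `L t` is the kernel at time `t + 1`; the value at time zero is not used.
  let K₀ : ℕ → Kernel UI UI := fun t => L (t - 1)
  have hK₀ : ∀ t, IsMarkovKernel (K₀ t) := fun t => hL (t - 1)
  have hK₀eq : ∀ t, t + 1 ≤ T → ∀ s,
      K₀ (t + 1) s = (M.backward (t + 1) (M.filtering t) (H.toState s)).map h' := hLeq
  have hgood := ae_backwardGood (T := T) (HilbertOrder.isOpen_domain H).measurableSet Q K₀ hQdom
    fun t => hLdom (t - 1)
  have hlaw := map_backwardInv_curve hh hm' hae hac hprob (fun t ht => (hcont t ht).measurable)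
    hnorm (fun t ht => (hpred t ht).2) hK₀eq hgood
  -- Convergence of the laws from which the backward passes start.
  have hQlim : ∀ a ∈ ratUI, Tendsto (fun N => cdfUI (Qc N) a) atTop (𝓝 (cdfUI Q a)) :=
    fun a ha => by
    have h1 := (hfwd T le_rfl).tendsto_weightedCDF hd hh hm' hae (hac T le_rfl) a
    have h2 : Tendsto (fun N => cdfUI (Qc N) a - weightedCDF (W N T) (fun n => h (x N T n)) a)
        atTop (𝓝 0) := by
      refine squeeze_zero_norm (fun N => ?_) hQc
      have e : weightedCDF (W N T) (fun n => h (x N T n)) a =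
          cdfUI (weightedDirac (W N T) fun n => h (x N T n)) a :=
        (weightedDirac_real (fun n => (hfwd T le_rfl).nonneg N n) measurableSet_Iic).symm
      rw [e]
      exact abs_cdfUI_sub_le _ _ ha.1
    simpa using h2.add h1
  have hKlim : ∀ u₁ : Fin (T + 1) → UI, ∀ t, 1 ≤ t → t ≤ T →
      ∀ (s : (Σ N : ℕ, Fin N) → UI) (s₀ : UI), s₀ ∈ H.domain →
      Tendsto s (ptFilter atTop v u₁) (𝓝 s₀) → ∀ a ∈ ratUI,
      Tendsto (fun i => cdfUI (K i.1 t (s i)) a) (ptFilter atTop v u₁)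
        (𝓝 (cdfUI (K₀ t s₀) a)) := fun u₁ t ht1 ht s s₀ hs₀ hs a ha => by
    obtain ⟨t, rfl⟩ := Nat.exists_eq_add_of_le' ht1
    have := hfprob t (by omega)
    have := fun N => hK_markov N (t + 1)
    obtain ⟨C, hC⟩ := (hH1 (t + 1) ht1 ht).2
    rw [hK₀eq t ht]
    exact FeynmanKac.tendsto_cdfUI_kernel hd hh hm' hae ht1 (hac t (by omega))
      (hfwd t (by omega)) (hcont t ht) hC (hpred t ht).1 (hnorm t ht) (hK (t + 1) ht1 ht)
      (tendsto_fst_ptFilter v u₁) hs₀ hs ha.1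
  -- The backward passes converge at almost every point, and hence so do their laws.
  have hconv : WeakConv atTop (fun N (_ : Fin N) => (N : ℝ)⁻¹)
      (fun N n (p : Fin (T + 1) × Fin d) =>
        H.curve (backwardInv (Qc N) (K N) (v N n) p.1) p.2)
      ((M.smoothing T).map fun y (p : Fin (T + 1) × Fin d) => (y p.1 p.2 : ℝ)) := by
    rw [← hlaw]
    refine (weakConv_of_discrepancy hv).map ?_ ?_
    · exact measurable_pi_lambda _ fun p => (measurable_pi_apply p.2).comp
        ((HilbertOrder.continuous_curve H).measurable.comp
          ((measurable_pi_apply p.1).comp (measurable_backwardInv _ K₀)))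
    · filter_upwards [hgood] with u₁ hu₁
      refine tendsto_pi_nhds.2 fun q => ?_
      have h1 := tendsto_backwardInv (l := ptFilter atTop v u₁) (Q := fun i => Qc i.1)
        (K := fun i => K i.1) (fun a ha => (hQlim a ha).comp (tendsto_fst_ptFilter v u₁))
        (hKlim u₁) (tendsto_point_ptFilter v u₁) hu₁ q.1
      exact ((tendsto_pi_nhds.1 (((HilbertOrder.continuous_curve H).tendsto _).comp h1)) q.2)
  have hpS := hprob T le_rfl
  have hpM : IsProbabilityMeasure
      ((M.smoothing T).map fun y (p : Fin (T + 1) × Fin d) => (y p.1 p.2 : ℝ)) :=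
    Measure.isProbabilityMeasure_map measurable_coe_path.aemeasurable
  simp only [empirical_eq_weightedDirac]
  exact hconv.tendsto_extremeNorm (smoothing_map_hyperplane hac hprob)
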